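/- There are finitely many players. Player $i$ has an unknown state vector $\theta^i\in\mathbb R^K$ ($K\ge 1$) and access to $K$ signals $X^i_k=\langle c^i_k,\theta^i\rangle+\epsilon^i_k$ with standard normal noise. Let $V^i$ be a positive definite matrix (the prior covariance of $\theta^i$) and $C^i$ the matrix with rows $c^i_k$. Assume that $C^i$ is invertible and that the first row of $(C^i)^{-1}$ has no zero entry. For $q\in\mathbb Z_+^K$ let $f^i(q)=\big[((V^i)^{-1}+(C^i)'\,\mathrm{diag}(q)\,C^i)^{-1}\big]_{11}$ be the posterior variance of $\theta^i_1$ after $q_k$ observations of each signal $X^i_k$. The environment $(V^i,C^i)$ is separable if $f^i(q)=F(g_1(q_1)+\dots+g_K(q_K))$ for some convex functions $g_1,\dots,g_K$ of the signal counts, with values in $(-\infty,+\infty]$, and some function $F$ that is strictly increasing on the values of the sum. Given the environments, there is a $B_0$ such that the following holds for every $B\ge 1$ with $B\ge B_0$, and for every $B\ge1$ if the environments of all players are separable. Let $\omega\in\mathbb R$ and $(\theta^i)_i$ have any common prior under which each $\theta^i$ is Gaussian with covariance $V^i$ and, for each $i$, conditional on $\theta^i_1$, the pair $(\omega,(\theta^j)_{j\neq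 i})$ is independent of $\theta^i$. In each of the periods $1,2,\dots$ up to and including a random final period, each player privately chooses $B$ of his signals (repetitions allowed), as a measurable function of his past realizations, and privately observes independent realizations of them. The final period has an arbitrary exogenous distribution on $\{1,2,\dots\}$, independent of everything else. In the final period each player $i$ chooses an action $a^i$ in a measurable space $A_i$, as a measurable function of his realizations, and receives $u_i(a,\omega)$, where $u_i$ is measurable and $a$ is the action profile. All choices may also depend on a private, independent, uniform randomization device. Acquisition is myopic if after every history the next $B$ signals minimize $f^i$ of the resulting counts among all multisets of $B$ signals. Expected payoffs take values in $[-\infty,\infty]$, those that do not exist counting as $-\infty$; in an equilibrium they are required to be finite. Then: 1. (Dominance) For each player $i$, each myopic acquisition strategy $S$ of $i$, all strategies of the opponents and each strategy of $i$, there is a decision strategy of $i$ which together with $S$ gives $i$ at least the same expected payoff against these opponents. 2. If all players acquire information myopically and no player gains by changing his decision strategy alone (that is, the decision strategies form an equilibrium of the game in which this myopic information is exogenous), then the strategies form a Nash equilibrium of the game, in which acquisition can be changed as well. 3. If all $A_i$ are finite and nonempty (with all subsets measurable) and $u_i(a,\omega)$ is integrable for all $i$ and all $a$, then there exists a Nash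 equilibrium in which every player acquires information myopically. -/

import Mathlib

open MeasureTheory ProbabilityTheory
open scoped Matrix

noncomputable section

namespace InfoGame

/-- The prior covariance matrix of one player's state vector and the matrix of signal coefficients.
Signal `k` is `⟨coeff k, θ⟩ + ε` with standard normal noise `ε`. The coordinate `0` of the state
vector is the state of interest (called `θ₁` on paper). -/
structure Environment (K : ℕ) where
  /-- Prior covariance matrix of the state vector. -/
  cov : Matrix (Fin K) (Fin K) ℝ
  /-- Coefficient matrix, with the signals as rows. -/
  coeff : Matrix (Fin K) (Fin K) ℝ

namespace Environment

variable {K : ℕ} [NeZero K]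

/-- The prior is nondegenerate, the coefficient matrix is invertible, and the first row of its
inverse has no zero entry (non-redundancy). -/
structure Regular (E : Environment K) : Prop where
  posDef : E.cov.PosDef
  invertible : IsUnit E.coeff.det
  nonredundant : ∀ k, E.coeff⁻¹ 0 k ≠ 0

/-- The posterior variance of `θ₁` after `q k` observations of each signal `k`: the entry `(0, 0)`
of the inverse of the posterior precision matrix `V⁻¹ + Cᵀ diag(q) C`. -/
def posteriorVariance (E : Environment K) (q : Fin K → ℕ) : ℝ :=
  (E.cov⁻¹ + E.coeffᵀ * Matrix.diagonal (fun k => (q k : ℝ)) * E.coeff)⁻¹ 0 0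

/-- For positive counts this is the usual conditional variance formula for Gaussian vectors,
where `q k` observations amount to one observation with noise variance `1 / q k`. -/
theorem posteriorVariance_eq (E : Environment K) (hE : E.Regular) (q : Fin K → ℕ)
    (hq : ∀ k, 0 < q k) :
    E.posteriorVariance q =
      (E.cov - E.cov * E.coeffᵀ * (E.coeff * E.cov * E.coeffᵀ
        + Matrix.diagonal (fun k => ((q k : ℝ))⁻¹))⁻¹ * E.coeff * E.cov) 0 0 := by
  have hV : IsUnit E.cov := hE.posDef.isUnit
  have hD : (Matrix.diagonal (fun k => (q k : ℝ))⁻¹).PosDef :=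
    Matrix.PosDef.diagonal fun k => by
      have := hq k
      simp only [Pi.inv_apply]
      positivity
  have hD' : (Matrix.diagonal (fun k => (q k : ℝ)))⁻¹ = Matrix.diagonal (fun k => (q k : ℝ))⁻¹ := by
    refine Matrix.inv_eq_right_inv ?_
    rw [Matrix.diagonal_mul_diagonal, ← Matrix.diagonal_one]
    congr 1
    ext k
    have : (q k : ℝ) ≠ 0 := by exact_mod_cast (hq k).ne'
    simp [this]
  have hU : IsUnit (Matrix.diagonal (fun k => (q k : ℝ))) := by
    have h := hD.isUnit
    rw [← hD'] at h
    exact Matrix.isUnit_nonsing_inv_iff.mp h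
  have hS : (E.coeff * E.cov * E.coeffᵀ).PosSemidef := by
    simpa [Matrix.conjTranspose_eq_transpose_of_trivial] using
      hE.posDef.posSemidef.mul_mul_conjTranspose_same E.coeff
  have hVV : (E.cov⁻¹)⁻¹ = E.cov :=
    Matrix.nonsing_inv_nonsing_inv _ ((Matrix.isUnit_iff_isUnit_det _).mp hV)
  have hW : IsUnit ((Matrix.diagonal (fun k => (q k : ℝ)))⁻¹
      + E.coeff * (E.cov⁻¹)⁻¹ * E.coeffᵀ) := by
    rw [hVV, hD']
    exact (hD.add_posSemidef hS).isUnit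
  rw [posteriorVariance, Matrix.add_mul_mul_inv_eq_sub _ _ _ _
    (Matrix.isUnit_nonsing_inv_iff.mpr hV) hU hW, hVV, hD', add_comm]
  rfl

/-- The environment is separable: the posterior variance function is a strictly increasing function
of a sum of convex functions of the individual signal counts. The convex functions may take the
value `+∞` (as does `σ² / q` at `q = 0`), and the outer function has to be defined and strictly
increasing only on the values that the sum takes. -/
def Separable (E : Environment K) : Prop :=
  ∃ (g : Fin K → ℕ → WithTop ℝ) (F : WithTop ℝ → ℝ),
    (∀ k n, g k (n + 1) + g k (n + 1) ≤ g k n + g k (n + 2)) ∧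
    StrictMonoOn F (Set.range fun q : Fin K → ℕ => ∑ k, g k (q k)) ∧
    ∀ q : Fin K → ℕ, E.posteriorVariance q = F (∑ k, g k (q k))

end Environment

/-- What a player has observed in `t` periods: `B` real signal realizations per period. -/
abbrev History (B t : ℕ) : Type := Fin t → Fin B → ℝ

/-- An information acquisition strategy: before each period, as a measurable function of the past
realizations (and of a private randomization device with values in `[0, 1]`, which a pure strategy
ignores), it names the `B` signals that are observed next; repetitions are allowed.
`choose t` is applied after `t` periods have passed. The player's own past choices
are themselves functions of these data. -/
structure Acquisition (K B : ℕ) where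
  choose : (t : ℕ) → unitInterval → History B t → Fin B → Fin K
  measurable_choose : ∀ t, Measurable fun p : unitInterval × History B t => choose t p.1 p.2

/-- A decision strategy: the action to be taken if period `t` is the final one, as a measurable
function of the realizations of periods `1, …, t` and of the randomization device. -/
structure Decision (B : ℕ) (A : Type*) [MeasurableSpace A] where
  act : (t : ℕ) → unitInterval → History B t → A
  measurable_act : ∀ t, Measurable fun p : unitInterval × History B t => act t p.1 p.2

/-- A strategy of a player in the dynamic game. -/
structure Strategy (K B : ℕ) (A : Type*) [MeasurableSpace A] where
  acquisition : Acquisition K B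
  decision : Decision B A

namespace Acquisition

variable {K B : ℕ}

/-- How often each signal occurs in a list of `B` signals. -/
def count (c : Fin B → Fin K) (k : Fin K) : ℕ := (Finset.univ.filter fun b => c b = k).card

/-- The division vector after the history `h`: how often each signal has been acquired. -/
def division (S : Acquisition K B) {t : ℕ} (r : unitInterval) (h : History B t) (k : Fin K) : ℕ :=
  ∑ s : Fin t, count (S.choose s r fun j => h (Fin.castLE s.isLt.le j)) k

/-- Myopic acquisition: after every history, the next `B` signals minimize, among all multisets of
`B` signals, the posterior variance of the state of interest at the end of the next period. -/
def IsMyopic [NeZero K] (E : Environment K) (S : Acquisition K B) : Prop :=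
  ∀ (t : ℕ) (r : unitInterval) (h : History B t) (c : Fin B → Fin K),
    E.posteriorVariance (S.division r h + count (S.choose t r h)) ≤
      E.posteriorVariance (S.division r h + count c)

/-- The history of the first `t` periods when the state vector is `θ`, the randomization device
shows `r`, and the noise terms are `e`; `e (t, b)` is the noise of the `b`-th observation in
period `t + 1`. -/
def history (S : Acquisition K B) (E : Environment K) (θ : EuclideanSpace ℝ (Fin K))
    (r : unitInterval) (e : ℕ × Fin B → ℝ) : (t : ℕ) → History B t
  | 0 => Fin.elim0
  | t + 1 => Fin.snoc (α := fun _ => Fin B → ℝ) (history S E θ r e t) fun b =>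
      (∑ l, E.coeff (S.choose t r (history S E θ r e t) b) l * θ l) + e (t, b)

end Acquisition

/-- All states: the payoff-relevant state `ω` and the state vectors of the players. -/
abbrev States (ι : Type*) (K : ℕ) : Type _ := ℝ × (ι → EuclideanSpace ℝ (Fin K))

/-- A common prior: a probability measure over all states under which the state vector of each
player `i` is Gaussian with the covariance matrix of the environment of `i`, and under which,
conditional on the state of interest `θ₁` of player `i`, the pair of `ω` and the other players'
state vectors is independent of the state vector of `i`. -/
structure IsCommonPrior {ι : Type*} [Fintype ι] {K : ℕ} [NeZero K] (E : ι → Environment K)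
    (P : Measure (States ι K)) [IsProbabilityMeasure P] : Prop where
  gaussian : ∀ i, ∃ m : EuclideanSpace ℝ (Fin K),
    P.map (fun x => x.2 i) = multivariateGaussian m (E i).cov
  condIndep : ∀ i, CondIndepFun
    (MeasurableSpace.comap (fun x : States ι K => x.2 i 0) inferInstance)
    (Measurable.comap_le (by fun_prop))
    (fun x : States ι K => (x.1, fun j : {j // j ≠ i} => x.2 j))
    (fun x : States ι K => x.2 i) P

/-- The data of the game that are not informational: the distribution of the final period and the
payoffs of the one-shot game played in that period. -/
structure Payoffs {ι : Type*} (A : ι → Type*) [∀ i, MeasurableSpace (A i)] where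
  /-- Distribution of the final period. -/
  final : PMF ℕ
  /-- The periods are numbered `1, 2, …`. -/
  final_zero : final 0 = 0
  /-- The payoff of player `i` from an action profile, given `ω`. -/
  u : ι → (∀ i, A i) → ℝ → ℝ
  measurable_u : ∀ i, Measurable fun p : (∀ i, A i) × ℝ => u i p.1 p.2

/-- The outcomes of nature: the final period, the states, and for each player the outcome of the
randomization device and the noise terms. -/
abbrev Outcome (ι : Type*) (K B : ℕ) : Type _ :=
  ℕ × States ι K × (ι → unitInterval × (ℕ × Fin B → ℝ))

/-- The final period, the states, the randomization devices (uniform) and the noise terms (standard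
normal) are all independent. -/
def nature {ι : Type*} [Fintype ι] {K : ℕ} (B : ℕ) (final : PMF ℕ) (P : Measure (States ι K)) :
    Measure (Outcome ι K B) :=
  final.toMeasure.prod (P.prod (Measure.pi fun _ : ι =>
    (volume : Measure unitInterval).prod
      (Measure.infinitePi fun _ : ℕ × Fin B => gaussianReal 0 1)))

section Game

variable {ι : Type*} [Fintype ι] [DecidableEq ι] {K B : ℕ} [NeZero K]
  {A : ι → Type*} [∀ i, MeasurableSpace (A i)]

/-- The action that player `i` takes in the final period. -/
def finalAction (E : ι → Environment K) (σ : ∀ i, Strategy K B (A i)) (x : Outcome ι K B) (i : ι) :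
    A i :=
  (σ i).decision.act x.1 (x.2.2 i).1
    ((σ i).acquisition.history (E i) (x.2.1.2 i) (x.2.2 i).1 (x.2.2 i).2 x.1)

/-- The realized payoff of player `i`. -/
def realizedPayoff (E : ι → Environment K) (G : Payoffs A) (σ : ∀ i, Strategy K B (A i)) (i : ι)
    (x : Outcome ι K B) : ℝ :=
  G.u i (finalAction E σ x) x.2.1.1

/-- The expected payoff of player `i`, with values in `[-∞, ∞]`: the integral of the positive part
minus that of the negative part. By the convention `∞ - ∞ = -∞`, a profile at which the expected
payoff does not exist counts as worst. -/
def expectedPayoff (E : ι → Environment K) (P : Measure (States ι K)) (G : Payoffs A)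
    (σ : ∀ i, Strategy K B (A i)) (i : ι) : EReal :=
  ((∫⁻ x, ENNReal.ofReal (realizedPayoff E G σ i x) ∂(nature B G.final P) : ENNReal) : EReal) -
    ((∫⁻ x, ENNReal.ofReal (-realizedPayoff E G σ i x) ∂(nature B G.final P) : ENNReal) : EReal)

/-- Nash equilibrium: all expected payoffs are finite, and no player gains by a change of his
strategy (acquisition and decisions). -/
def IsNash (E : ι → Environment K) (P : Measure (States ι K)) (G : Payoffs A)
    (σ : ∀ i, Strategy K B (A i)) : Prop :=
  ∀ i, Integrable (realizedPayoff E G σ i) (nature B G.final P) ∧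
    ∀ τ : Strategy K B (A i),
      expectedPayoff E P G (Function.update σ i τ) i ≤ expectedPayoff E P G σ i

/-- Equilibrium in decisions, the acquisition strategies being exogenous: all expected payoffs are
finite, and no player gains by a change of his decision strategy alone. -/
def IsDecisionEquilibrium (E : ι → Environment K) (P : Measure (States ι K)) (G : Payoffs A)
    (σ : ∀ i, Strategy K B (A i)) : Prop :=
  ∀ i, Integrable (realizedPayoff E G σ i) (nature B G.final P) ∧
    ∀ δ : Decision B (A i),
      expectedPayoff E P G (Function.update σ i ⟨(σ i).acquisition, δ⟩) i ≤
        expectedPayoff E P G σ i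

/-- The acquisition strategy `S` is dominant for player `i`: whatever strategies the opponents use,
every strategy of `i` (the `i`-th entry of `σ`) can be replaced by one that acquires information
according to `S`, without a loss for `i`. -/
def IsDominant (E : ι → Environment K) (P : Measure (States ι K)) (G : Payoffs A) (i : ι)
    (S : Acquisition K B) : Prop :=
  ∀ σ : ∀ j, Strategy K B (A j), ∃ δ : Decision B (A i),
    expectedPayoff E P G σ i ≤ expectedPayoff E P G (Function.update σ i ⟨S, δ⟩) i

end Game

end InfoGame

end

open InfoGame

/-!
The posterior variance `f i q` of the state of interest is deterministic, so information about this
Gaussian state can be ranked by its variance. If the optimal count vectors for the totals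
`B, 2B, 3B, …` can be chosen increasing, then a myopic player attains the minimal variance in all
periods at once. In the separable case they increase by convexity. In general, an optimal count
vector is proportional, up to a bounded error, to the weights of the state of interest in terms of
the signal means, so that a large block moves all of its coordinates up.

Dominance is Blackwell's comparison: a player with the smaller variance can add noise to his
posterior mean and draw the history of the other strategy from its conditional law given the noisy
mean. This reproduces the joint law of his action and his state of interest, and, by the
conditional independence, that of the action profile and the payoff-relevant state.

Myopic acquisition can follow a deterministic path. In each period, behavior strategies are then
positive functionals on `L²` of the signals, a weak-* compact convex set, and the signals have
square-integrable densities. Equilibria in decisions thus follow from Ky Fan's inequality, which is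
derived here from Scarf's lemma.
-/

namespace Scarf

open Finset

section Pivot

variable {I Y α : Type*} [LinearOrder α] {ρ : I → Y → α} {m : I → Y} {τ : Finset Y}

/-- A point is a *pivot* for the ranking `j` if it is `j`-highest among the points that lie strictly
above `m i` in all other rankings `i`. Here `m i` is the `i`-lowest point of a set that lacks one
point to be primitive; the pivots are the points that complete it. -/
def IsPivot (ρ : I → Y → α) (m : I → Y) (j : I) (y : Y) : Prop :=
  (∀ i ≠ j, ρ i (m i) < ρ i y) ∧ ∀ z, (∀ i ≠ j, ρ i (m i) < ρ i z) → ρ j z ≤ ρ j y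

theorem IsPivot.eq (hρ : ∀ i, Function.Injective (ρ i)) {j : I} {y z : Y} (hy : IsPivot ρ m j y)
    (hz : IsPivot ρ m j z) : y = z :=
  hρ j (le_antisymm (hz.2 y hy.1) (hy.2 z hz.1))

theorem exists_isPivot [Finite Y] {j : I} {y : Y} (hy : ∀ i ≠ j, ρ i (m i) < ρ i y) :
    ∃ z, IsPivot ρ m j z := by
  obtain ⟨z, hz, hmax⟩ := Set.exists_max_image {y | ∀ i ≠ j, ρ i (m i) < ρ i y} (ρ j)
    (Set.toFinite _) ⟨y, hy⟩
  exact ⟨z, hz, hmax⟩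

theorem IsPivot.ne_of_ne (hm : ∀ y, ∃ i, ρ i y ≤ ρ i (m i)) {j k : I} (hjk : j ≠ k) {y z : Y}
    (hy : IsPivot ρ m j y) (hz : IsPivot ρ m k z) : y ≠ z := by
  rintro rfl
  obtain ⟨i, hi⟩ := hm y
  by_cases hij : i = j
  · exact hi.not_gt (hz.1 i (hij ▸ hjk))
  · exact hi.not_gt (hy.1 i hij)

variable [Fintype I]

/-- A set of `card I` points is primitive for the rankings `ρ` if no point lies strictly above the
minimum of the set in all rankings. -/
def Primitive (ρ : I → Y → α) (P : Finset Y) : Prop :=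
  #P = Fintype.card I ∧ ∀ y, ∃ i, ∀ x ∈ P, ρ i y ≤ ρ i x

instance [Fintype Y] (ρ : I → Y → α) : DecidablePred (Primitive ρ) := fun _ =>
  inferInstanceAs (Decidable (_ ∧ _))

theorem Primitive.exists_equiv (hρ : ∀ i, Function.Injective (ρ i)) {P : Finset Y}
    (hP : Primitive ρ P) : ∃ a : P ≃ I, ∀ x, ∀ y ∈ P, ρ (a x) x ≤ ρ (a x) y := by
  choose a ha using fun x : P => hP.2 x
  have ha_inj : Function.Injective a := fun x x' h =>
    Subtype.ext (hρ (a x) (le_antisymm (ha x x' x'.2) (h ▸ ha x' x x.2)))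
  have ha_bij : Function.Bijective a :=
    (Fintype.bijective_iff_injective_and_card a).2 ⟨ha_inj, by rw [Fintype.card_coe, hP.1]⟩
  exact ⟨Equiv.ofBijective a ha_bij, ha⟩

theorem exists_forall_surjOn_compl_iff (hm : ∀ i, m i ∈ τ) (hτ : #τ + 1 = Fintype.card I)
    {j : I} (hj : ∀ x ∈ τ, ∃ i ≠ j, m i = x) :
    ∃ k ≠ j, ∀ l, (∀ x ∈ τ, ∃ i ≠ l, m i = x) ↔ l = j ∨ l = k := by
  classical
  have hinj : Set.InjOn m ↑(univ.erase j) :=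
    injOn_of_surjOn_of_card_le m (fun i _ => hm i)
      (fun x hx => let ⟨i, hi, h⟩ := hj x hx; ⟨i, by simp [hi], h⟩)
      (by rw [card_erase_of_mem (mem_univ _), card_univ]; omega)
  obtain ⟨k, hkj, hk⟩ := hj (m j) (hm j)
  refine ⟨k, hkj, fun l => ⟨fun hl => ?_, ?_⟩⟩
  · by_contra! hlc
    obtain ⟨i, hil, hi⟩ := hl (m l) (hm l)
    by_cases hij : i = j
    · exact hlc.2 (hinj (by simpa using hlc.1) (by simpa using hkj) (by rw [← hi, hij, hk]))
    · exact hil (hinj (by simpa using hij) (by simpa using hlc.1) hi)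
  · rintro (rfl | rfl) x hx
    · exact hj x hx
    · obtain ⟨i, -, rfl⟩ := hj x hx
      by_cases hil : i = l
      · exact ⟨j, hkj.symm, by rw [hil, hk]⟩
      · exact ⟨i, hil, rfl⟩

variable [DecidableEq Y]

theorem Primitive.exists_isPivot (hρ : ∀ i, Function.Injective (ρ i))
    (hm : ∀ i, m i ∈ τ ∧ ∀ x ∈ τ, ρ i (m i) ≤ ρ i x) {y : Y} (hy : y ∉ τ)
    (hP : Primitive ρ (insert y τ)) :
    ∃ j, (∀ x ∈ τ, ∃ i ≠ j, m i = x) ∧ IsPivot ρ m j y := by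
  obtain ⟨a, ha⟩ := hP.exists_equiv hρ
  set j := a ⟨y, mem_insert_self y τ⟩ with hj
  have m_apply (x : (insert y τ : Finset Y)) (hx : x.1 ∈ τ) : m (a x) = x :=
    hρ (a x) (le_antisymm ((hm _).2 x hx) (ha x _ (mem_insert_of_mem (hm _).1)))
  have mem_of_ne (x : (insert y τ : Finset Y)) (hx : a x ≠ j) : x.1 ∈ τ :=
    (mem_insert.1 x.2).resolve_left fun h => hx (congrArg a (Subtype.ext h))
  refine ⟨j, fun x hx => ?_, fun i hi => ?_, fun z hz => ?_⟩
  · refine ⟨a ⟨x, mem_insert_of_mem hx⟩, fun h => hy ?_, m_apply ⟨x, _⟩ hx⟩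
    obtain rfl : x = y := congrArg Subtype.val (a.injective h)
    exact hx
  · obtain ⟨x, rfl⟩ := a.surjective i
    have hx := mem_of_ne x hi
    rw [m_apply x hx]
    exact lt_of_le_of_ne (ha x y (mem_insert_self _ _)) fun h => hy (hρ _ h ▸ hx)
  · obtain ⟨i, hi⟩ := hP.2 z
    obtain rfl : i = j := by
      by_contra hij
      exact (hi _ (mem_insert_of_mem (hm i).1)).not_gt (hz i hij)
    exact hi y (mem_insert_self _ _)

theorem IsPivot.primitive_insert (hτ : #τ + 1 = Fintype.card I)
    (hm : ∀ i, ∀ x ∈ τ, ρ i (m i) ≤ ρ i x) (hdom : ∀ y, ∃ i, ρ i y ≤ ρ i (m i))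
    {j : I} (hj : ∀ x ∈ τ, ∃ i ≠ j, m i = x) {y : Y} (hy : IsPivot ρ m j y) :
    y ∉ τ ∧ Primitive ρ (insert y τ) := by
  have hyτ : y ∉ τ := fun h => by
    obtain ⟨i, hi, rfl⟩ := hj y h
    exact lt_irrefl _ (hy.1 i hi)
  have hyj : ρ j y ≤ ρ j (m j) := by
    obtain ⟨i, hi⟩ := hdom y
    obtain rfl : i = j := by
      by_contra hij
      exact hi.not_gt (hy.1 i hij)
    exact hi
  refine ⟨hyτ, by rw [card_insert_of_notMem hyτ, hτ], fun z => ?_⟩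
  by_cases hz : ∀ i ≠ j, ρ i (m i) < ρ i z
  · exact ⟨j, (forall_mem_insert y τ _).2
      ⟨hy.2 z hz, fun x hx => ((hy.2 z hz).trans hyj).trans (hm j x hx)⟩⟩
  · push Not at hz
    obtain ⟨i, hij, hi⟩ := hz
    exact ⟨i, (forall_mem_insert y τ _).2
      ⟨hi.trans (hy.1 i hij).le, fun x hx => hi.trans (hm i x hx)⟩⟩

end Pivot

section Slack

variable {I Y α : Type*} [LinearOrder α] {ρ : I → Y → α} {s : I → Y}

/-- Rankings of points that include one *slack point* `s i` for each ranking `i`: it is the lowest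
point of its own ranking, and lies above all points that are not slack in the others. -/
structure IsSlackRanking (ρ : I → Y → α) (s : I → Y) : Prop where
  injective_ranking : ∀ i, Function.Injective (ρ i)
  le : ∀ i y, ρ i (s i) ≤ ρ i y
  lt : ∀ {i j y}, y ∉ Set.range s → j ≠ i → ρ i y < ρ i (s j)
  exists_notMem_range : ∃ v, v ∉ Set.range s

theorem IsSlackRanking.injective (h : IsSlackRanking ρ s) : Function.Injective s := by
  intro i j hij
  by_contra hne
  obtain ⟨v, hv⟩ := h.exists_notMem_range
  exact (h.le i v).not_gt (hij ▸ h.lt hv (Ne.symm hne))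

theorem IsSlackRanking.slack_lt (h : IsSlackRanking ρ s) (i : I) {y : Y} (hy : y ∉ Set.range s) :
    ρ i (s i) < ρ i y :=
  lt_of_le_of_ne (h.le i y) fun e => hy ⟨i, h.injective_ranking i e⟩

variable [Fintype I] [DecidableEq Y]

theorem IsSlackRanking.card_image_erase [DecidableEq I] (h : IsSlackRanking ρ s) (i₀ : I) :
    #((univ.erase i₀).image s) + 1 = Fintype.card I := by
  rw [card_image_of_injective _ h.injective, card_erase_add_one (mem_univ _), card_univ]

theorem IsSlackRanking.primitive_insert_image_erase_iff [DecidableEq I] (h : IsSlackRanking ρ s)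
    {i₀ : I} {y : Y} (hy : y ∉ (univ.erase i₀).image s) :
    Primitive ρ (insert y ((univ.erase i₀).image s)) ↔
      y ∉ Set.range s ∧ ∀ z ∉ Set.range s, ρ i₀ z ≤ ρ i₀ y := by
  have slack_mem {j : I} (hj : j ≠ i₀) : s j ∈ insert y ((univ.erase i₀).image s) :=
    mem_insert_of_mem (mem_image_of_mem _ (by simp [hj]))
  constructor
  · rintro ⟨-, hP⟩
    have key (z : Y) (hz : z ∉ Set.range s) : ρ i₀ z ≤ ρ i₀ y := by
      obtain ⟨j, hj⟩ := hP z
      obtain rfl : j = i₀ := by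
        by_contra hji
        exact (hj _ (slack_mem hji)).not_gt (h.slack_lt j hz)
      exact hj y (mem_insert_self _ _)
    refine ⟨?_, key⟩
    rintro ⟨i, rfl⟩
    obtain rfl : i = i₀ := by
      by_contra hi
      exact hy (mem_image_of_mem _ (by simp [hi]))
    obtain ⟨v, hv⟩ := h.exists_notMem_range
    exact (key v hv).not_gt (h.slack_lt i hv)
  · rintro ⟨-, hmax⟩
    refine ⟨by rw [card_insert_of_notMem hy, h.card_image_erase], fun z => ?_⟩
    by_cases hz : z ∈ Set.range s
    · obtain ⟨j, rfl⟩ := hz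
      exact ⟨j, fun x _ => h.le j x⟩
    · refine ⟨i₀, (forall_mem_insert _ _ _).2 ⟨hmax z hz, forall_mem_image.2 fun i hi => ?_⟩⟩
      exact (h.lt hz (ne_of_mem_erase hi)).le

variable [Fintype Y]

/-- The points that complete `τ` to a primitive set. -/
def completions (ρ : I → Y → α) (τ : Finset Y) : Finset Y :=
  {y | y ∉ τ ∧ Primitive ρ (insert y τ)}

theorem mem_completions {τ : Finset Y} {y : Y} :
    y ∈ completions ρ τ ↔ y ∉ τ ∧ Primitive ρ (insert y τ) := by
  simp [completions]

theorem IsSlackRanking.card_completions (h : IsSlackRanking ρ s) {τ : Finset Y}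
    (hτ : #τ + 1 = Fintype.card I) (hns : ∃ v ∈ τ, v ∉ Set.range s)
    (hne : (completions ρ τ).Nonempty) : #(completions ρ τ) = 2 := by
  obtain ⟨v, hvτ, hv⟩ := hns
  obtain ⟨x₀, hx₀⟩ := hne
  obtain ⟨hx₀τ, hP₀⟩ := mem_completions.1 hx₀
  choose m hm using fun i => exists_min_image τ (ρ i) ⟨v, hvτ⟩
  have hdom (y : Y) : ∃ i, ρ i y ≤ ρ i (m i) :=
    let ⟨i, hi⟩ := hP₀.2 y
    ⟨i, hi _ (mem_insert_of_mem (hm i).1)⟩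
  have exists_pivot (l : I) : ∃ y, IsPivot ρ m l y :=
    exists_isPivot fun i hi => ((hm i).2 v hvτ).trans_lt (h.lt hv (Ne.symm hi))
  obtain ⟨j, hj, -⟩ := hP₀.exists_isPivot h.injective_ranking hm hx₀τ
  obtain ⟨k, hkj, hjk⟩ := exists_forall_surjOn_compl_iff (fun i => (hm i).1) hτ hj
  obtain ⟨y, hy⟩ := exists_pivot j
  obtain ⟨z, hz⟩ := exists_pivot k
  have completions_eq : completions ρ τ = {y, z} := by
    ext x
    rw [mem_completions, mem_insert, mem_singleton]
    constructor
    · rintro ⟨hxτ, hP⟩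
      obtain ⟨l, hl, hx⟩ := hP.exists_isPivot h.injective_ranking hm hxτ
      rcases (hjk l).1 hl with rfl | rfl
      · exact Or.inl (hx.eq h.injective_ranking hy)
      · exact Or.inr (hx.eq h.injective_ranking hz)
    · rintro (rfl | rfl)
      · exact hy.primitive_insert hτ (fun i => (hm i).2) hdom hj
      · exact hz.primitive_insert hτ (fun i => (hm i).2) hdom ((hjk k).2 (Or.inr rfl))
  rw [completions_eq, card_pair (hy.ne_of_ne hdom hkj.symm hz)]

theorem IsSlackRanking.card_completions_image_erase [DecidableEq I] (h : IsSlackRanking ρ s)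
    (i₀ : I) : #(completions ρ ((univ.erase i₀).image s)) = 1 := by
  obtain ⟨y₀, hy₀, hmax⟩ := Set.exists_max_image {y | y ∉ Set.range s} (ρ i₀) (Set.toFinite _)
    h.exists_notMem_range
  have notMem_image {y : Y} (hy : y ∉ Set.range s) : y ∉ (univ.erase i₀).image s := fun hmem =>
    let ⟨i, _, hi⟩ := mem_image.1 hmem
    hy ⟨i, hi⟩
  refine card_eq_one.2 ⟨y₀, eq_singleton_iff_unique_mem.2 ⟨mem_completions.2 ?_, fun y hy => ?_⟩⟩
  · exact ⟨notMem_image hy₀, (h.primitive_insert_image_erase_iff (notMem_image hy₀)).2 ⟨hy₀, hmax⟩⟩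
  · obtain ⟨hyτ, hP⟩ := mem_completions.1 hy
    obtain ⟨hys, hymax⟩ := (h.primitive_insert_image_erase_iff hyτ).1 hP
    exact h.injective_ranking i₀ (le_antisymm (hmax y hys) (hymax y₀ hy₀))

end Slack

section Labels

variable {I Y : Type*} [Fintype I] [DecidableEq I] [DecidableEq Y] {ℓ : Y → I} {i₀ : I}
  {P : Finset Y}

/-- The points of `P` whose removal leaves exactly the labels other than `i₀`. -/
def removals (ℓ : Y → I) (i₀ : I) (P : Finset Y) : Finset Y :=
  {x ∈ P | (P.erase x).image ℓ = univ.erase i₀}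

theorem injOn_erase_of_mem_removals (hP : #P = Fintype.card I) {x : Y} (hx : x ∈ removals ℓ i₀ P) :
    Set.InjOn ℓ ↑(P.erase x) := by
  obtain ⟨hxP, hxe⟩ := mem_filter.1 hx
  rw [← card_image_iff, hxe, card_erase_of_mem (mem_univ _), card_erase_of_mem hxP, hP, card_univ]

theorem removals_eq_filter (hP : #P = Fintype.card I) {x : Y} (hx : x ∈ removals ℓ i₀ P) :
    removals ℓ i₀ P = {z ∈ P | ℓ z = ℓ x} := by
  obtain ⟨hxP, hxe⟩ := mem_filter.1 hx
  ext z
  simp only [removals, mem_filter, and_congr_right_iff]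
  intro hz
  constructor
  · intro hze
    by_contra hzx
    have hzx' : z ≠ x := fun e => hzx (congrArg ℓ e)
    have hzP : z ∈ P.erase x := mem_erase.2 ⟨hzx', hz⟩
    obtain ⟨w, hw, hwz⟩ := mem_image.1 (show ℓ z ∈ (P.erase z).image ℓ by
      rw [hze, ← hxe]
      exact mem_image_of_mem _ hzP)
    have hwx : w ≠ x := fun e => hzx (by rw [← hwz, e])
    exact ne_of_mem_erase hw (injOn_erase_of_mem_removals hP hx
      (mem_erase.2 ⟨hwx, mem_of_mem_erase hw⟩) hzP hwz)
  · intro hzx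
    by_cases hne : z = x
    · rw [hne, hxe]
    rw [← hxe, ← insert_erase (mem_erase.2 ⟨hne, hz⟩), ← insert_erase
      (mem_erase.2 ⟨Ne.symm hne, hxP⟩), image_insert, image_insert, hzx, erase_right_comm]

theorem card_removals_of_image_ne_univ (hP : #P = Fintype.card I) (h : P.image ℓ ≠ univ)
    (hne : (removals ℓ i₀ P).Nonempty) : #(removals ℓ i₀ P) = 2 := by
  obtain ⟨x, hx⟩ := hne
  obtain ⟨hxP, hxe⟩ := mem_filter.1 hx
  have hxi : ℓ x ≠ i₀ := fun hxi => h (by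
    rw [← insert_erase hxP, image_insert, hxe, hxi, insert_erase (mem_univ _)])
  obtain ⟨x', hx', hℓ⟩ := mem_image.1 (show ℓ x ∈ (P.erase x).image ℓ by rw [hxe]; simp [hxi])
  have fiber_eq : {z ∈ P | ℓ z = ℓ x} = {x, x'} := by
    ext z
    simp only [mem_filter, mem_insert, mem_singleton]
    constructor
    · rintro ⟨hz, hzx⟩
      by_cases hne : z = x
      · exact Or.inl hne
      · exact Or.inr (injOn_erase_of_mem_removals hP hx (mem_erase.2 ⟨hne, hz⟩) hx'
          (hzx.trans hℓ.symm))
    · rintro (rfl | rfl)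
      exacts [⟨hxP, rfl⟩, ⟨mem_of_mem_erase hx', hℓ⟩]
  rw [removals_eq_filter hP hx, fiber_eq, card_pair (ne_of_mem_erase hx').symm]

theorem even_card_removals (hP : #P = Fintype.card I) (h : P.image ℓ ≠ univ) :
    Even #(removals ℓ i₀ P) := by
  rcases (removals ℓ i₀ P).eq_empty_or_nonempty with he | hne
  · simp [he]
  · simp [card_removals_of_image_ne_univ hP h hne]

end Labels

variable {I Y α : Type*} [Fintype I] [DecidableEq I] [LinearOrder α] {ρ : I → Y → α} {s : I → Y}

section Doors

variable [Fintype Y]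

/-- The sets that lack one point to be primitive and carry exactly the labels other than `i₀`: the
doors between primitive sets in the parity argument. -/
def doors (ℓ : Y → I) (i₀ : I) : Finset (Finset Y) :=
  {τ | #τ + 1 = Fintype.card I ∧ τ.image ℓ = univ.erase i₀}

theorem mem_doors {ℓ : Y → I} {i₀ : I} {τ : Finset Y} :
    τ ∈ doors ℓ i₀ ↔ #τ + 1 = Fintype.card I ∧ τ.image ℓ = univ.erase i₀ := by
  simp [doors]

variable [DecidableEq Y]

theorem sum_card_removals_eq_sum_card_completions (ρ : I → Y → α) (ℓ : Y → I) (i₀ : I) :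
    ∑ P with Primitive ρ P, #(removals ℓ i₀ P) = ∑ τ ∈ doors ℓ i₀, #(completions ρ τ) := by
  rw [← card_sigma, ← card_sigma]
  refine card_nbij' (fun p => ⟨p.1.erase p.2, p.2⟩) (fun p => ⟨insert p.2 p.1, p.2⟩) ?_ ?_ ?_ ?_
  · rintro ⟨P, x⟩ hp
    obtain ⟨hP, hx, hxe⟩ : Primitive ρ P ∧ x ∈ P ∧ _ := by simpa [removals] using hp
    simp only [coe_sigma, Set.mem_sigma_iff, mem_coe, mem_doors, mem_completions]
    exact ⟨⟨by rw [card_erase_add_one hx, hP.1], hxe⟩, notMem_erase _ _, by rwa [insert_erase hx]⟩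
  · rintro ⟨τ, y⟩ hp
    simp only [coe_sigma, Set.mem_sigma_iff, mem_coe, mem_doors, mem_completions] at hp
    obtain ⟨⟨-, hℓ⟩, hy, hP⟩ := hp
    simpa [removals, hP, erase_insert hy] using hℓ
  · rintro ⟨P, x⟩ hp
    have hx : x ∈ P := by simpa using (mem_filter.1 (mem_sigma.1 hp).2).1
    simp [insert_erase hx]
  · rintro ⟨τ, y⟩ hp
    have hy : y ∉ τ := (mem_completions.1 (mem_sigma.1 hp).2).1
    simp [erase_insert hy]

theorem IsSlackRanking.even_card_completions (h : IsSlackRanking ρ s) {ℓ : Y → I}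
    (hℓ : ∀ i, ℓ (s i) = i) {i₀ : I} {τ : Finset Y} (hτ : τ ∈ doors ℓ i₀)
    (hne : τ ≠ (univ.erase i₀).image s) : Even #(completions ρ τ) := by
  obtain ⟨hcard, himg⟩ := mem_doors.1 hτ
  have hns : ∃ x ∈ τ, x ∉ Set.range s := by
    by_contra! hall
    refine hne (eq_of_subset_of_card_le (fun x hx => ?_) (by have := h.card_image_erase i₀; omega))
    obtain ⟨i, rfl⟩ := hall x hx
    exact mem_image_of_mem _ (himg ▸ hℓ i ▸ mem_image_of_mem ℓ hx)
  rcases (completions ρ τ).eq_empty_or_nonempty with he | hne'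
  · simp [he]
  · simp [h.card_completions hcard hns hne']

end Doors

/-- **Scarf's lemma** -/
theorem IsSlackRanking.exists_primitive_image_eq_univ [Nonempty I] [Finite Y]
    (h : IsSlackRanking ρ s) {ℓ : Y → I} (hℓ : ∀ i, ℓ (s i) = i) :
    ∃ P, Primitive ρ P ∧ P.image ℓ = univ := by
  classical
  have := Fintype.ofFinite Y
  obtain ⟨i₀⟩ := ‹Nonempty I›
  by_contra! hnone
  have hs_mem : (univ.erase i₀).image s ∈ doors ℓ i₀ := by
    refine mem_doors.2 ⟨h.card_image_erase i₀, ?_⟩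
    rw [image_image, show ℓ ∘ s = id from funext hℓ, image_id]
  have heven : Even (∑ P with Primitive ρ P, #(removals ℓ i₀ P)) :=
    even_sum _ fun P hP =>
      even_card_removals (mem_filter.1 hP).2.1 (hnone P (mem_filter.1 hP).2)
  rw [sum_card_removals_eq_sum_card_completions, ← add_sum_erase _ _ hs_mem,
    h.card_completions_image_erase] at heven
  refine Nat.not_even_iff_odd.2 (odd_one.add_even (even_sum _ fun τ hτ => ?_)) heven
  exact h.even_card_completions hℓ (mem_of_mem_erase hτ) (ne_of_mem_erase hτ)

end Scarf

namespace Scarf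

open Finset

section Grid

variable {I : Type*} [Fintype I] [DecidableEq I] {m : ℕ}

/-- The points of the grid of mesh `1 / m` in the standard simplex, scaled by `m` so that their
coordinates are natural numbers. -/
abbrev GridPoint (I : Type*) [Fintype I] [DecidableEq I] (m : ℕ) : Type _ :=
  piAntidiag (univ : Finset I) m

theorem GridPoint.sum_eq (x : GridPoint I m) : ∑ i, x.1 i = m :=
  (mem_piAntidiag.1 x.2).1

theorem GridPoint.apply_le (x : GridPoint I m) (i : I) : x.1 i ≤ m :=
  (single_le_sum (fun _ _ => Nat.zero_le _) (mem_univ i)).trans x.sum_eq.le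

theorem GridPoint.div_mem_stdSimplex (hm : 0 < m) (x : GridPoint I m) :
    (fun i => (x.1 i : ℝ) / m) ∈ stdSimplex ℝ I := by
  refine ⟨fun i => by positivity, ?_⟩
  rw [← sum_div, ← Nat.cast_sum, x.sum_eq, div_self (by positivity)]

/-- The coordinates of the grid points, shifted by one, and of the slack points, which are the
elements of `I`: high enough to be above the grid, except for coordinate `i` of the slack point `i`,
which is below it. -/
def gridHeight (m : ℕ) (i : I) : GridPoint I m ⊕ I → ℕ :=
  Sum.elim (fun x => x.1 i + 1) fun j => if j = i then 0 else m + 2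

/-- The rankings by coordinates, with ties broken by the enumeration `e`. -/
def gridRanking (e : GridPoint I m ⊕ I ↪ ℕ) (i : I) (y : GridPoint I m ⊕ I) : ℕ ×ₗ ℕ :=
  toLex (gridHeight m i y, e y)

variable {e : GridPoint I m ⊕ I ↪ ℕ}

theorem gridRanking_lt_of_gridHeight_lt {i : I} {y z : GridPoint I m ⊕ I}
    (h : gridHeight m i y < gridHeight m i z) : gridRanking e i y < gridRanking e i z :=
  Prod.Lex.toLex_lt_toLex.2 (Or.inl h)

theorem gridHeight_le_of_gridRanking_le {i : I} {y z : GridPoint I m ⊕ I}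
    (h : gridRanking e i y ≤ gridRanking e i z) : gridHeight m i y ≤ gridHeight m i z :=
  Prod.Lex.monotone_fst _ _ h

theorem isSlackRanking_gridRanking [Nonempty I] (e : GridPoint I m ⊕ I ↪ ℕ) :
    IsSlackRanking (gridRanking e) Sum.inr where
  injective_ranking i y z h := e.injective (congrArg Prod.snd (toLex.injective h))
  le i y := by
    by_cases h : y = Sum.inr i
    · rw [h]
    · refine (gridRanking_lt_of_gridHeight_lt ?_).le
      rcases y with x | j
      · simp [gridHeight]
      · simp [gridHeight, show j ≠ i from fun hj => h (by rw [hj])]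
  lt {i j y} hy hji := by
    refine gridRanking_lt_of_gridHeight_lt ?_
    rcases y with x | k
    · simpa [gridHeight, hji] using Nat.lt_succ_of_le (x.apply_le i)
    · exact absurd ⟨k, rfl⟩ hy
  exists_notMem_range := by
    obtain ⟨c⟩ := ‹Nonempty I›
    exact ⟨Sum.inl ⟨Pi.single c m, by simp [mem_piAntidiag]⟩, by simp⟩

variable {P : Finset (GridPoint I m ⊕ I)}

theorem Primitive.exists_inr_notMem [Nonempty I] (hP : Primitive (gridRanking e) P) :
    ∃ c, Sum.inr c ∉ P := by
  by_contra! hall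
  obtain ⟨c⟩ := ‹Nonempty I›
  obtain ⟨i, hi⟩ := hP.2 (Sum.inl ⟨Pi.single c m, by simp [mem_piAntidiag]⟩)
  simpa [gridHeight] using gridHeight_le_of_gridRanking_le (hi _ (hall i))

/-- Otherwise `μ + 1` on the coordinates without slack point, with the remaining weight added at
some `c`, would be a grid point above the minimum of `P` in all rankings. -/
theorem Primitive.lt_sum_add_one [Nonempty I] (hP : Primitive (gridRanking e) P)
    {μ : I → ℕ} (hμ : ∀ i, Sum.inr i ∉ P → ∃ x, Sum.inl x ∈ P ∧ x.1 i ≤ μ i) :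
    m < ∑ i with Sum.inr i ∉ P, (μ i + 1) := by
  by_contra! hle
  obtain ⟨c⟩ := ‹Nonempty I›
  let y : I → ℕ := fun i => (if Sum.inr i ∉ P then μ i + 1 else 0) +
    if i = c then m - ∑ i with Sum.inr i ∉ P, (μ i + 1) else 0
  have hy : ∑ i, y i = m := by
    rw [sum_add_distrib, ← sum_filter, sum_ite_eq', if_pos (mem_univ c), Nat.add_sub_cancel' hle]
  obtain ⟨i, hi⟩ := hP.2 (Sum.inl ⟨y, by simp [mem_piAntidiag, hy]⟩)
  by_cases hiP : Sum.inr i ∈ P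
  · simpa [gridHeight] using gridHeight_le_of_gridRanking_le (hi _ hiP)
  · obtain ⟨x, hx, hxμ⟩ := hμ i hiP
    have := gridHeight_le_of_gridRanking_le (hi _ hx)
    simp only [gridHeight, Sum.elim_inl, y, if_pos hiP] at this
    omega

theorem Primitive.exists_le_apply_le [Nonempty I] (hP : Primitive (gridRanking e) P)
    (hne : ∃ x, Sum.inl x ∈ P) :
    ∃ μ : I → ℕ, (∀ i, Sum.inr i ∈ P → μ i = 0) ∧
      ∀ x, Sum.inl x ∈ P → ∀ i, μ i ≤ x.1 i ∧ x.1 i ≤ μ i + Fintype.card I := by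
  obtain ⟨x₀, hx₀⟩ := hne
  choose x hxP hx using fun i => exists_min_image {x : GridPoint I m | Sum.inl x ∈ P}
    (fun x => x.1 i) ⟨x₀, by simpa using hx₀⟩
  simp only [mem_filter, mem_univ, true_and] at hxP hx
  set μ : I → ℕ := fun i => if Sum.inr i ∉ P then (x i).1 i else 0 with hμ
  have μ_le {z : GridPoint I m} (hz : Sum.inl z ∈ P) (i : I) : μ i ≤ z.1 i := by
    simp only [hμ]
    split_ifs
    exacts [Nat.zero_le _, hx i z hz]
  have hsum : m < ∑ i, μ i + Fintype.card I := by
    have h := hP.lt_sum_add_one fun i _ => ⟨x i, hxP i, le_rfl⟩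
    rw [sum_add_distrib, sum_const, smul_eq_mul, mul_one, sum_filter] at h
    exact h.trans_le (Nat.add_le_add_left (card_le_univ _) _)
  refine ⟨μ, fun i hi => if_neg (not_not_intro hi), fun z hz i => ⟨μ_le hz i, ?_⟩⟩
  have hz_sum := add_sum_erase univ z.1 (mem_univ i)
  have hμ_sum := add_sum_erase univ μ (mem_univ i)
  have hle : ∑ j ∈ univ.erase i, μ j ≤ ∑ j ∈ univ.erase i, z.1 j :=
    sum_le_sum fun j _ => μ_le hz j
  rw [z.sum_eq] at hz_sum
  omega

theorem exists_gridPoint_near_labels [Nonempty I] (ℓ : GridPoint I m → I) :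
    ∃ z : GridPoint I m, ∀ i, z.1 i ≤ Fintype.card I ∨
      ∃ w : GridPoint I m, ℓ w = i ∧
        ∀ j, w.1 j ≤ z.1 j + Fintype.card I ∧ z.1 j ≤ w.1 j + Fintype.card I := by
  obtain ⟨e⟩ : Nonempty (GridPoint I m ⊕ I ↪ ℕ) :=
    ⟨(Fintype.equivFin _).toEmbedding.trans Fin.valEmbedding⟩
  obtain ⟨P, hP, himg⟩ := (isSlackRanking_gridRanking e).exists_primitive_image_eq_univ
    (ℓ := Sum.elim ℓ id) fun _ => rfl
  have exists_label (i : I) (hi : Sum.inr i ∉ P) : ∃ x, Sum.inl x ∈ P ∧ ℓ x = i := by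
    obtain ⟨x | j, hy, h⟩ := mem_image.1 (himg ▸ mem_univ i)
    · exact ⟨x, hy, h⟩
    · exact absurd ((show j = i from h) ▸ hy) hi
  obtain ⟨c, hc⟩ := hP.exists_inr_notMem
  obtain ⟨z, hz, -⟩ := exists_label c hc
  obtain ⟨μ, hμ_zero, hμ⟩ := hP.exists_le_apply_le ⟨z, hz⟩
  refine ⟨z, fun i => ?_⟩
  by_cases hi : Sum.inr i ∈ P
  · exact Or.inl (by simpa [hμ_zero i hi] using (hμ z hz i).2)
  · obtain ⟨w, hw, rfl⟩ := exists_label i hi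
    refine Or.inr ⟨w, rfl, fun j => ?_⟩
    obtain ⟨hzl, hzu⟩ := hμ z hz j
    obtain ⟨hwl, hwu⟩ := hμ w hw j
    omega

end Grid

end Scarf

section FixedPoint

variable {I : Type*} [Fintype I] [Nonempty I]

theorem exists_stdSimplex_near_nonneg {H : (I → ℝ) → I → ℝ}
    (hH : ∀ x ∈ stdSimplex ℝ I, ∃ i, 0 ≤ H x i) {m : ℕ} (hm : 0 < m) :
    ∃ z ∈ stdSimplex ℝ I, ∀ i, z i ≤ Fintype.card I / m ∨
      ∃ w ∈ stdSimplex ℝ I, dist w z ≤ Fintype.card I / m ∧ 0 ≤ H w i := by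
  classical
  choose ℓ hℓ using fun x : Scarf.GridPoint I m => hH _ (x.div_mem_stdSimplex hm)
  obtain ⟨z, hz⟩ := Scarf.exists_gridPoint_near_labels ℓ
  refine ⟨_, z.div_mem_stdSimplex hm, fun i => ?_⟩
  rcases hz i with h | ⟨w, rfl, hw⟩
  · left
    gcongr
  · refine Or.inr ⟨_, w.div_mem_stdSimplex hm, (dist_pi_le_iff (by positivity)).2 fun j => ?_, hℓ w⟩
    have hwz : (w.1 j : ℝ) ≤ z.1 j + Fintype.card I := by exact_mod_cast (hw j).1
    have hzw : (z.1 j : ℝ) ≤ w.1 j + Fintype.card I := by exact_mod_cast (hw j).2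
    rw [Real.dist_eq, ← sub_div, abs_div, Nat.abs_cast]
    gcongr
    exact abs_sub_le_iff.2 ⟨by linarith, by linarith⟩

open Filter Topology in
/-- Limits of the approximate solutions on finer and finer grids are solutions. -/
theorem exists_stdSimplex_eq_zero_or_nonneg {H : (I → ℝ) → I → ℝ}
    (hc : ContinuousOn H (stdSimplex ℝ I)) (hH : ∀ x ∈ stdSimplex ℝ I, ∃ i, 0 ≤ H x i) :
    ∃ z ∈ stdSimplex ℝ I, ∀ i, z i = 0 ∨ 0 ≤ H z i := by
  classical
  choose z hz hzi using fun m : ℕ => exists_stdSimplex_near_nonneg hH m.succ_pos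
  obtain ⟨a, ha, φ, hφ, hlim⟩ := (isCompact_stdSimplex ℝ I).tendsto_subseq hz
  have hmesh : Tendsto (fun k => (Fintype.card I : ℝ) / (φ k).succ) atTop (𝓝 0) :=
    ((tendsto_add_atTop_iff_nat 1).2
      (tendsto_const_div_atTop_nhds_zero_nat (Fintype.card I : ℝ))).comp hφ.tendsto_atTop
  refine ⟨a, ha, fun i => ?_⟩
  by_contra! ⟨hai, hneg⟩
  have hpos : 0 < a i := (ha.1 i).lt_of_ne' hai
  have hneg_near : ∀ᶠ w in 𝓝[stdSimplex ℝ I] a, H w i < 0 :=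
    ((continuous_apply i).comp_continuousOn hc a ha).eventually_lt_const hneg
  obtain ⟨δ, hδ, hball⟩ := Metric.mem_nhdsWithin_iff.1 hneg_near
  have hcoord : ∀ᶠ k in atTop, (Fintype.card I : ℝ) / (φ k).succ < z (φ k) i :=
    hmesh.eventually_lt (((continuous_apply i).tendsto a).comp hlim) hpos
  obtain ⟨k, hk, hk_mesh, hk_dist⟩ := (hcoord.and ((hmesh.eventually_lt_const (half_pos hδ)).and
    (Metric.tendsto_nhds.1 hlim _ (half_pos hδ)))).exists
  obtain ⟨w, hw, hwz, hHw⟩ := (hzi (φ k) i).resolve_left hk.not_ge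
  refine (hball ⟨?_, hw⟩ : H w i < 0).not_ge hHw
  calc dist w a ≤ dist w (z (φ k)) + dist (z (φ k)) a := dist_triangle _ _ _
    _ < δ / 2 + δ / 2 := add_lt_add (hwz.trans_lt hk_mesh) hk_dist
    _ = δ := add_halves δ

/-- Nash's map: the previous theorem is applied to `H x i = F x i ⁺ - x i * ∑ j, F x j ⁺`. -/
theorem exists_forall_nonpos_of_sum_mul_nonpos {F : (I → ℝ) → I → ℝ}
    (hc : ContinuousOn F (stdSimplex ℝ I)) (hF : ∀ x ∈ stdSimplex ℝ I, ∑ i, x i * F x i ≤ 0) :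
    ∃ z ∈ stdSimplex ℝ I, ∀ i, F z i ≤ 0 := by
  set T : (I → ℝ) → ℝ := fun x => ∑ i, max (F x i) 0
  set H : (I → ℝ) → I → ℝ := fun x i => max (F x i) 0 - x i * T x
  have sum_H (x) (hx : x ∈ stdSimplex ℝ I) : ∑ i, H x i = 0 := by
    simp only [H, Finset.sum_sub_distrib, ← Finset.sum_mul, hx.2, one_mul]
    exact sub_self _
  have hgain (i : I) : ContinuousOn (fun x => max (F x i) 0) (stdSimplex ℝ I) :=
    ((continuous_apply i).comp_continuousOn hc).sup continuousOn_const
  have hHc : ContinuousOn H (stdSimplex ℝ I) := continuousOn_pi.2 fun i =>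
    (hgain i).sub <| (continuous_apply i).continuousOn.mul <|
      continuousOn_finsetSum _ fun j _ => hgain j
  obtain ⟨z, hz, hzH⟩ := exists_stdSimplex_eq_zero_or_nonneg hHc fun x hx =>
    let ⟨i, _, hi⟩ := Finset.exists_le_of_sum_le Finset.univ_nonempty
      (f := fun _ => (0 : ℝ)) (by rw [sum_H x hx, Finset.sum_const_zero])
    ⟨i, hi⟩
  have H_nonneg (i : I) : 0 ≤ H z i := (hzH i).elim (fun h => by simp [H, h]) id
  have gain_eq (i : I) : max (F z i) 0 = z i * T z := sub_eq_zero.1 <|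
    (Finset.sum_eq_zero_iff_of_nonneg fun i _ => H_nonneg i).1 (sum_H z hz) i (Finset.mem_univ i)
  have gain_sq (i : I) : max (F z i) 0 ^ 2 = T z * (z i * F z i) :=
    calc max (F z i) 0 ^ 2 = max (F z i) 0 * F z i := by
          rcases le_total (F z i) 0 with h | h <;> simp [h, sq]
      _ = T z * (z i * F z i) := by rw [gain_eq]; ring
  have sum_gain_sq : ∑ i, max (F z i) 0 ^ 2 ≤ 0 := by
    simp only [gain_sq, ← Finset.mul_sum]
    exact mul_nonpos_of_nonneg_of_nonpos (Finset.sum_nonneg fun i _ => le_max_right _ _) (hF z hz)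
  refine ⟨z, hz, fun i => max_eq_right_iff.1 (pow_eq_zero_iff two_ne_zero |>.1 ?_)⟩
  exact (Finset.sum_eq_zero_iff_of_nonneg fun i _ => sq_nonneg _).1
    (sum_gain_sq.antisymm (Finset.sum_nonneg fun i _ => sq_nonneg _)) i (Finset.mem_univ i)

end FixedPoint

/-- **Ky Fan's inequality** -/
theorem exists_forall_nonpos_of_concaveOn {V : Type*} [AddCommGroup V] [Module ℝ V]
    [TopologicalSpace V] [ContinuousAdd V] [ContinuousSMul ℝ V] {S : Set V} (hS : IsCompact S)
    (hconv : Convex ℝ S) (hne : S.Nonempty) {Φ : V → V → ℝ}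
    (hcont : ∀ y ∈ S, ContinuousOn (fun x => Φ x y) S) (hconc : ∀ x ∈ S, ConcaveOn ℝ S (Φ x))
    (hdiag : ∀ x ∈ S, Φ x x ≤ 0) : ∃ x ∈ S, ∀ y ∈ S, Φ x y ≤ 0 := by
  classical
  have : CompactSpace S := isCompact_iff_compactSpace.1 hS
  have hfin (u : Finset S) : (Set.univ ∩ ⋂ y ∈ u, {x : S | Φ x y ≤ 0}).Nonempty := by
    rcases u.eq_empty_or_nonempty with rfl | hu
    · have := hne.to_subtype
      simp
    have : Nonempty u := hu.to_subtype
    let c : (u → ℝ) → V := fun t => ∑ y, t y • y.1.1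
    have hcS : ∀ t ∈ stdSimplex ℝ u, c t ∈ S := fun t ht =>
      hconv.sum_mem (fun i _ => ht.1 i) ht.2 fun i _ => i.1.2
    have hcc : Continuous c := continuous_finsetSum _ fun y _ =>
      (continuous_apply y).smul continuous_const
    have hsum (t) (ht : t ∈ stdSimplex ℝ u) : ∑ y : u, t y * Φ (c t) y.1.1 ≤ 0 :=
      ((hconc (c t) (hcS t ht)).le_map_sum (fun i _ => ht.1 i) ht.2 fun i _ => i.1.2).trans
        (hdiag (c t) (hcS t ht))
    obtain ⟨t, ht, h⟩ := exists_forall_nonpos_of_sum_mul_nonpos (F := fun t y => Φ (c t) y.1.1)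
      (continuousOn_pi.2 fun y => (hcont y.1.1 y.1.2).comp hcc.continuousOn hcS) hsum
    exact ⟨⟨c t, hcS t ht⟩, Set.mem_univ _, Set.mem_iInter₂.2 fun y hy => h ⟨y, hy⟩⟩
  obtain ⟨x, -, hx⟩ := isCompact_univ.inter_iInter_nonempty
    (fun y : S => {x : S | Φ x y ≤ 0})
    (fun y => isClosed_le (continuousOn_iff_continuous_domRestrict.1 (hcont y y.2))
      continuous_const) hfin
  exact ⟨x, x.2, fun y hy => Set.mem_iInter.1 hx ⟨y, hy⟩⟩

section Behavior

variable {T : Type*} [MeasurableSpace T] {lam : Measure T} {A : Type*} [Fintype A]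

/-- A behavior strategy: the probability `s x a` of action `a` after the observation `x`. -/
structure IsBehavior (s : T → A → ℝ) : Prop where
  measurable_apply : ∀ a, Measurable fun x => s x a
  nonneg : ∀ x a, 0 ≤ s x a
  sum_eq_one : ∀ x, ∑ a, s x a = 1

theorem IsBehavior.le_one {s : T → A → ℝ} (hs : IsBehavior s) (x : T) (a : A) : s x a ≤ 1 :=
  hs.sum_eq_one x ▸ Finset.single_le_sum (fun a _ => hs.nonneg x a) (Finset.mem_univ a)

theorem IsBehavior.norm_le_one {s : T → A → ℝ} (hs : IsBehavior s) (x : T) (a : A) :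
    ‖s x a‖ ≤ 1 := by
  rw [Real.norm_of_nonneg (hs.nonneg x a)]
  exact hs.le_one x a

theorem isBehavior_const_single [DecidableEq A] (a₀ : A) :
    IsBehavior fun _ : T => Pi.single a₀ (1 : ℝ) where
  measurable_apply _ := measurable_const
  nonneg _ _ := (Pi.single_nonneg.2 zero_le_one : (0 : A → ℝ) ≤ Pi.single a₀ 1) _
  sum_eq_one _ := by simp

theorem exists_isBehavior_ae_eq [Nonempty A] {s : T → A → ℝ}
    (hs : ∀ a, Measurable fun x => s x a) (hs_nonneg : ∀ᵐ x ∂lam, ∀ a, 0 ≤ s x a)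
    (hs_sum : ∀ᵐ x ∂lam, ∑ a, s x a = 1) : ∃ s', IsBehavior s' ∧ ∀ᵐ x ∂lam, s' x = s x := by
  classical
  obtain ⟨a₀⟩ := ‹Nonempty A›
  let G : Set T := {x | ∀ a, 0 ≤ s x a} ∩ {x | ∑ a, s x a = 1}
  have hG : MeasurableSet G := by
    refine MeasurableSet.inter ?_ <|
      measurableSet_eq_fun (Finset.measurable_fun_sum _ fun a _ => hs a) measurable_const
    simp only [Set.ofPred_forall]
    exact MeasurableSet.iInter fun a => measurableSet_le measurable_const (hs a)
  have hsingle := isBehavior_const_single (T := T) a₀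
  refine ⟨G.piecewise s fun _ => Pi.single a₀ 1, ⟨fun a => ?_, fun x => ?_, fun x => ?_⟩, ?_⟩
  · exact measurable_pi_iff.1
      ((measurable_pi_iff.2 hs).piecewise hG (measurable_pi_iff.2 hsingle.measurable_apply)) a
  · by_cases hx : x ∈ G
    · rw [Set.piecewise_eq_of_mem _ _ _ hx]
      exact hx.1
    · rw [Set.piecewise_eq_of_notMem _ _ _ hx]
      exact hsingle.nonneg x
  · by_cases hx : x ∈ G
    · rw [Set.piecewise_eq_of_mem _ _ _ hx]
      exact hx.2
    · rw [Set.piecewise_eq_of_notMem _ _ _ hx]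
      exact hsingle.sum_eq_one x
  · filter_upwards [hs_nonneg, hs_sum] with x hx hx'
    exact Set.piecewise_eq_of_mem _ _ _ ⟨hx, hx'⟩

/-- The functionals `φ` are integration against `s`. -/
def Represents (lam : Measure T) (s : T → A → ℝ) (φ : A → WeakDual ℝ (Lp ℝ 2 lam)) : Prop :=
  ∀ a (g : Lp ℝ 2 lam), φ a g = ∫ x, s x a * g x ∂lam

/-- Behavior strategies as families of functionals on `L²`, which are compact in the weak-*
topology: the functionals of the single actions are positive and add up to integration. -/
def mixedFunctionals {T : Type*} [MeasurableSpace T] (lam : Measure T) (A : Type*) [Fintype A] :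
    Set (A → WeakDual ℝ (Lp ℝ 2 lam)) :=
  {φ | (∀ a (g : Lp ℝ 2 lam), 0 ≤ g → 0 ≤ φ a g) ∧ ∀ g : Lp ℝ 2 lam, ∑ a, φ a g = ∫ x, g x ∂lam}

theorem exists_represents {A : Type*} (φ : A → WeakDual ℝ (Lp ℝ 2 lam)) :
    ∃ f : A → Lp ℝ 2 lam, Represents lam (fun x a => f a x) φ := by
  refine ⟨fun a => (InnerProductSpace.toDual ℝ (Lp ℝ 2 lam)).symm (WeakDual.toStrongDual (φ a)),
    fun a g => ?_⟩
  have hinner := InnerProductSpace.toDual_symm_apply (x := g) (y := WeakDual.toStrongDual (φ a))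
  rw [L2.inner_def] at hinner
  refine hinner.symm.trans (integral_congr_ae (ae_of_all _ fun x => ?_))
  simp [mul_comm]

namespace mixedFunctionals

variable {φ : A → WeakDual ℝ (Lp ℝ 2 lam)}

theorem apply_le (hφ : φ ∈ mixedFunctionals lam A) (a : A) {g : Lp ℝ 2 lam} (hg : 0 ≤ g) :
    φ a g ≤ ∫ x, g x ∂lam := by
  rw [← hφ.2 g]
  exact Finset.single_le_sum (f := fun a => φ a g) (fun a _ => hφ.1 a g hg) (Finset.mem_univ a)

theorem abs_apply_le_apply_abs (hφ : φ ∈ mixedFunctionals lam A) (a : A) (g : Lp ℝ 2 lam) :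
    |φ a g| ≤ φ a |g| := by
  have hsub := hφ.1 a (|g| - g) (sub_nonneg.2 (le_abs_self g))
  have hadd := hφ.1 a (|g| - -g) (sub_nonneg.2 (neg_le_abs g))
  rw [map_sub] at hsub hadd
  rw [map_neg] at hadd
  exact abs_le.2 ⟨by linarith, by linarith⟩

theorem convex : Convex ℝ (mixedFunctionals lam A) := by
  intro φ hφ ψ hψ s t hs ht hst
  refine ⟨fun a g hg => ?_, fun g => ?_⟩
  · exact add_nonneg (mul_nonneg hs (hφ.1 a g hg)) (mul_nonneg ht (hψ.1 a g hg))
  · change ∑ a, (s * φ a g + t * ψ a g) = _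
    rw [Finset.sum_add_distrib, ← Finset.mul_sum, ← Finset.mul_sum, hφ.2, hψ.2, ← add_mul, hst,
      one_mul]

theorem isClosed : IsClosed (mixedFunctionals lam A) := by
  have hev (a : A) (g : Lp ℝ 2 lam) :
      Continuous fun φ : A → WeakDual ℝ (Lp ℝ 2 lam) => φ a g :=
    (WeakDual.eval_continuous g).comp (continuous_apply a)
  simp only [mixedFunctionals, Set.ofPred_and, Set.ofPred_forall]
  exact (isClosed_iInter fun a => isClosed_iInter fun g => isClosed_iInter fun _ =>
    isClosed_le continuous_const (hev a g)).inter <| isClosed_iInter fun g =>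
      isClosed_eq (continuous_finsetSum _ fun a _ => hev a g) continuous_const

variable [IsProbabilityMeasure lam]

theorem abs_apply_le (hφ : φ ∈ mixedFunctionals lam A) (a : A) (g : Lp ℝ 2 lam) :
    |φ a g| ≤ ‖g‖ :=
  calc |φ a g| ≤ φ a |g| := abs_apply_le_apply_abs hφ a g
    _ ≤ ∫ x, (|g| : Lp ℝ 2 lam) x ∂lam := apply_le hφ a (abs_nonneg g)
    _ = ∫ x, ‖g x‖ ∂lam := integral_congr_ae (Lp.coeFn_abs g)
    _ = (eLpNorm g 1 lam).toReal := by
        rw [integral_norm_eq_lintegral_enorm (Lp.aestronglyMeasurable g),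
          eLpNorm_one_eq_lintegral_enorm]
    _ ≤ ‖g‖ := ENNReal.toReal_mono (Lp.eLpNorm_ne_top g)
        (eLpNorm_le_eLpNorm_of_exponent_le (by norm_num) (Lp.aestronglyMeasurable g))

theorem mem_closedBall (hφ : φ ∈ mixedFunctionals lam A) (a : A) :
    φ a ∈ WeakDual.toStrongDual ⁻¹' Metric.closedBall (0 : StrongDual ℝ (Lp ℝ 2 lam)) 1 := by
  rw [Set.mem_preimage, mem_closedBall_zero_iff]
  refine ContinuousLinearMap.opNorm_le_bound _ zero_le_one fun g => ?_
  rw [one_mul]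
  exact abs_apply_le hφ a g

theorem isCompact : IsCompact (mixedFunctionals lam A) :=
  (isCompact_univ_pi fun _ : A => WeakDual.isCompact_closedBall
    (0 : StrongDual ℝ (Lp ℝ 2 lam)) 1).of_isClosed_subset isClosed fun _ hφ a _ =>
      mem_closedBall hφ a

theorem exists_represents_of_isBehavior {s : T → A → ℝ} (hs : IsBehavior s) :
    ∃ φ ∈ mixedFunctionals lam A, Represents lam s φ := by
  have hL (a : A) : MemLp (fun x => s x a) 2 lam :=
    MemLp.of_bound (hs.measurable_apply a).aestronglyMeasurable 1
      (ae_of_all _ fun x => hs.norm_le_one x a)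
  let φ : A → WeakDual ℝ (Lp ℝ 2 lam) := fun a =>
    StrongDual.toWeakDual (InnerProductSpace.toDual ℝ (Lp ℝ 2 lam) ((hL a).toLp _))
  have hφ : Represents lam s φ := by
    intro a g
    change inner ℝ ((hL a).toLp _) g = _
    rw [L2.inner_def]
    refine integral_congr_ae ?_
    filter_upwards [(hL a).coeFn_toLp] with x hx
    simp [hx, mul_comm]
  refine ⟨φ, ⟨fun a g hg => ?_, fun g => ?_⟩, hφ⟩
  · rw [hφ]
    refine integral_nonneg_of_ae ?_
    filter_upwards [(Lp.coeFn_nonneg g).2 hg] with x hx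
    exact mul_nonneg (hs.nonneg x a) hx
  · have hint : Integrable g lam := (Lp.memLp g).integrable (by norm_num)
    simp only [hφ _ g]
    rw [← integral_finsetSum _ fun a _ => hint.bdd_mul
      (hs.measurable_apply a).aestronglyMeasurable (ae_of_all _ fun x => hs.norm_le_one x a)]
    simp only [← Finset.sum_mul, hs.sum_eq_one, one_mul]

theorem nonempty [Nonempty A] : (mixedFunctionals lam A).Nonempty := by
  classical
  obtain ⟨a₀⟩ := ‹Nonempty A›
  obtain ⟨φ, hφ, -⟩ := exists_represents_of_isBehavior (lam := lam) (isBehavior_const_single a₀)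
  exact ⟨φ, hφ⟩

end mixedFunctionals

section Represents

variable [IsProbabilityMeasure lam] {s : T → A → ℝ} {φ : A → WeakDual ℝ (Lp ℝ 2 lam)}

theorem Represents.apply_indicatorConstLp {A : Type*} {s : T → A → ℝ}
    {φ : A → WeakDual ℝ (Lp ℝ 2 lam)} (h : Represents lam s φ) (a : A) {U : Set T}
    (hU : MeasurableSet U) :
    φ a (indicatorConstLp 2 hU (measure_ne_top lam U) 1) = ∫ x in U, s x a ∂lam := by
  rw [h, ← integral_indicator hU]
  refine integral_congr_ae ?_
  filter_upwards [indicatorConstLp_coeFn (p := 2) (hs := hU) (hμs := measure_ne_top lam U)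
    (c := (1 : ℝ))] with x hx
  by_cases hxU : x ∈ U <;> simp [hx, hxU]

theorem Represents.ae_nonneg (h : Represents lam s φ) (hφ : φ ∈ mixedFunctionals lam A)
    (hs : ∀ a, Integrable (fun x => s x a) lam) : ∀ᵐ x ∂lam, ∀ a, 0 ≤ s x a := by
  refine ae_all_iff.2 fun a => ae_nonneg_of_forall_setIntegral_nonneg (hs a) fun U hU _ => ?_
  rw [← h.apply_indicatorConstLp a hU]
  refine hφ.1 a _ ((Lp.coeFn_nonneg _).1 ?_)
  filter_upwards [indicatorConstLp_coeFn (p := 2) (hs := hU) (hμs := measure_ne_top lam U)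
    (c := (1 : ℝ))] with x hx
  rw [hx]
  exact Set.indicator_nonneg (fun _ _ => zero_le_one) _

theorem Represents.ae_sum_eq_one (h : Represents lam s φ) (hφ : φ ∈ mixedFunctionals lam A)
    (hs : ∀ a, Integrable (fun x => s x a) lam) : ∀ᵐ x ∂lam, ∑ a, s x a = 1 := by
  refine Integrable.ae_eq_of_forall_setIntegral_eq _ _
    (integrable_finsetSum _ fun a _ => hs a) (integrable_const (1 : ℝ)) fun U hU _ => ?_
  rw [integral_finsetSum _ fun a _ => (hs a).integrableOn]
  simp only [← h.apply_indicatorConstLp _ hU]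
  rw [hφ.2, integral_indicatorConstLp, setIntegral_const]

theorem mixedFunctionals.exists_isBehavior [Nonempty A] (hφ : φ ∈ mixedFunctionals lam A) :
    ∃ s, IsBehavior s ∧ Represents lam s φ := by
  obtain ⟨f, hf⟩ := exists_represents φ
  have hint (a : A) : Integrable (f a) lam := (Lp.memLp (f a)).integrable (by norm_num)
  obtain ⟨s, hs, hsf⟩ := exists_isBehavior_ae_eq
    (fun a => (Lp.stronglyMeasurable (f a)).measurable) (hf.ae_nonneg hφ hint)
    (hf.ae_sum_eq_one hφ hint)
  refine ⟨s, hs, fun a g => (hf a g).trans (integral_congr_ae ?_)⟩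
  filter_upwards [hsf] with x hx
  rw [hx]

end Represents

end Behavior

section BayesianGame

open Filter Topology

variable {Ω : Type*} [MeasurableSpace Ω]

/-- `ℓ ω` is the density of a signal in state `ω`, relative to the reference measure `lam`. -/
structure IsSignalDensity {T : Type*} [MeasurableSpace T] {lam : Measure T}
    (ℓ : Ω → Lp ℝ 2 lam) : Prop where
  nonneg : ∀ ω, 0 ≤ ℓ ω
  integral_eq_one : ∀ ω, ∫ x, ℓ ω x ∂lam = 1
  measurable_apply : ∀ ψ : WeakDual ℝ (Lp ℝ 2 lam), Measurable fun ω => ψ (ℓ ω)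

theorem IsSignalDensity.abs_apply_le_one {T : Type*} [MeasurableSpace T] {lam : Measure T}
    {A : Type*} [Fintype A] {ℓ : Ω → Lp ℝ 2 lam} (hℓ : IsSignalDensity ℓ)
    {φ : A → WeakDual ℝ (Lp ℝ 2 lam)} (hφ : φ ∈ mixedFunctionals lam A) (a : A) (ω : Ω) :
    |φ a (ℓ ω)| ≤ 1 := by
  rw [abs_of_nonneg (hφ.1 a _ (hℓ.nonneg ω)), ← hℓ.integral_eq_one ω]
  exact mixedFunctionals.apply_le hφ a (hℓ.nonneg ω)

variable {ι : Type*} {A : ι → Type*} [∀ j, Fintype (A j)]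
  {T : ι → Type*} [∀ j, MeasurableSpace (T j)] {lam : ∀ j, Measure (T j)}

theorem firstCountable_pi_mixedFunctionals [Countable ι]
    [∀ j, IsProbabilityMeasure (lam j)] [∀ j, MeasurableSpace.CountablyGenerated (T j)] :
    FirstCountableTopology (Set.univ.pi fun j => mixedFunctionals (lam j) (A j)) := by
  let K (j : ι) : Set (WeakDual ℝ (Lp ℝ 2 (lam j))) :=
    WeakDual.toStrongDual ⁻¹' Metric.closedBall (0 : StrongDual ℝ (Lp ℝ 2 (lam j))) 1
  have two_ne_top : Fact ((2 : ENNReal) ≠ ⊤) := ⟨by simp⟩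
  have (j : ι) : TopologicalSpace.MetrizableSpace (K j) :=
    WeakDual.metrizable_of_isCompact ℝ (Lp ℝ 2 (lam j)) (K j) (WeakDual.isCompact_closedBall _ _)
  let e : (Set.univ.pi fun j => mixedFunctionals (lam j) (A j)) → ∀ j, A j → K j := fun φ j a =>
    ⟨φ.1 j a, mixedFunctionals.mem_closedBall (φ.2 j (Set.mem_univ j)) a⟩
  have he : IsInducing e := by
    refine IsInducing.of_comp (g := fun q j a => (q j a).1) ?_ ?_ IsInducing.subtypeVal
    · exact continuous_pi fun j => continuous_pi fun a =>
        continuous_induced_rng.2 ((continuous_apply a).comp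
          ((continuous_apply j).comp continuous_subtype_val))
    · exact continuous_pi fun j => continuous_pi fun a => continuous_subtype_val.comp
        ((continuous_apply a).comp (continuous_apply j))
  exact he.firstCountableTopology

variable [Fintype ι] [DecidableEq ι]

/-- The expected payoff of player `i` in a game with private signals, when the signal of player `j`
has the density `ℓ j ω` in state `ω`, the opponents use `φ` and player `i` uses `χ`. -/
noncomputable def signalPayoff (P : Measure Ω) (ℓ : ∀ j, Ω → Lp ℝ 2 (lam j))
    (g : (∀ j, A j) → Ω → ℝ) (i : ι) (φ : ∀ j, A j → WeakDual ℝ (Lp ℝ 2 (lam j)))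
    (χ : A i → WeakDual ℝ (Lp ℝ 2 (lam i))) : ℝ :=
  ∫ ω, ∑ a, g a ω * (χ (a i) (ℓ i ω) * ∏ j ∈ Finset.univ.erase i, φ j (a j) (ℓ j ω)) ∂P

variable {P : Measure Ω} {ℓ : ∀ j, Ω → Lp ℝ 2 (lam j)} {g : (∀ j, A j) → Ω → ℝ} {i : ι}

theorem norm_signalPayoff_term_le (hℓ : ∀ j, IsSignalDensity (ℓ j))
    {φ : ∀ j, A j → WeakDual ℝ (Lp ℝ 2 (lam j))}
    (hφ : ∀ j, φ j ∈ mixedFunctionals (lam j) (A j))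
    {χ : A i → WeakDual ℝ (Lp ℝ 2 (lam i))} (hχ : χ ∈ mixedFunctionals (lam i) (A i))
    (a : ∀ j, A j) (ω : Ω) :
    ‖g a ω * (χ (a i) (ℓ i ω) * ∏ j ∈ Finset.univ.erase i, φ j (a j) (ℓ j ω))‖ ≤ |g a ω| := by
  rw [Real.norm_eq_abs, abs_mul, abs_mul, Finset.abs_prod]
  refine mul_le_of_le_one_right (abs_nonneg _) (mul_le_one₀ ((hℓ i).abs_apply_le_one hχ _ _)
    (Finset.prod_nonneg fun _ _ => abs_nonneg _) ?_)
  exact Finset.prod_le_one (fun _ _ => abs_nonneg _) fun j _ =>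
    (hℓ j).abs_apply_le_one (hφ j) _ _

theorem aestronglyMeasurable_signalPayoff_term {A : ι → Type*} {g : (∀ j, A j) → Ω → ℝ}
    (hℓ : ∀ j, IsSignalDensity (ℓ j)) (hg : ∀ a, Integrable (g a) P)
    (φ : ∀ j, A j → WeakDual ℝ (Lp ℝ 2 (lam j))) (χ : A i → WeakDual ℝ (Lp ℝ 2 (lam i)))
    (a : ∀ j, A j) :
    AEStronglyMeasurable (fun ω =>
      g a ω * (χ (a i) (ℓ i ω) * ∏ j ∈ Finset.univ.erase i, φ j (a j) (ℓ j ω))) P :=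
  (hg a).aestronglyMeasurable.mul (((hℓ i).measurable_apply _).mul
    (Finset.measurable_fun_prod _ fun j _ => (hℓ j).measurable_apply _)).aestronglyMeasurable

theorem signalPayoff_smul_add_smul (hℓ : ∀ j, IsSignalDensity (ℓ j))
    (hg : ∀ a, Integrable (g a) P) {φ : ∀ j, A j → WeakDual ℝ (Lp ℝ 2 (lam j))}
    (hφ : ∀ j, φ j ∈ mixedFunctionals (lam j) (A j))
    {χ χ' : A i → WeakDual ℝ (Lp ℝ 2 (lam i))} (hχ : χ ∈ mixedFunctionals (lam i) (A i))
    (hχ' : χ' ∈ mixedFunctionals (lam i) (A i)) (s t : ℝ) :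
    signalPayoff P ℓ g i φ (s • χ + t • χ') =
      s * signalPayoff P ℓ g i φ χ + t * signalPayoff P ℓ g i φ χ' := by
  have hint {χ : A i → WeakDual ℝ (Lp ℝ 2 (lam i))} (hχ : χ ∈ mixedFunctionals (lam i) (A i)) :
      Integrable (fun ω => ∑ a, g a ω *
        (χ (a i) (ℓ i ω) * ∏ j ∈ Finset.univ.erase i, φ j (a j) (ℓ j ω))) P :=
    integrable_finsetSum _ fun a _ =>
      (hg a).abs.mono' (aestronglyMeasurable_signalPayoff_term hℓ hg φ χ a)
        (ae_of_all _ fun ω => norm_signalPayoff_term_le hℓ hφ hχ a ω)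
  rw [signalPayoff, signalPayoff, signalPayoff, ← integral_const_mul, ← integral_const_mul,
    ← integral_add ((hint hχ).const_mul _) ((hint hχ').const_mul _)]
  congr 1
  ext ω
  rw [Finset.mul_sum, Finset.mul_sum, ← Finset.sum_add_distrib]
  refine Finset.sum_congr rfl fun a _ => ?_
  have apply_eq : (s • χ + t • χ') (a i) (ℓ i ω) = s * χ (a i) (ℓ i ω) + t * χ' (a i) (ℓ i ω) :=
    rfl
  rw [apply_eq]
  ring

theorem tendsto_signalPayoff (hℓ : ∀ j, IsSignalDensity (ℓ j)) (hg : ∀ a, Integrable (g a) P)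
    {φ : ℕ → ∀ j, A j → WeakDual ℝ (Lp ℝ 2 (lam j))}
    (hφ : ∀ n j, φ n j ∈ mixedFunctionals (lam j) (A j))
    {χ : ℕ → A i → WeakDual ℝ (Lp ℝ 2 (lam i))}
    (hχ : ∀ n, χ n ∈ mixedFunctionals (lam i) (A i))
    {φ' : ∀ j, A j → WeakDual ℝ (Lp ℝ 2 (lam j))} {χ' : A i → WeakDual ℝ (Lp ℝ 2 (lam i))}
    (hφ_lim : Tendsto φ atTop (𝓝 φ')) (hχ_lim : Tendsto χ atTop (𝓝 χ')) :
    Tendsto (fun n => signalPayoff P ℓ g i (φ n) (χ n)) atTop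
      (𝓝 (signalPayoff P ℓ g i φ' χ')) := by
  refine tendsto_integral_of_dominated_convergence (fun ω => ∑ a, |g a ω|)
    (fun n => ?_) (integrable_finsetSum _ fun a _ => (hg a).abs) (fun n => ?_) ?_
  · exact Finset.aestronglyMeasurable_fun_sum _ fun a _ =>
      aestronglyMeasurable_signalPayoff_term hℓ hg _ _ a
  · exact ae_of_all _ fun ω => (norm_sum_le _ _).trans
      (Finset.sum_le_sum fun a _ => norm_signalPayoff_term_le hℓ (hφ n) (hχ n) a ω)
  · refine ae_of_all _ fun ω => tendsto_finsetSum _ fun a _ => ?_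
    refine tendsto_const_nhds.mul (Tendsto.mul ?_ (tendsto_finsetProd _ fun j _ => ?_))
    · exact ((WeakDual.eval_continuous (ℓ i ω)).tendsto _).comp
        (((continuous_apply (a i)).tendsto χ').comp hχ_lim)
    · exact ((WeakDual.eval_continuous (ℓ j ω)).tendsto _).comp (((continuous_apply (a j)).tendsto
        (φ' j)).comp (((continuous_apply j).tendsto φ').comp hφ_lim))

theorem concaveOn_sum_signalPayoff_sub {g : ι → (∀ j, A j) → Ω → ℝ}
    (hℓ : ∀ j, IsSignalDensity (ℓ j)) (hg : ∀ i a, Integrable (g i a) P)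
    {φ : ∀ j, A j → WeakDual ℝ (Lp ℝ 2 (lam j))}
    (hφ : ∀ j, φ j ∈ mixedFunctionals (lam j) (A j)) (b : ι → ℝ) :
    ConcaveOn ℝ (Set.univ.pi fun j => mixedFunctionals (lam j) (A j))
      fun ψ => ∑ i, (signalPayoff P ℓ (g i) i φ (ψ i) - b i) := by
  refine ⟨convex_pi fun j _ => mixedFunctionals.convex, fun ψ hψ ψ' hψ' s t _ _ hst => ?_⟩
  simp only [smul_eq_mul, Finset.mul_sum, ← Finset.sum_add_distrib]
  refine Finset.sum_le_sum fun i _ => le_of_eq ?_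
  rw [Pi.add_apply, Pi.smul_apply, Pi.smul_apply, signalPayoff_smul_add_smul hℓ (hg i) hφ
    (hψ i (Set.mem_univ i)) (hψ' i (Set.mem_univ i))]
  linear_combination -b i * hst

variable [∀ j, IsProbabilityMeasure (lam j)]

theorem continuousOn_signalPayoff [∀ j, MeasurableSpace.CountablyGenerated (T j)]
    (hℓ : ∀ j, IsSignalDensity (ℓ j)) (hg : ∀ a, Integrable (g a) P)
    {χ : (∀ j, A j → WeakDual ℝ (Lp ℝ 2 (lam j))) → A i → WeakDual ℝ (Lp ℝ 2 (lam i))}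
    (hχ : Continuous χ) (hχ_mem : Set.MapsTo χ (Set.univ.pi fun j => mixedFunctionals (lam j) (A j))
      (mixedFunctionals (lam i) (A i))) :
    ContinuousOn (fun φ => signalPayoff P ℓ g i φ (χ φ))
      (Set.univ.pi fun j => mixedFunctionals (lam j) (A j)) := by
  have : FirstCountableTopology (Set.univ.pi fun j => mixedFunctionals (lam j) (A j)) :=
    firstCountable_pi_mixedFunctionals
  rw [continuousOn_iff_continuous_domRestrict, continuous_iff_seqContinuous]
  intro φ φ' hφ
  have hφ' := (continuous_subtype_val.tendsto φ').comp hφ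
  exact tendsto_signalPayoff hℓ hg (fun n j => (φ n).2 j (Set.mem_univ j))
    (fun n => hχ_mem (φ n).2) hφ' ((hχ.tendsto _).comp hφ')

/-- Ky Fan's inequality is applied to the sum of the gains from deviating from `φ` to `ψ`. -/
theorem exists_signalPayoff_equilibrium [∀ j, Nonempty (A j)]
    [∀ j, MeasurableSpace.CountablyGenerated (T j)] {g : ι → (∀ j, A j) → Ω → ℝ}
    (hℓ : ∀ j, IsSignalDensity (ℓ j)) (hg : ∀ i a, Integrable (g i a) P) :
    ∃ φ : ∀ j, A j → WeakDual ℝ (Lp ℝ 2 (lam j)),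
      (∀ j, φ j ∈ mixedFunctionals (lam j) (A j)) ∧
      ∀ i, ∀ χ ∈ mixedFunctionals (lam i) (A i),
        signalPayoff P ℓ (g i) i φ χ ≤ signalPayoff P ℓ (g i) i φ (φ i) := by
  set S : Set (∀ j, A j → WeakDual ℝ (Lp ℝ 2 (lam j))) :=
    Set.univ.pi fun j => mixedFunctionals (lam j) (A j)
  have hcont (ψ) (hψ : ψ ∈ S) : ContinuousOn (fun φ => ∑ i, (signalPayoff P ℓ (g i) i φ (ψ i) -
      signalPayoff P ℓ (g i) i φ (φ i))) S :=
    continuousOn_finsetSum _ fun i _ =>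
      (continuousOn_signalPayoff hℓ (hg i) (χ := fun _ => ψ i) continuous_const
        fun _ _ => hψ i (Set.mem_univ i)).sub <|
      continuousOn_signalPayoff hℓ (hg i) (χ := fun φ => φ i) (continuous_apply i)
        fun φ hφ => hφ i (Set.mem_univ i)
  obtain ⟨φ, hφ, hgain⟩ := exists_forall_nonpos_of_concaveOn (S := S)
    (isCompact_univ_pi fun j => mixedFunctionals.isCompact)
    (convex_pi fun j _ => mixedFunctionals.convex)
    (Set.univ_pi_nonempty_iff.2 fun j => mixedFunctionals.nonempty) hcont
    (fun φ hφ => concaveOn_sum_signalPayoff_sub hℓ hg (fun j => hφ j (Set.mem_univ j)) _)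
    fun φ _ => by simp
  refine ⟨φ, fun j => hφ j (Set.mem_univ j), fun i χ hχ => ?_⟩
  have hmem : Function.update φ i χ ∈ S :=
    (Set.update_mem_pi_iff_of_mem hφ).2 fun _ => hχ
  have hsum := hgain _ hmem
  rw [Finset.sum_eq_single i (fun j _ hj => by simp [hj]) (by simp), Function.update_self] at hsum
  exact sub_nonpos.1 hsum

end BayesianGame

section QuadraticForm

open Matrix

variable {n : Type*}

section SymmetricMatrix

variable [Fintype n] {A : Matrix n n ℝ}

theorem dotProduct_mulVec_comm_of_posDef (hA : A.PosDef) (x y : n → ℝ) :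
    x ⬝ᵥ A *ᵥ y = A *ᵥ x ⬝ᵥ y := by
  have transpose_eq : Aᵀ = A := by
    rw [← conjTranspose_eq_transpose_of_trivial]
    exact hA.isHermitian
  rw [dotProduct_mulVec, ← mulVec_transpose, transpose_eq]

theorem dotProduct_mulVec_nonneg_of_posDef (hA : A.PosDef) (x : n → ℝ) : 0 ≤ x ⬝ᵥ A *ᵥ x := by
  simpa using hA.posSemidef.dotProduct_mulVec_nonneg x

theorem mulVec_apply_sq_le_of_posDef (hA : A.PosDef) (y : n → ℝ) (k : n) :
    (A *ᵥ y) k ^ 2 ≤ A k k * (y ⬝ᵥ A *ᵥ y) := by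
  classical
  have cauchySchwarz := LinearMap.BilinForm.apply_sq_le_of_symm (toBilin' A)
    (fun x => by
      rw [toBilin'_apply']
      exact dotProduct_mulVec_nonneg_of_posDef hA x)
    ⟨fun x y => by
      rw [toBilin'_apply', toBilin'_apply', dotProduct_mulVec_comm_of_posDef hA, dotProduct_comm]
      rfl⟩ (Pi.single k 1) y
  simpa [toBilin'_apply', single_one_dotProduct] using cauchySchwarz

end SymmetricMatrix

section OptimalCount

variable [Fintype n]

/-- `q` minimizes `f` among the count vectors with sum `N`. -/
def IsOptimalCount {α : Type*} [LE α] (f : (n → ℕ) → α) (N : ℕ) (q : n → ℕ) : Prop :=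
  ∑ k, q k = N ∧ ∀ q' : n → ℕ, ∑ k, q' k = N → f q ≤ f q'

theorem exists_isOptimalCount {α : Type*} [LinearOrder α] [Nonempty n] (f : (n → ℕ) → α) (N : ℕ) :
    ∃ q, IsOptimalCount f N q := by
  classical
  obtain ⟨k⟩ := ‹Nonempty n›
  obtain ⟨q, hq, h⟩ := Finset.exists_min_image (Finset.piAntidiag (Finset.univ : Finset n) N) f
    ⟨Pi.single k N, by simp [Finset.mem_piAntidiag]⟩
  exact ⟨q, (Finset.mem_piAntidiag.1 hq).1, fun q' hq' =>
    h q' (by simp [Finset.mem_piAntidiag, hq'])⟩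

theorem IsOptimalCount.apply_le {α : Type*} [LE α] {f : (n → ℕ) → α} {N : ℕ} {q : n → ℕ}
    (hq : IsOptimalCount f N q) (k : n) : q k ≤ N :=
  hq.1 ▸ Finset.single_le_sum (f := q) (fun _ _ => Nat.zero_le _) (Finset.mem_univ k)

theorem exists_forall_div_card_le_and_sum_eq [Nonempty n] (N : ℕ) :
    ∃ b : n → ℕ, ∑ k, b k = N ∧ ∀ k, N / Fintype.card n ≤ b k := by
  classical
  obtain ⟨k₀⟩ := ‹Nonempty n›
  refine ⟨fun k => N / Fintype.card n + (Pi.single k₀ (N % Fintype.card n) : n → ℕ) k, ?_,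
    fun k => Nat.le_add_right _ _⟩
  simp only [Finset.sum_add_distrib, Finset.sum_const, Finset.card_univ, smul_eq_mul,
    Finset.sum_pi_single', Finset.mem_univ, if_true]
  exact Nat.div_add_mod N (Fintype.card n)

theorem mul_sum_sub_sum_mul_le {x a : n → ℝ} {R : ℝ} (h : ∀ j k, x j * a k - x k * a j ≤ R)
    (j : n) : x j * ∑ k, a k - (∑ k, x k) * a j ≤ Fintype.card n * R := by
  rw [Finset.mul_sum, Finset.sum_mul, ← Finset.sum_sub_distrib]
  exact (Finset.sum_le_card_nsmul _ _ R fun k _ => h j k).trans_eq (by simp)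

end OptimalCount

variable [DecidableEq n] {P : Matrix n n ℝ}

/-- The posterior precision matrix of the signal means `C θ` after `q k` observations of each
signal `k`, when `P` is their prior precision matrix. -/
def precision (P : Matrix n n ℝ) (q : n → ℕ) : Matrix n n ℝ :=
  P + diagonal fun k => (q k : ℝ)

theorem posDef_precision (hP : P.PosDef) (q : n → ℕ) : (precision P q).PosDef :=
  hP.add_posSemidef (PosSemidef.diagonal fun k => Nat.cast_nonneg (q k))

theorem precision_add_single (P : Matrix n n ℝ) (q : n → ℕ) (k : n) :
    precision P (q + Pi.single k 1) = precision P q + diagonal (Pi.single k 1) := by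
  rw [precision, precision, add_assoc, diagonal_add]
  congr 2
  ext l
  by_cases h : l = k
  · subst h
    simp
  · simp [h]

variable [Fintype n] {q : n → ℕ} {w y : n → ℝ}

theorem precision_mulVec (P : Matrix n n ℝ) (q : n → ℕ) (y : n → ℝ) (k : n) :
    (precision P q *ᵥ y) k = (P *ᵥ y) k + q k * y k := by
  rw [precision, add_mulVec, Pi.add_apply, mulVec_diagonal]

/-- The posterior covariances of `∑ k, w k * (C θ) k` with the signal means. -/
noncomputable def residualCov (P : Matrix n n ℝ) (w : n → ℝ) (q : n → ℕ) : n → ℝ :=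
  (precision P q)⁻¹ *ᵥ w

/-- The posterior variance of `∑ k, w k * (C θ) k`. -/
noncomputable def residualVariance (P : Matrix n n ℝ) (w : n → ℝ) (q : n → ℕ) : ℝ :=
  w ⬝ᵥ residualCov P w q

theorem isUnit_det_precision (hP : P.PosDef) (q : n → ℕ) : IsUnit (precision P q).det :=
  (isUnit_iff_isUnit_det _).1 (posDef_precision hP q).isUnit

theorem precision_mulVec_residualCov (hP : P.PosDef) (w : n → ℝ) (q : n → ℕ) :
    precision P q *ᵥ residualCov P w q = w := by
  rw [residualCov, mulVec_mulVec, mul_nonsing_inv _ (isUnit_det_precision hP q), one_mulVec]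

theorem residualCov_eq_of_mulVec_eq (hP : P.PosDef) (hy : precision P q *ᵥ y = w) :
    residualCov P w q = y := by
  rw [residualCov, ← hy, mulVec_mulVec, nonsing_inv_mul _ (isUnit_det_precision hP q), one_mulVec]

theorem residualVariance_nonneg (hP : P.PosDef) (w : n → ℝ) (q : n → ℕ) :
    0 ≤ residualVariance P w q :=
  dotProduct_mulVec_nonneg_of_posDef (posDef_precision hP q).inv w

theorem residualVariance_single (P : Matrix n n ℝ) (q : n → ℕ) (k : n) :
    residualVariance P (Pi.single k 1) q = residualCov P (Pi.single k 1) q k := by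
  rw [residualVariance, single_one_dotProduct]

theorem dotProduct_residualCov_single (hP : P.PosDef) (w : n → ℝ) (q : n → ℕ) (k : n) :
    w ⬝ᵥ residualCov P (Pi.single k 1) q = residualCov P w q k := by
  nth_rewrite 1 [← precision_mulVec_residualCov hP w q]
  rw [← dotProduct_mulVec_comm_of_posDef (posDef_precision hP q), precision_mulVec_residualCov hP,
    dotProduct_single_one]

theorem residualCov_add_single (hP : P.PosDef) (w : n → ℝ) (q : n → ℕ) (k : n) :
    residualCov P w (q + Pi.single k 1) = residualCov P w q -
      (residualCov P w q k / (1 + residualVariance P (Pi.single k 1) q)) •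
        residualCov P (Pi.single k 1) q := by
  have hz := residualVariance_nonneg hP (Pi.single k 1) q
  apply residualCov_eq_of_mulVec_eq hP
  rw [precision_add_single, add_mulVec, mulVec_sub, mulVec_smul, precision_mulVec_residualCov hP,
    precision_mulVec_residualCov hP]
  ext l
  rw [Pi.add_apply, mulVec_diagonal]
  by_cases h : l = k
  · subst h
    rw [residualVariance_single] at hz ⊢
    simp only [Pi.sub_apply, Pi.smul_apply, Pi.single_eq_same, smul_eq_mul, mul_one, one_mul]
    field_simp
    ring
  · simp [h]

theorem residualVariance_add_single (hP : P.PosDef) (w : n → ℝ) (q : n → ℕ) (k : n) :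
    residualVariance P w (q + Pi.single k 1) = residualVariance P w q -
      residualCov P w q k ^ 2 / (1 + residualVariance P (Pi.single k 1) q) := by
  rw [residualVariance, residualCov_add_single hP, dotProduct_sub, dotProduct_smul,
    dotProduct_residualCov_single hP, smul_eq_mul, ← residualVariance]
  ring

theorem residualVariance_add_single_le (hP : P.PosDef) (w : n → ℝ) (q : n → ℕ) (k : n) :
    residualVariance P w (q + Pi.single k 1) ≤ residualVariance P w q := by
  have hz := residualVariance_nonneg hP (Pi.single k 1) q
  rw [residualVariance_add_single hP]
  exact sub_le_self _ (by positivity)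

theorem exists_residualVariance_add_single_lt (hP : P.PosDef) (hw : w ≠ 0) (q : n → ℕ) :
    ∃ k, residualVariance P w (q + Pi.single k 1) < residualVariance P w q := by
  have hy : residualCov P w q ≠ 0 := by
    intro h
    apply hw
    rw [← precision_mulVec_residualCov hP w q, h, mulVec_zero]
  obtain ⟨k, hk⟩ := Function.ne_iff.1 hy
  have hk : residualCov P w q k ≠ 0 := hk
  have hz := residualVariance_nonneg hP (Pi.single k 1) q
  refine ⟨k, ?_⟩
  rw [residualVariance_add_single hP]
  exact sub_lt_self _ (by positivity)

theorem sq_le_mul_residualVariance (hP : P.PosDef) (w : n → ℝ) (q : n → ℕ) (k : n) :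
    w k ^ 2 ≤ (P k k + q k) * residualVariance P w q := by
  have h := mulVec_apply_sq_le_of_posDef (posDef_precision hP q) (residualCov P w q) k
  rw [precision_mulVec_residualCov hP, dotProduct_comm, ← residualVariance] at h
  simpa [precision] using h

section LowerBound

variable {μ : ℝ}

theorem mul_sum_sq_residualCov_le (hP : P.PosDef) (w : n → ℝ) (hq : ∀ k, μ ≤ q k) :
    μ * ∑ k, residualCov P w q k ^ 2 ≤ residualVariance P w q := by
  set y := residualCov P w q
  calc μ * ∑ k, y k ^ 2 ≤ ∑ k, y k * (q k * y k) := by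
        rw [Finset.mul_sum]
        refine Finset.sum_le_sum fun k _ => ?_
        rw [mul_left_comm, ← sq]
        exact mul_le_mul_of_nonneg_right (hq k) (sq_nonneg _)
    _ ≤ y ⬝ᵥ P *ᵥ y + ∑ k, y k * (q k * y k) :=
        le_add_of_nonneg_left (dotProduct_mulVec_nonneg_of_posDef hP y)
    _ = y ⬝ᵥ precision P q *ᵥ y := by
        simp only [dotProduct, precision_mulVec, mul_add, Finset.sum_add_distrib]
    _ = residualVariance P w q := by
        rw [precision_mulVec_residualCov hP, dotProduct_comm, residualVariance]

theorem mul_abs_residualCov_le (hP : P.PosDef) (w : n → ℝ) (hμ : 0 ≤ μ) (hq : ∀ k, μ ≤ q k)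
    (k : n) : μ * |residualCov P w q k| ≤ ∑ l, |w l| := by
  set y := residualCov P w q
  have : Nonempty n := ⟨k⟩
  obtain ⟨m, hm⟩ := Finite.exists_max fun l => |y l|
  refine (mul_le_mul_of_nonneg_left (hm k) hμ).trans ?_
  rcases (abs_nonneg (y m)).eq_or_lt with h0 | hpos
  · rw [← h0, mul_zero]
    exact Finset.sum_nonneg fun l _ => abs_nonneg _
  refine le_of_mul_le_mul_right ?_ hpos
  calc μ * |y m| * |y m| = μ * y m ^ 2 := by rw [mul_assoc, abs_mul_abs_self, sq]
    _ ≤ μ * ∑ l, y l ^ 2 := mul_le_mul_of_nonneg_left (Finset.single_le_sum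
        (f := fun l => y l ^ 2) (fun l _ => sq_nonneg _) (Finset.mem_univ m)) hμ
    _ ≤ ∑ l, w l * y l := mul_sum_sq_residualCov_le hP w hq
    _ ≤ ∑ l, |w l| * |y m| := Finset.sum_le_sum fun l _ => (le_abs_self _).trans <| by
        rw [abs_mul]
        exact mul_le_mul_of_nonneg_left (hm l) (abs_nonneg _)
    _ = (∑ l, |w l|) * |y m| := (Finset.sum_mul _ _ _).symm

theorem mul_residualVariance_le (hP : P.PosDef) (w : n → ℝ) (hμ : 0 ≤ μ) (hq : ∀ k, μ ≤ q k) :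
    μ * residualVariance P w q ≤ (∑ l, |w l|) ^ 2 := by
  rw [residualVariance, dotProduct, Finset.mul_sum, sq, Finset.sum_mul]
  refine Finset.sum_le_sum fun l _ => ?_
  calc μ * (w l * residualCov P w q l) ≤ μ * |w l * residualCov P w q l| :=
        mul_le_mul_of_nonneg_left (le_abs_self _) hμ
    _ = |w l| * (μ * |residualCov P w q l|) := by rw [abs_mul]; ring
    _ ≤ |w l| * ∑ l, |w l| :=
        mul_le_mul_of_nonneg_left (mul_abs_residualCov_le hP w hμ hq l) (abs_nonneg _)

theorem residualVariance_single_le (hP : P.PosDef) (hμ : 0 < μ) (hq : ∀ k, μ ≤ q k) (k : n) :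
    residualVariance P (Pi.single k 1) q ≤ 1 / μ := by
  have sum_abs : ∑ l, |(Pi.single k 1 : n → ℝ) l| = 1 := by
    simp [Pi.single_apply, apply_ite abs]
  have h := mul_residualVariance_le hP (Pi.single k 1) hμ.le hq
  rw [sum_abs, one_pow] at h
  rwa [le_div_iff₀ hμ, mul_comm]

theorem abs_mul_residualCov_sub_le (hP : P.PosDef) (w : n → ℝ) (hμ : 0 < μ) (hq : ∀ k, μ ≤ q k)
    (l : n) : |q l * residualCov P w q l - w l| ≤ (∑ i, ∑ j, |P i j|) * (∑ j, |w j|) / μ := by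
  set y := residualCov P w q
  have residual_eq : q l * y l - w l = -∑ j, P l j * y j := by
    have h := congrFun (precision_mulVec_residualCov hP w q) l
    rw [precision_mulVec] at h
    rw [← h, sub_add_cancel_right]
    rfl
  rw [residual_eq, abs_neg, mul_div_assoc]
  calc |∑ j, P l j * y j| ≤ ∑ j, |P l j| * |y j| := by
        simp only [← abs_mul]
        exact Finset.abs_sum_le_sum_abs _ _
    _ ≤ ∑ j, |P l j| * ((∑ j, |w j|) / μ) := by
        refine Finset.sum_le_sum fun j _ => mul_le_mul_of_nonneg_left ?_ (abs_nonneg _)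
        rw [le_div_iff₀' hμ]
        exact mul_abs_residualCov_le hP w hμ.le hq j
    _ = (∑ j, |P l j|) * ((∑ j, |w j|) / μ) := (Finset.sum_mul _ _ _).symm
    _ ≤ (∑ i, ∑ j, |P i j|) * ((∑ j, |w j|) / μ) := by
        refine mul_le_mul_of_nonneg_right ?_ (by positivity)
        exact Finset.single_le_sum (f := fun i => ∑ j, |P i j|)
          (fun i _ => Finset.sum_nonneg fun j _ => abs_nonneg _) (Finset.mem_univ l)

end LowerBound

namespace IsOptimalCount

variable {N : ℕ} {μ : ℝ}

/-- Otherwise the `j`-th signal would better be replaced by the `k`-th one. -/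
theorem abs_residualCov_le (hP : P.PosDef) {j : n}
    (hq : IsOptimalCount (residualVariance P w) N (q + Pi.single j 1)) (hμ : 0 < μ)
    (hqμ : ∀ k, μ ≤ q k) (k : n) :
    |residualCov P w q k| ≤ |residualCov P w q j| * (1 + 1 / μ) := by
  have hzj := residualVariance_nonneg hP (Pi.single j 1) q
  have hzk := residualVariance_nonneg hP (Pi.single k 1) q
  have hzk_le := residualVariance_single_le hP hμ hqμ k
  have hopt := hq.2 (q + Pi.single k 1) (by
    rw [← hq.1]
    simp [Finset.sum_add_distrib])
  rw [residualVariance_add_single hP, residualVariance_add_single hP] at hopt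
  have hsq : residualCov P w q k ^ 2 ≤
      residualCov P w q j ^ 2 * (1 + residualVariance P (Pi.single k 1) q) := by
    rw [← div_le_iff₀ (by linarith)]
    have := div_le_self (sq_nonneg (residualCov P w q j)) (le_add_of_nonneg_right hzj)
    linarith
  have : 0 ≤ 1 / μ := by positivity
  refine (abs_le_of_sq_le_sq' ?_ (by positivity)).2
  calc |residualCov P w q k| ^ 2 = residualCov P w q k ^ 2 := sq_abs _
    _ ≤ residualCov P w q j ^ 2 * (1 + 1 / μ) :=
        hsq.trans (mul_le_mul_of_nonneg_left (by linarith) (sq_nonneg _))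
    _ ≤ residualCov P w q j ^ 2 * (1 + 1 / μ) ^ 2 :=
        mul_le_mul_of_nonneg_left (le_self_pow₀ (by linarith) two_ne_zero) (sq_nonneg _)
    _ = (|residualCov P w q j| * (1 + 1 / μ)) ^ 2 := by rw [mul_pow, sq_abs]

theorem mul_abs_le_of_add_single (hP : P.PosDef) {j : n}
    (hq : IsOptimalCount (residualVariance P w) N (q + Pi.single j 1)) (hμ : 1 ≤ μ)
    (hqμ : ∀ k, μ ≤ q k) (k : n) :
    q j * |w k| ≤
      q k * |w j| + N * ((3 * (∑ i, ∑ j, |P i j|) + 1) * (∑ l, |w l|) / μ) := by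
  have hμ0 : 0 < μ := by linarith
  have hμ1 : 1 / μ ≤ 1 := by rwa [div_le_one hμ0]
  set ε := (∑ i, ∑ j, |P i j|) * (∑ l, |w l|) / μ with hε
  have hε0 : 0 ≤ ε := by positivity
  set y := residualCov P w q
  have abs_sub_le (l : n) : abs (q l * |y l| - |w l|) ≤ ε := by
    rw [← Nat.abs_cast (q l), ← abs_mul]
    exact (abs_abs_sub_abs_le_abs_sub _ _).trans (abs_mul_residualCov_sub_le hP w hμ0 hqμ l)
  have hk : |w k| - ε ≤ q k * |y k| := by linarith [(abs_le.1 (abs_sub_le k)).1]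
  have hj : q j * |y j| ≤ |w j| + ε := by linarith [(abs_le.1 (abs_sub_le j)).2]
  have hwj : |w j| / μ ≤ (∑ l, |w l|) / μ := by
    gcongr
    exact Finset.single_le_sum (f := fun l => |w l|) (fun l _ => abs_nonneg _) (Finset.mem_univ j)
  have hεμ : ε * (1 / μ) ≤ ε * 1 := mul_le_mul_of_nonneg_left hμ1 hε0
  have hqN (l : n) : q l ≤ N := (Nat.le_add_right _ _).trans (hq.apply_le l)
  have chain : q j * (|w k| - ε) ≤ q k * (|w j| + 2 * ε + (∑ l, |w l|) / μ) :=
    calc q j * (|w k| - ε) ≤ q j * (q k * |y k|) := by gcongr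
      _ ≤ q j * (q k * (|y j| * (1 + 1 / μ))) := by
          gcongr
          exact hq.abs_residualCov_le hP hμ0 hqμ k
      _ = q k * ((q j * |y j|) * (1 + 1 / μ)) := by ring
      _ ≤ q k * ((|w j| + ε) * (1 + 1 / μ)) := by gcongr
      _ = q k * (|w j| + |w j| / μ + ε + ε * (1 / μ)) := by ring
      _ ≤ q k * (|w j| + 2 * ε + (∑ l, |w l|) / μ) :=
          mul_le_mul_of_nonneg_left (by linarith) (Nat.cast_nonneg _)
  calc q j * |w k| ≤ q k * |w j| + (q j * ε + q k * (2 * ε + (∑ l, |w l|) / μ)) := by linarith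
    _ ≤ q k * |w j| + (N * ε + N * (2 * ε + (∑ l, |w l|) / μ)) := by
        gcongr <;> exact hqN _
    _ = _ := by rw [hε]; ring

/-- In an optimal count vector, the counts are proportional to the weights up to a constant. -/
theorem mul_abs_sub_mul_abs_le (hP : P.PosDef) (hq : IsOptimalCount (residualVariance P w) N q)
    (hμ : 1 ≤ μ) (hqμ : ∀ k, μ + 1 ≤ q k) (j k : n) :
    q j * |w k| - q k * |w j| ≤
      N * ((3 * (∑ i, ∑ j, |P i j|) + 1) * (∑ l, |w l|) / μ) + ∑ l, |w l| := by
  have hqj : 1 ≤ q j := by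
    have : (1 : ℝ) ≤ q j := by linarith [hqμ j]
    exact_mod_cast this
  obtain ⟨q, rfl⟩ : ∃ q', q = q' + Pi.single j 1 :=
    ⟨q - Pi.single j 1,
      (tsub_add_cancel_of_le (update_le_iff.2 ⟨hqj, fun _ _ => Nat.zero_le _⟩)).symm⟩
  have hqμ' (l : n) : μ ≤ q l := by
    have hl := hqμ l
    have single_le : (Pi.single j 1 : n → ℕ) l ≤ 1 := Pi.single_apply j 1 l ▸ by split_ifs <;> simp
    have : ((Pi.single j 1 : n → ℕ) l : ℝ) ≤ 1 := by exact_mod_cast single_le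
    rw [Pi.add_apply, Nat.cast_add] at hl
    linarith
  have h := hq.mul_abs_le_of_add_single hP hμ hqμ' k
  have hwk : |w k| ≤ ∑ l, |w l| :=
    Finset.single_le_sum (f := fun l => |w l|) (fun l _ => abs_nonneg _) (Finset.mem_univ k)
  have hqk : (q k : ℝ) * |w j| ≤ (q + Pi.single j 1 : n → ℕ) k * |w j| := by
    gcongr
    exact Nat.le_add_right _ _
  have hqj_mul : ((q + Pi.single j 1 : n → ℕ) j : ℝ) * |w k| = q j * |w k| + |w k| := by
    simp [add_mul]
  linarith

/-- In an optimal count vector, all counts are of the order of their sum. -/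
theorem sq_mul_le (hP : P.PosDef) (hq : IsOptimalCount (residualVariance P w) N q)
    (hN : 2 * Fintype.card n ≤ N) (k : n) :
    w k ^ 2 * N ≤ (P k k + q k) * (2 * Fintype.card n * (∑ l, |w l|) ^ 2) := by
  have : Nonempty n := ⟨k⟩
  obtain ⟨b, hb, hb_le⟩ := exists_forall_div_card_le_and_sum_eq (n := n) N
  set m := N / Fintype.card n with hm
  have hNm : (N : ℝ) ≤ 2 * Fintype.card n * m := by
    have hcard : 0 < Fintype.card n := Fintype.card_pos
    have hmod := Nat.mod_lt N hcard
    have hdiv := Nat.div_add_mod N (Fintype.card n)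
    have hmul : Fintype.card n * 1 ≤ Fintype.card n * m :=
      Nat.mul_le_mul_left _ ((Nat.le_div_iff_mul_le hcard).2 (by omega))
    have : N ≤ 2 * (Fintype.card n * m) := by
      rw [← hm] at hdiv
      omega
    rw [mul_assoc]
    exact_mod_cast this
  have hPk : 0 < P k k := hP.diag_pos
  have hf := residualVariance_nonneg hP w q
  calc w k ^ 2 * N ≤ ((P k k + q k) * residualVariance P w q) * (2 * Fintype.card n * m) := by
        gcongr
        exact sq_le_mul_residualVariance hP w q k
    _ = (P k k + q k) * (2 * Fintype.card n * (m * residualVariance P w q)) := by ring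
    _ ≤ (P k k + q k) * (2 * Fintype.card n * (m * residualVariance P w b)) := by
        gcongr
        exact hq.2 b hb
    _ ≤ _ := by
        gcongr
        exact mul_residualVariance_le hP w (Nat.cast_nonneg _) fun l => by exact_mod_cast hb_le l

end IsOptimalCount

theorem exists_mul_sub_le_of_isOptimalCount (hP : P.PosDef) (hw : ∀ k, w k ≠ 0) :
    ∃ c > (0 : ℝ), ∃ d : ℝ, ∀ N ≥ 2 * Fintype.card n, ∀ q,
      IsOptimalCount (residualVariance P w) N q → ∀ k, c * N - d ≤ q k := by
  rcases isEmpty_or_nonempty n with hn | hn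
  · exact ⟨1, one_pos, 0, fun _ _ _ _ k => isEmptyElim k⟩
  obtain ⟨k₀, hk₀⟩ := Finite.exists_min fun k => |w k|
  obtain ⟨k₁, hk₁⟩ := Finite.exists_max fun k => P k k
  have hv : 0 < |w k₀| := abs_pos.2 (hw k₀)
  have hW : 0 < ∑ l, |w l| := Finset.sum_pos (fun l _ => abs_pos.2 (hw l)) Finset.univ_nonempty
  have : 0 < Fintype.card n := Fintype.card_pos
  refine ⟨|w k₀| ^ 2 / (2 * Fintype.card n * (∑ l, |w l|) ^ 2), by positivity, P k₁ k₁,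
    fun N hN q hq k => ?_⟩
  rw [sub_le_iff_le_add', div_mul_eq_mul_div, div_le_iff₀ (by positivity)]
  calc |w k₀| ^ 2 * N ≤ |w k| ^ 2 * N := by
        gcongr ?_ ^ 2 * _
        exact hk₀ k
    _ ≤ (P k k + q k) * (2 * Fintype.card n * (∑ l, |w l|) ^ 2) := by
        rw [sq_abs]
        exact hq.sq_mul_le hP hN k
    _ ≤ _ := by
        gcongr
        exact hk₁ k

theorem exists_mul_abs_sub_le_of_isOptimalCount (hP : P.PosDef) (hw : ∀ k, w k ≠ 0) :
    ∃ R : ℝ, ∃ N₀ : ℕ, ∀ N ≥ N₀, ∀ q, IsOptimalCount (residualVariance P w) N q →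
      ∀ j k, q j * |w k| - q k * |w j| ≤ R := by
  obtain ⟨c, hc, d, hcd⟩ := exists_mul_sub_le_of_isOptimalCount hP hw
  set D := (3 * (∑ i, ∑ j, |P i j|) + 1) * ∑ l, |w l| with hD
  obtain ⟨N₀, hN₀⟩ := exists_nat_ge (max (2 / c) (2 * (d + 1) / c))
  refine ⟨2 * D / c + ∑ l, |w l|, max N₀ (2 * Fintype.card n), fun N hN q hq j k => ?_⟩
  have hN₀N : (N₀ : ℝ) ≤ N := by exact_mod_cast (le_max_left _ _).trans hN
  have hcN : 2 / c ≤ N := (le_max_left _ _).trans (hN₀.trans hN₀N)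
  have hcdN : 2 * (d + 1) / c ≤ N := (le_max_right _ _).trans (hN₀.trans hN₀N)
  have hNpos : (0 : ℝ) < N := lt_of_lt_of_le (by positivity) hcN
  rw [div_le_iff₀ hc] at hcN hcdN
  refine (hq.mul_abs_sub_mul_abs_le hP (μ := c * N / 2) (by linarith)
    (fun l => by linarith [hcd N ((le_max_right _ _).trans hN) q hq l]) j k).trans (le_of_eq ?_)
  rw [← hD]
  field_simp

/-- The counts are within a constant of being proportional to `|w|`, and a block of size `B` adds
the order of `B` to each of them. -/
theorem exists_le_of_isOptimalCount (hP : P.PosDef) (hw : ∀ k, w k ≠ 0) :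
    ∃ B₀ : ℕ, ∀ N ≥ B₀, ∀ B ≥ B₀, ∀ q q', IsOptimalCount (residualVariance P w) N q →
      IsOptimalCount (residualVariance P w) (N + B) q' → q ≤ q' := by
  rcases isEmpty_or_nonempty n with hn | hn
  · exact ⟨0, fun _ _ _ _ _ _ _ _ k => isEmptyElim k⟩
  obtain ⟨R, N₀, hR⟩ := exists_mul_abs_sub_le_of_isOptimalCount hP hw
  obtain ⟨k₀, hk₀⟩ := Finite.exists_min fun k => |w k|
  have hv : 0 < |w k₀| := abs_pos.2 (hw k₀)
  have hW : 0 < ∑ l, |w l| := Finset.sum_pos (fun l _ => abs_pos.2 (hw l)) Finset.univ_nonempty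
  obtain ⟨B₁, hB₁⟩ := exists_nat_ge (2 * (Fintype.card n * R) / |w k₀|)
  rw [div_le_iff₀ hv] at hB₁
  refine ⟨max N₀ B₁, fun N hN B hB q q' hq hq' k => ?_⟩
  have hN₀ : N₀ ≤ N := (le_max_left _ _).trans hN
  have upper := mul_sum_sub_sum_mul_le (hR N hN₀ q hq) k
  have lower := mul_sum_sub_sum_mul_le (x := fun k => -(q' k : ℝ)) (a := fun k => |w k|) (R := R)
    (fun j k => by linarith [hR (N + B) (hN₀.trans (Nat.le_add_right _ _)) q' hq' k j]) k
  rw [← Nat.cast_sum, hq.1] at upper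
  rw [Finset.sum_neg_distrib, ← Nat.cast_sum, hq'.1, Nat.cast_add] at lower
  have hBw : (B₁ : ℝ) * |w k₀| ≤ B * |w k| := by
    gcongr ?_ * ?_
    · exact_mod_cast (le_max_right _ _).trans hB
    · exact hk₀ k
  have hle : (q k : ℝ) * ∑ l, |w l| ≤ q' k * ∑ l, |w l| := by linarith
  exact_mod_cast le_of_mul_le_mul_right hle hW

end QuadraticForm

section Separable

theorem withTop_add_le_add_of_convex {g : ℕ → WithTop ℝ} (hanti : Antitone g)
    (hconv : ∀ n, g (n + 1) + g (n + 1) ≤ g n + g (n + 2)) {a b : ℕ} (hab : a < b) :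
    g (a + 1) + g (b - 1) ≤ g a + g b := by
  by_cases htop : g a = ⊤
  · rw [htop, top_add]
    exact le_top
  choose γ hγ using fun n =>
    WithTop.ne_top_iff_exists.1 (ne_top_of_le_ne_top htop (hanti (Nat.le_add_right a n)))
  have monotone_increment : Monotone fun n => γ (n + 1) - γ n := monotone_nat_of_le_succ fun n => by
    have h := hconv (a + n)
    rw [add_assoc, add_assoc, ← hγ, ← hγ, ← hγ] at h
    norm_cast at h
    linarith
  obtain ⟨d, rfl⟩ : ∃ d, b = a + (d + 1) := ⟨b - a - 1, by omega⟩
  have h : γ (0 + 1) - γ 0 ≤ γ (d + 1) - γ d := monotone_increment (Nat.zero_le d)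
  have ha : g a = γ 0 := (hγ 0).symm
  rw [show a + (d + 1) - 1 = a + d by omega, ha, ← hγ, ← hγ, ← hγ]
  norm_cast
  rw [zero_add] at h
  linarith

variable {n : Type*} [DecidableEq n] {q x : n → ℕ} {j k l : n}

/-- The count vector obtained from `q` by replacing one observation of signal `k` by one of
signal `j`. It is meant for `0 < q k` and `j ≠ k`. -/
def transfer (q : n → ℕ) (k j : n) : n → ℕ :=
  q - Pi.single k 1 + Pi.single j 1

theorem transfer_apply_left (h : k ≠ j) : transfer q k j k = q k - 1 := by
  simp [transfer, h]

theorem transfer_apply_right (h : k ≠ j) : transfer q k j j = q j + 1 := by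
  simp [transfer, h.symm]

theorem transfer_apply_of_ne (hk : l ≠ k) (hj : l ≠ j) : transfer q k j l = q l := by
  simp [transfer, hk, hj]

variable [Fintype n]

theorem sum_transfer (hk : 0 < q k) : ∑ l, transfer q k j l = ∑ l, q l := by
  have add_single : q = q - Pi.single k 1 + Pi.single k 1 :=
    (tsub_add_cancel_of_le (update_le_iff.2 ⟨hk, fun _ _ => Nat.zero_le _⟩)).symm
  conv_rhs => rw [add_single]
  simp [transfer, Finset.sum_add_distrib]

theorem sum_tsub_transfer_lt (hk : x k < q k) (hj : q j < x j) :
    ∑ l, (q l - transfer x j k l) < ∑ l, (q l - x l) := by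
  have hjk : j ≠ k := by
    rintro rfl
    exact hk.not_gt hj
  refine Finset.sum_lt_sum (fun l _ => ?_) ⟨k, Finset.mem_univ k, ?_⟩
  · rcases eq_or_ne l j with rfl | hlj
    · rw [transfer_apply_left hjk]
      omega
    rcases eq_or_ne l k with rfl | hlk
    · rw [transfer_apply_right hjk]
      omega
    · rw [transfer_apply_of_ne hlj hlk]
  · rw [transfer_apply_right hjk]
    omega

section ConvexSum

variable {g : n → ℕ → WithTop ℝ}

theorem sum_transfer_add_sum_transfer_le (hanti : ∀ k, Antitone (g k))
    (hconv : ∀ k m, g k (m + 1) + g k (m + 1) ≤ g k m + g k (m + 2))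
    (hk : x k < q k) (hj : q j < x j) :
    ∑ l, g l (transfer q k j l) + ∑ l, g l (transfer x j k l) ≤
      ∑ l, g l (q l) + ∑ l, g l (x l) := by
  have hkj : k ≠ j := by
    rintro rfl
    exact hk.not_gt hj
  rw [← Finset.sum_add_distrib, ← Finset.sum_add_distrib]
  refine Finset.sum_le_sum fun l _ => ?_
  rcases eq_or_ne l k with rfl | hlk
  · rw [transfer_apply_left hkj, transfer_apply_right hkj.symm, add_comm, add_comm (g l (q l))]
    exact withTop_add_le_add_of_convex (hanti l) (hconv l) hk
  rcases eq_or_ne l j with rfl | hlj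
  · rw [transfer_apply_right hkj, transfer_apply_left hkj.symm]
    exact withTop_add_le_add_of_convex (hanti l) (hconv l) hj
  · rw [transfer_apply_of_ne hlk hlj, transfer_apply_of_ne hlj hlk]

omit [DecidableEq n] in
/-- Among the optimal vectors with the larger sum, one at minimal distance above `q` works:
otherwise an exchange of two observations would bring it closer to `q`. -/
theorem exists_isOptimalCount_ge_of_convex [Nonempty n] (hanti : ∀ k, Antitone (g k))
    (hconv : ∀ k m, g k (m + 1) + g k (m + 1) ≤ g k m + g k (m + 2)) {N B : ℕ}
    (hq : IsOptimalCount (fun q => ∑ k, g k (q k)) N q) (hfin : ∑ k, g k (q k) ≠ ⊤) :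
    ∃ q', IsOptimalCount (fun q => ∑ k, g k (q k)) (N + B) q' ∧ q ≤ q' := by
  classical
  obtain ⟨x, hx, hmin⟩ := (measure fun x : n → ℕ => ∑ l, (q l - x l)).wf.has_min
    {x | IsOptimalCount (fun q => ∑ k, g k (q k)) (N + B) x} (exists_isOptimalCount _ _)
  refine ⟨x, hx, ?_⟩
  by_contra hle
  obtain ⟨k, hk⟩ : ∃ k, x k < q k := by simpa [Pi.le_def] using hle
  obtain ⟨j, hj⟩ : ∃ j, q j < x j := by
    by_contra! hxq
    have := Finset.sum_lt_sum (fun l _ => hxq l) ⟨k, Finset.mem_univ k, hk⟩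
    rw [hx.1, hq.1] at this
    omega
  have hqt := hq.2 _ ((sum_transfer (j := j) (Nat.zero_lt_of_lt hk)).trans hq.1)
  have hxt : ∑ l, g l (transfer x j k l) ≤ ∑ l, g l (x l) :=
    (WithTop.add_le_add_iff_left hfin).1
      ((add_le_add_left hqt _).trans (sum_transfer_add_sum_transfer_le hanti hconv hk hj))
  exact hmin (transfer x j k)
    ⟨(sum_transfer (Nat.zero_lt_of_lt hj)).trans hx.1, fun y hy => hxt.trans (hx.2 y hy)⟩
    (sum_tsub_transfer_lt hk hj)

end ConvexSum

section OrderEquivalent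

variable {f : (n → ℕ) → ℝ} {g : n → ℕ → WithTop ℝ} {k₀ : n}

theorem apply_single_ne_top
    (hfg : ∀ q q', f q ≤ f q' ↔ ∑ k, g k (q k) ≤ ∑ k, g k (q' k))
    (hk₀ : f (Pi.single k₀ 1) < f 0) (l : n) :
    g l ((Pi.single k₀ 1 : n → ℕ) l) ≠ ⊤ := by
  have : ∑ l, g l ((Pi.single k₀ 1 : n → ℕ) l) < ∑ l, g l ((0 : n → ℕ) l) := by
    rwa [← not_le, ← hfg, not_le]
  exact (WithTop.sum_lt_top.1 (this.trans_le le_top) l (Finset.mem_univ l)).ne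

theorem antitone_of_apply_add_single_le
    (hfg : ∀ q q', f q ≤ f q' ↔ ∑ k, g k (q k) ≤ ∑ k, g k (q' k))
    (hk₀ : f (Pi.single k₀ 1) < f 0) (hf : ∀ q k, f (q + Pi.single k 1) ≤ f q) (k : n) :
    Antitone (g k) := by
  refine antitone_nat_of_succ_le fun m => ?_
  set x : n → ℕ := Function.update (Pi.single k₀ 1) k m
  have hx {l : n} (hl : l ∈ Finset.univ.erase k) : x l = (Pi.single k₀ 1 : n → ℕ) l :=
    Function.update_of_ne (Finset.ne_of_mem_erase hl) _ _
  have rest_ne_top : ∑ l ∈ Finset.univ.erase k, g l (x l) ≠ ⊤ :=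
    (WithTop.sum_lt_top.2 fun l hl => by
      rw [hx hl]
      exact (apply_single_ne_top hfg hk₀ l).lt_top).ne
  have rest_eq : ∑ l ∈ Finset.univ.erase k, g l ((x + Pi.single k 1 : n → ℕ) l) =
      ∑ l ∈ Finset.univ.erase k, g l (x l) :=
    Finset.sum_congr rfl fun l hl => by simp [Finset.ne_of_mem_erase hl]
  have h := (hfg _ _).1 (hf x k)
  rw [← Finset.add_sum_erase _ _ (Finset.mem_univ k),
    ← Finset.add_sum_erase _ (fun l => g l (x l)) (Finset.mem_univ k), rest_eq] at h
  simpa [x] using (WithTop.add_le_add_iff_right rest_ne_top).1 h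

theorem exists_isOptimalCount_ge_of_separable
    (hfg : ∀ q q', f q ≤ f q' ↔ ∑ k, g k (q k) ≤ ∑ k, g k (q' k))
    (hk₀ : f (Pi.single k₀ 1) < f 0)
    (hconv : ∀ k m, g k (m + 1) + g k (m + 1) ≤ g k m + g k (m + 2))
    (hf : ∀ q k, f (q + Pi.single k 1) ≤ f q) {N B : ℕ} (hN : 0 < N)
    (hq : IsOptimalCount f N q) : ∃ q', IsOptimalCount f (N + B) q' ∧ q ≤ q' := by
  have : Nonempty n := ⟨k₀⟩
  have hanti := antitone_of_apply_add_single_le hfg hk₀ hf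
  have isOptimalCount_iff (M : ℕ) (x : n → ℕ) :
      IsOptimalCount f M x ↔ IsOptimalCount (fun q => ∑ k, g k (q k)) M x := by
    simp only [IsOptimalCount, hfg]
  have single_le : (Pi.single k₀ 1 : n → ℕ) ≤ Pi.single k₀ N := Pi.single_mono k₀ hN
  have hfin : ∑ k, g k (q k) ≠ ⊤ :=
    ne_top_of_le_ne_top
      (WithTop.sum_lt_top.2 fun l _ =>
        ((hanti l (single_le l)).trans_lt (apply_single_ne_top hfg hk₀ l).lt_top)).ne
      ((hfg _ _).1 (hq.2 (Pi.single k₀ N) (by simp)))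
  simp only [isOptimalCount_iff] at hq ⊢
  exact exists_isOptimalCount_ge_of_convex hanti hconv hq hfin

end OrderEquivalent

end Separable

namespace InfoGame

variable {K B : ℕ}

namespace Acquisition

theorem sum_count (c : Fin B → Fin K) : ∑ k, count c k = B := by
  have := Finset.card_eq_sum_card_fiberwise (f := c) (s := Finset.univ) (t := Finset.univ)
    (fun _ _ => Finset.mem_univ _)
  simpa [count] using this.symm

theorem exists_count_eq {v : Fin K → ℕ} (hv : ∑ k, v k = B) :
    ∃ c : Fin B → Fin K, count c = v := by
  let e : Fin B ≃ Σ k, Fin (v k) := Fintype.equivOfCardEq (by simp [hv])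
  refine ⟨fun b => (e b).1, funext fun k => ?_⟩
  rw [count, ← Fintype.card_subtype, Fintype.card_congr
    (e.subtypeEquiv (q := fun x => x.1 = k) fun b => Iff.rfl),
    Fintype.card_congr (Equiv.sigmaSubtype k), Fintype.card_fin]

theorem division_succ (S : Acquisition K B) {t : ℕ} (r : unitInterval) (h : History B (t + 1)) :
    S.division r h = S.division r (fun j : Fin t => h j.castSucc) +
      count (S.choose t r fun j => h j.castSucc) := by
  ext k
  rw [division, Fin.sum_univ_castSucc]
  rfl

theorem sum_division (S : Acquisition K B) {t : ℕ} (r : unitInterval) (h : History B t) :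
    ∑ k, S.division r h k = t * B := by
  simp only [division]
  rw [Finset.sum_comm]
  simp [sum_count]

end Acquisition

variable [NeZero K] {E : Environment K}

namespace Environment.Regular

theorem posDef_transformed (hE : E.Regular) :
    ((E.coeff⁻¹)ᵀ * E.cov⁻¹ * E.coeff⁻¹).PosDef := by
  have injective : Function.Injective E.coeff⁻¹.mulVec :=
    Matrix.mulVec_injective_of_isUnit
      (Matrix.isUnit_nonsing_inv_iff.2 ((Matrix.isUnit_iff_isUnit_det _).2 hE.invertible))
  have h := hE.posDef.inv.conjTranspose_mul_mul_same injective
  rwa [Matrix.conjTranspose_eq_transpose_of_trivial] at h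

theorem posteriorVariance_eq_residualVariance (hE : E.Regular) (q : Fin K → ℕ) :
    E.posteriorVariance q =
      residualVariance ((E.coeff⁻¹)ᵀ * E.cov⁻¹ * E.coeff⁻¹) (E.coeff⁻¹ 0) q := by
  set P := (E.coeff⁻¹)ᵀ * E.cov⁻¹ * E.coeff⁻¹ with hP
  set D := Matrix.diagonal fun k => (q k : ℝ)
  have inv_mul : E.coeff⁻¹ * E.coeff = 1 := Matrix.nonsing_inv_mul _ hE.invertible
  have transpose_mul : E.coeffᵀ * (E.coeff⁻¹)ᵀ = 1 := by
    rw [← Matrix.transpose_mul, inv_mul, Matrix.transpose_one]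
  have precision_eq : E.cov⁻¹ + E.coeffᵀ * D * E.coeff = E.coeffᵀ * (P + D) * E.coeff := by
    rw [Matrix.mul_add, Matrix.add_mul, hP]
    congr 1
    calc E.cov⁻¹ = (E.coeffᵀ * (E.coeff⁻¹)ᵀ) * E.cov⁻¹ * (E.coeff⁻¹ * E.coeff) := by
          rw [inv_mul, transpose_mul, Matrix.one_mul, Matrix.mul_one]
      _ = _ := by simp only [Matrix.mul_assoc]
  rw [posteriorVariance, precision_eq, Matrix.mul_inv_rev, Matrix.mul_inv_rev,
    ← Matrix.transpose_nonsing_inv, residualVariance, ← Matrix.mul_assoc, Matrix.mul_apply,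
    residualCov, Matrix.dotProduct_mulVec]
  rfl

theorem exists_isOptimalCount_ge (hE : E.Regular) :
    ∃ B₀ : ℕ, ∀ B : ℕ, 0 < B → (B₀ ≤ B ∨ E.Separable) → ∀ (t : ℕ) (q : Fin K → ℕ),
      IsOptimalCount E.posteriorVariance (t * B) q →
      ∃ q', IsOptimalCount E.posteriorVariance ((t + 1) * B) q' ∧ q ≤ q' := by
  have hP := hE.posDef_transformed
  have hf := funext hE.posteriorVariance_eq_residualVariance
  obtain ⟨B₀, hB₀⟩ := exists_le_of_isOptimalCount hP hE.nonredundant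
  refine ⟨B₀, fun B hB hcase t q hq => ?_⟩
  obtain ⟨q', hq'⟩ := exists_isOptimalCount E.posteriorVariance ((t + 1) * B)
  rcases Nat.eq_zero_or_pos t with rfl | ht
  · have hq0 := hq.1
    rw [zero_mul, Finset.sum_eq_zero_iff] at hq0
    exact ⟨q', hq', fun k => (hq0 k (Finset.mem_univ k)).trans_le (Nat.zero_le _)⟩
  rw [Nat.add_mul, one_mul] at hq' ⊢
  have htB : B ≤ t * B := Nat.le_mul_of_pos_left B ht
  rcases hcase with hle | ⟨g, F, hconv, hmono, hFg⟩
  · refine ⟨q', hq', hB₀ (t * B) (hle.trans htB) B hle q q' ?_ ?_⟩ <;> rwa [← hf]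
  · have hw : E.coeff⁻¹ 0 ≠ 0 := fun h => hE.nonredundant 0 (congrFun h 0)
    obtain ⟨k₀, hk₀⟩ := exists_residualVariance_add_single_lt hP hw 0
    rw [zero_add, ← hf] at hk₀
    refine exists_isOptimalCount_ge_of_separable (fun q q' => ?_) hk₀ hconv
      (hf ▸ residualVariance_add_single_le hP _) (hB.trans_le htB) hq
    rw [hFg, hFg]
    exact hmono.le_iff_le ⟨q, rfl⟩ ⟨q', rfl⟩

end Environment.Regular

theorem Acquisition.IsMyopic.isOptimalCount_division
    (h : ∀ (t : ℕ) (q : Fin K → ℕ), IsOptimalCount E.posteriorVariance (t * B) q →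
      ∃ q', IsOptimalCount E.posteriorVariance ((t + 1) * B) q' ∧ q ≤ q')
    {S : Acquisition K B} (hS : S.IsMyopic E) (t : ℕ) (r : unitInterval) (x : History B t) :
    IsOptimalCount E.posteriorVariance (t * B) (S.division r x) := by
  induction t with
  | zero =>
    have eq_zero {q : Fin K → ℕ} (hq : ∑ k, q k = 0 * B) : q = 0 := by
      rw [zero_mul] at hq
      exact funext fun k => Finset.sum_eq_zero_iff.1 hq k (Finset.mem_univ k)
    refine ⟨S.sum_division r x, fun q' hq' => ?_⟩
    rw [eq_zero hq', eq_zero (S.sum_division r x)]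
  | succ t ih =>
    set x' : History B t := fun j => x j.castSucc
    obtain ⟨q', hq', hle⟩ := h t _ (ih x')
    have sum_sub : ∑ k, (q' k - S.division r x' k) = B := by
      rw [Finset.sum_tsub_distrib _ fun k _ => hle k, hq'.1, S.sum_division, Nat.add_mul, one_mul,
        Nat.add_sub_cancel_left]
    obtain ⟨c, hc⟩ := Acquisition.exists_count_eq (v := q' - S.division r x') sum_sub
    refine ⟨S.sum_division r x, fun y hy => ?_⟩
    rw [S.division_succ]
    refine (hS t r x' c).trans ?_
    rw [hc, add_tsub_cancel_of_le hle]
    exact hq'.2 y hy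

end InfoGame

section GaussianPosterior

variable {X X' Y Z R I : Type*} [MeasurableSpace X] [MeasurableSpace X'] [MeasurableSpace Y]
  [MeasurableSpace Z] [MeasurableSpace R]

/-- Given the data `D = y`, the state `θ` is Gaussian with mean `μ y` and variance `v y`. This is
encoded without conditional distributions: `(θ, D)` has the law of `(μ D + √(v D) z, D)` with a
standard normal `z` that is independent of `D`. -/
structure HasGaussianPosterior (P : Measure X) (θ : X → ℝ) (D : X → Y) (μ v : Y → ℝ) :
    Prop where
  measurable_state : Measurable θ
  measurable_data : Measurable D
  measurable_mean : Measurable μ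
  measurable_variance : Measurable v
  map_eq : P.map (fun x => (θ x, D x)) =
    (P.prod (gaussianReal 0 1)).map fun p => (μ (D p.1) + √(v (D p.1)) * p.2, D p.1)

theorem gaussianReal_map_const_add_sqrt_mul (c : ℝ) {v : ℝ} (hv : 0 ≤ v) :
    (gaussianReal 0 1).map (fun z => c + √v * z) = gaussianReal c v.toNNReal := by
  change (gaussianReal 0 1).map ((fun x => c + x) ∘ fun z => √v * z) = _
  rw [← Measure.map_map (by fun_prop) (by fun_prop), gaussianReal_map_const_mul,
    gaussianReal_map_const_add]
  congr 1
  · simp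
  · ext
    simp [Real.sq_sqrt hv, hv]

theorem hasGaussianPosterior_of_map_prodMk {P : Measure X} [SFinite P] {ξ θ : X → ℝ} {D : X → Y}
    {h : Y → ℝ} {c v : ℝ} (hv : 0 ≤ v) (hξ : Measurable ξ) (hD : Measurable D) (hh : Measurable h)
    (hlaw : P.map (fun x => (ξ x, D x)) = (gaussianReal c v.toNNReal).prod (P.map D))
    (hθ : ∀ x, θ x = ξ x + h (D x)) :
    HasGaussianPosterior P θ D (fun y => c + h y) fun _ => v where
  measurable_state := by
    rw [funext hθ]
    fun_prop
  measurable_data := hD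
  measurable_mean := by fun_prop
  measurable_variance := measurable_const
  map_eq := by
    let shift : ℝ × Y → ℝ × Y := fun y => (y.1 + h y.2, y.2)
    have hshift : Measurable shift := by fun_prop
    calc P.map (fun x => (θ x, D x))
        = (P.map fun x => (ξ x, D x)).map shift := by
          rw [Measure.map_map hshift (by fun_prop), funext hθ]
          rfl
      _ = (((P.prod (gaussianReal 0 1)).map (Prod.map D fun z => c + √v * z)).map
            Prod.swap).map shift := by
          rw [hlaw, ← gaussianReal_map_const_add_sqrt_mul c hv,
            ← Measure.map_prod_map _ _ hD (by fun_prop), Measure.prod_swap]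
      _ = _ := by
          rw [Measure.map_map (by fun_prop) (by fun_prop), Measure.map_map (by fun_prop)
            (by fun_prop)]
          congr 1
          funext p
          simp only [shift, Function.comp_apply, Prod.map, Prod.swap, Prod.mk.injEq, and_true]
          ring

namespace HasGaussianPosterior

variable {P : Measure X} {θ : X → ℝ} {D : X → Y} {μ v : Y → ℝ}

theorem comp_measurePreserving (h : HasGaussianPosterior P θ D μ v)
    {Q : Measure X'} [SFinite Q] {g : X' → X} (hg : MeasurePreserving g Q P) :
    HasGaussianPosterior Q (θ ∘ g) (D ∘ g) μ v where
  measurable_state := h.measurable_state.comp hg.measurable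
  measurable_data := h.measurable_data.comp hg.measurable
  measurable_mean := h.measurable_mean
  measurable_variance := h.measurable_variance
  map_eq := by
    obtain ⟨hθ, hD, hμ, hv, hmap⟩ := h
    have hgm := hg.measurable
    rw [← hg.map_eq, Measure.map_map (by fun_prop) hgm,
      hg.map_eq, ← (hg.prod (MeasurePreserving.id (gaussianReal 0 1))).map_eq,
      Measure.map_map (by fun_prop) (by fun_prop)] at hmap
    exact hmap

theorem map_data {e : Y → Z} {μ v : Z → ℝ} (h : HasGaussianPosterior P θ D (μ ∘ e) (v ∘ e))
    (he : Measurable e) (hμ : Measurable μ) (hv : Measurable v) :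
    HasGaussianPosterior P θ (e ∘ D) μ v where
  measurable_state := h.measurable_state
  measurable_data := he.comp h.measurable_data
  measurable_mean := hμ
  measurable_variance := hv
  map_eq := by
    obtain ⟨hθ, hD, -, -, hmap⟩ := h
    have := congrArg (Measure.map (Prod.map id e)) hmap
    rw [Measure.map_map (by fun_prop) (by fun_prop),
      Measure.map_map (by fun_prop) (by fun_prop)] at this
    exact this

theorem prod_left [SFinite P] (h : HasGaussianPosterior P θ D μ v) (ρ : Measure R) [SFinite ρ] :
    HasGaussianPosterior (ρ.prod P) (fun p => θ p.2) (fun p => (p.1, D p.2))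
      (fun y => μ y.2) fun y => v y.2 where
  measurable_state := h.measurable_state.comp measurable_snd
  measurable_data := measurable_fst.prodMk (h.measurable_data.comp measurable_snd)
  measurable_mean := h.measurable_mean.comp measurable_snd
  measurable_variance := h.measurable_variance.comp measurable_snd
  map_eq := by
    obtain ⟨hθ, hD, hμ, hv, hmap⟩ := h
    let rotate : R × ℝ × Y → ℝ × R × Y := fun p => (p.2.1, p.1, p.2.2)
    have hrotate : Measurable rotate := by fun_prop
    calc (ρ.prod P).map (fun p => (θ p.2, p.1, D p.2))
        = (ρ.prod (P.map fun x => (θ x, D x))).map rotate := by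
          rw [← Measure.map_id (μ := ρ), Measure.map_prod_map _ _ measurable_id (by fun_prop),
            Measure.map_map (by fun_prop) (by fun_prop), Measure.map_id]
          rfl
      _ = (ρ.prod (P.prod (gaussianReal 0 1))).map
            fun p => (μ (D p.2.1) + √(v (D p.2.1)) * p.2.2, p.1, D p.2.1) := by
          rw [hmap, ← Measure.map_id (μ := ρ), Measure.map_prod_map _ _ measurable_id
            (by fun_prop), Measure.map_map (by fun_prop) (by fun_prop), Measure.map_id]
          rfl
      _ = _ := by
          rw [← Measure.prodAssoc_prod, Measure.map_map (by fun_prop) (by fun_prop)]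
          rfl

end HasGaussianPosterior

theorem restrict_map_congr {P : Measure X} {f g : X → Y} (hf : Measurable f) (hg : Measurable g)
    {s : Set Y} (hs : MeasurableSet s) (h : ∀ x, f x ∈ s ∨ g x ∈ s → f x = g x) :
    (P.map f).restrict s = (P.map g).restrict s := by
  ext t ht
  rw [Measure.restrict_apply ht, Measure.restrict_apply ht, Measure.map_apply hf (ht.inter hs),
    Measure.map_apply hg (ht.inter hs)]
  congr 1
  ext x
  constructor
  · intro hx
    rwa [Set.mem_preimage, ← h x (Or.inl hx.2)]
  · intro hx
    rwa [Set.mem_preimage, h x (Or.inr hx.2)]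

theorem measurable_apply_of_countable [Countable I] [MeasurableSpace I]
    [MeasurableSingletonClass I] {f : I → Y → Z} (hf : ∀ κ, Measurable (f κ)) {c : Y → I}
    (hc : Measurable c) : Measurable fun y => f (c y) y :=
  (measurable_from_prod_countable_right (f := fun p : I × Y => f p.1 p.2) hf).comp
    (hc.prodMk measurable_id)

/-- The data may be collected adaptively: on each of countably many cells `c = κ` of the data, it is
enough to know the posterior for the data `D' κ` collected by a fixed plan `κ`. -/
theorem hasGaussianPosterior_of_forall_fixed [Countable I] [MeasurableSpace I]
    [MeasurableSingletonClass I] {P : Measure X} {θ : X → ℝ} {D : X → Y} {D' : I → X → Y}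
    {μ v : I → Y → ℝ} (h : ∀ κ, HasGaussianPosterior P θ (D' κ) (μ κ) (v κ))
    (hθ : Measurable θ) (hD : Measurable D) {c : Y → I} (hc : Measurable c)
    (hDD' : ∀ κ x, c (D x) = κ ∨ c (D' κ x) = κ → D x = D' κ x) :
    HasGaussianPosterior P θ D (fun y => μ (c y) y) fun y => v (c y) y where
  measurable_state := hθ
  measurable_data := hD
  measurable_mean := measurable_apply_of_countable (fun κ => (h κ).measurable_mean) hc
  measurable_variance := measurable_apply_of_countable (fun κ => (h κ).measurable_variance) hc
  map_eq := by
    have hμ := measurable_apply_of_countable (fun κ => (h κ).measurable_mean) hc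
    have hv := measurable_apply_of_countable (fun κ => (h κ).measurable_variance) hc
    refine Measure.ext_of_iUnion_eq_univ (ι := I) (s := fun κ => {y : ℝ × Y | c y.2 = κ})
      (by ext; simp) fun κ => ?_
    have hs : MeasurableSet {y : ℝ × Y | c y.2 = κ} :=
      (hc.comp measurable_snd) (measurableSet_singleton κ)
    have hD' := (h κ).measurable_data
    have hμ' := (h κ).measurable_mean
    have hv' := (h κ).measurable_variance
    calc (P.map fun x => (θ x, D x)).restrict {y | c y.2 = κ}
        = (P.map fun x => (θ x, D' κ x)).restrict {y | c y.2 = κ} :=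
          restrict_map_congr (by fun_prop) (by fun_prop) hs fun x hx => by
            rw [hDD' κ x hx]
      _ = _ := by
          rw [(h κ).map_eq]
          have hDp : Measurable fun p : X × ℝ => D p.1 := by fun_prop
          have hresample : Measurable fun p : X × ℝ =>
              (μ (c (D p.1)) (D p.1) + √(v (c (D p.1)) (D p.1)) * p.2, D p.1) :=
            ((hμ.comp hDp).add ((hv.comp hDp).sqrt.mul measurable_snd)).prodMk hDp
          refine restrict_map_congr (by fun_prop) hresample hs fun x hx => ?_
          have hD_eq : D x.1 = D' κ x.1 := hDD' κ x.1 hx.symm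
          have hc_eq : c (D' κ x.1) = κ := by
            rcases hx with hx | hx
            · exact hx
            · exact hD_eq ▸ hx
          rw [hD_eq, hc_eq]

end GaussianPosterior

section GaussianRegression

open WithLp

theorem covariance_add_prod {X Y : Type*} [MeasurableSpace X] [MeasurableSpace Y] {P : Measure X}
    [IsProbabilityMeasure P] {Q : Measure Y} [IsProbabilityMeasure Q] {f f' : X → ℝ} {g g' : Y → ℝ}
    (hf : MemLp f 2 P) (hf' : MemLp f' 2 P) (hg : MemLp g 2 Q) (hg' : MemLp g' 2 Q) :
    cov[fun x : X × Y => f x.1 + g x.2, fun x => f' x.1 + g' x.2; P.prod Q] =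
      cov[f, f'; P] + cov[g, g'; Q] := by
  have hf₁ : MemLp (fun x : X × Y => f x.1) 2 (P.prod Q) := hf.comp_fst Q
  have hf'₁ : MemLp (fun x : X × Y => f' x.1) 2 (P.prod Q) := hf'.comp_fst Q
  have hg₂ : MemLp (fun x : X × Y => g x.2) 2 (P.prod Q) := hg.comp_snd P
  have hg'₂ : MemLp (fun x : X × Y => g' x.2) 2 (P.prod Q) := hg'.comp_snd P
  have cov_fst : cov[fun x : X × Y => f x.1, fun x => f' x.1; P.prod Q] = cov[f, f'; P] := by
    have hfst : (P.prod Q).map Prod.fst = P := by simp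
    rw [← covariance_map_fun (hfst.symm ▸ hf.aestronglyMeasurable)
      (hfst.symm ▸ hf'.aestronglyMeasurable) measurable_fst.aemeasurable, hfst]
  have cov_snd : cov[fun x : X × Y => g x.2, fun x => g' x.2; P.prod Q] = cov[g, g'; Q] := by
    have hsnd : (P.prod Q).map Prod.snd = Q := by simp
    rw [← covariance_map_fun (hsnd.symm ▸ hg.aestronglyMeasurable)
      (hsnd.symm ▸ hg'.aestronglyMeasurable) measurable_snd.aemeasurable, hsnd]
  have cov_snd_fst : cov[fun x : X × Y => g x.2, fun x => f' x.1; P.prod Q] = 0 := by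
    rw [covariance_comm]
    exact covariance_fst_snd_prod hf' hg
  change cov[(fun x : X × Y => f x.1) + fun x => g x.2, (fun x => f' x.1) + fun x => g' x.2;
    P.prod Q] = _
  rw [covariance_add_left hf₁ hg₂ (hf'₁.add hg'₂), covariance_add_right hf₁ hf'₁ hg'₂,
    covariance_add_right hg₂ hf'₁ hg'₂, cov_fst, cov_snd, cov_snd_fst,
    covariance_fst_snd_prod hf hg', add_zero, zero_add]

variable {n J : Type*} [Fintype n] [Fintype J]

theorem memLp_innerSL_of_isGaussian {E : Type*} [NormedAddCommGroup E] [InnerProductSpace ℝ E]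
    [MeasurableSpace E] [BorelSpace E] (P : Measure E) [IsGaussian P] (u : E) :
    MemLp (innerSL ℝ u) 2 P :=
  (IsGaussian.hasGaussianLaw_id.map (innerSL ℝ u)).memLp_two

theorem covariance_innerSL_multivariateGaussian [DecidableEq n] {m : EuclideanSpace ℝ n}
    {V : Matrix n n ℝ} (hV : V.PosSemidef) (u u' : n → ℝ) :
    cov[innerSL ℝ (toLp 2 u), innerSL ℝ (toLp 2 u'); multivariateGaussian m V] =
      u ⬝ᵥ V *ᵥ u' := by
  have h := covarianceBilin_multivariateGaussian (μ := m) hV (toLp 2 u) (toLp 2 u')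
  rwa [covarianceBilin_apply_eq_cov IsGaussian.memLp_two_id] at h

/-- The linear functional `(θ, e) ↦ ⟨u, θ⟩ + ⟨a, e⟩` of a state vector and a noise vector. -/
noncomputable def pairFunctional (u : n → ℝ) (a : J → ℝ) :
    EuclideanSpace ℝ n × EuclideanSpace ℝ J →L[ℝ] ℝ :=
  (innerSL ℝ (toLp 2 u)).comp (ContinuousLinearMap.fst ℝ _ _) +
    (innerSL ℝ (toLp 2 a)).comp (ContinuousLinearMap.snd ℝ _ _)

theorem pairFunctional_apply (u : n → ℝ) (a : J → ℝ)
    (x : EuclideanSpace ℝ n × EuclideanSpace ℝ J) :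
    pairFunctional u a x = ∑ l, u l * x.1 l + ∑ j, a j * x.2 j := by
  simp [pairFunctional, PiLp.inner_apply, mul_comm]

variable [DecidableEq n] {m : EuclideanSpace ℝ n} {V : Matrix n n ℝ}

theorem covariance_pairFunctional (hV : V.PosSemidef) (u u' : n → ℝ) (a a' : J → ℝ) :
    cov[pairFunctional u a, pairFunctional u' a';
      (multivariateGaussian m V).prod (stdGaussian (EuclideanSpace ℝ J))] =
      u ⬝ᵥ V *ᵥ u' + a ⬝ᵥ a' := by
  classical
  calc _ = cov[innerSL ℝ (toLp 2 u), innerSL ℝ (toLp 2 u'); multivariateGaussian m V] +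
          cov[innerSL ℝ (toLp 2 a), innerSL ℝ (toLp 2 a'); stdGaussian (EuclideanSpace ℝ J)] :=
        covariance_add_prod (memLp_innerSL_of_isGaussian _ _) (memLp_innerSL_of_isGaussian _ _)
          (memLp_innerSL_of_isGaussian _ _) (memLp_innerSL_of_isGaussian _ _)
    _ = _ := by
        rw [covariance_innerSL_multivariateGaussian hV, ← multivariateGaussian_zero_one,
          covariance_innerSL_multivariateGaussian Matrix.PosSemidef.one, Matrix.one_mulVec]

theorem integral_pairFunctional (m : EuclideanSpace ℝ n) (V : Matrix n n ℝ) (u : n → ℝ)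
    (a : J → ℝ) :
    ∫ x, pairFunctional u a x
      ∂((multivariateGaussian m V).prod (stdGaussian (EuclideanSpace ℝ J))) = ∑ l, u l * m l := by
  set ν := (multivariateGaussian m V).prod (stdGaussian (EuclideanSpace ℝ J))
  have hi : Integrable (fun x => x) ν := IsGaussian.integrable_id
  have mean_eq : ∫ x, x ∂ν = (m, 0) := by
    refine Prod.ext ?_ ?_
    · rw [fst_integral hi]
      simpa [ν] using integral_fun_fst (μ := multivariateGaussian m V)
        (ν := stdGaussian (EuclideanSpace ℝ J)) (f := fun x => x)
    · rw [snd_integral hi]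
      simpa [ν, integral_id_stdGaussian] using integral_fun_snd (μ := multivariateGaussian m V)
        (ν := stdGaussian (EuclideanSpace ℝ J)) (f := fun x => x)
  rw [ContinuousLinearMap.integral_comp_comm _ hi, mean_eq, pairFunctional_apply]
  simp

theorem map_pairFunctional_prodMk (hV : V.PosSemidef) (u : n → ℝ) (a : J → ℝ) (v : J → n → ℝ)
    (b : J → J → ℝ) (h : ∀ j, u ⬝ᵥ V *ᵥ v j + a ⬝ᵥ b j = 0) :
    ((multivariateGaussian m V).prod (stdGaussian (EuclideanSpace ℝ J))).map
      (fun x => (pairFunctional u a x, fun j => pairFunctional (v j) (b j) x)) =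
    (gaussianReal (∑ l, u l * m l) (u ⬝ᵥ V *ᵥ u + a ⬝ᵥ a).toNNReal).prod
      (((multivariateGaussian m V).prod (stdGaussian (EuclideanSpace ℝ J))).map
        fun x j => pairFunctional (v j) (b j) x) := by
  set ν := (multivariateGaussian m V).prod (stdGaussian (EuclideanSpace ℝ J))
  have joint_law : HasGaussianLaw (fun x => (fun _ : Unit => pairFunctional u a x,
      fun j => pairFunctional (v j) (b j) x)) ν :=
    IsGaussian.hasGaussianLaw_id.map ((ContinuousLinearMap.pi fun _ : Unit =>
      pairFunctional u a).prod (ContinuousLinearMap.pi fun j => pairFunctional (v j) (b j)))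
  have indep : IndepFun (fun x => pairFunctional u a x)
      (fun x j => pairFunctional (v j) (b j) x) ν :=
    (joint_law.indepFun_of_covariance_eval (X := fun _ x => pairFunctional u a x)
      (Y := fun j x => pairFunctional (v j) (b j) x) fun _ j => by
        rw [covariance_pairFunctional hV, h]).comp
      (φ := fun y : Unit → ℝ => y ()) (ψ := id) (by fun_prop) measurable_id
  have law : HasGaussianLaw (pairFunctional u a) ν := IsGaussian.hasGaussianLaw_id.map _
  rw [(indepFun_iff_map_prod_eq_prod_map_map (by fun_prop) (by fun_prop)).1 indep,
    law.map_eq_gaussianReal, integral_pairFunctional, ← covariance_self (by fun_prop),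
    covariance_pairFunctional hV]

end GaussianRegression

namespace InfoGame

open Matrix WithLp

variable {K : ℕ} {J : Type*}

namespace Environment

/-- The observations of the signals `κ j` with the noise terms `e j`. -/
def observe (E : Environment K) (κ : J → Fin K) (θ : EuclideanSpace ℝ (Fin K)) (e : J → ℝ)
    (j : J) : ℝ :=
  (∑ l, E.coeff (κ j) l * θ l) + e j

/-- The precision matrix of the state vector after `q k` observations of each signal `k`. -/
noncomputable def posteriorPrecision (E : Environment K) (q : Fin K → ℕ) :
    Matrix (Fin K) (Fin K) ℝ :=
  E.cov⁻¹ + E.coeffᵀ * diagonal (fun k => (q k : ℝ)) * E.coeff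

theorem posDef_posteriorPrecision {E : Environment K} (hE : E.cov.PosDef) (q : Fin K → ℕ) :
    (E.posteriorPrecision q).PosDef := by
  have posSemidef_signals := (PosSemidef.diagonal (n := Fin K) (d := fun k => (q k : ℝ))
    fun k => Nat.cast_nonneg (q k)).conjTranspose_mul_mul_same E.coeff
  rw [conjTranspose_eq_transpose_of_trivial] at posSemidef_signals
  exact hE.inv.add_posSemidef posSemidef_signals

variable [NeZero K]

/-- The column of the posterior covariance matrix that belongs to the state of interest: the
covariances of the state of interest with all entries of the state vector. -/
noncomputable def posteriorCov (E : Environment K) (q : Fin K → ℕ) : Fin K → ℝ :=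
  (E.posteriorPrecision q)⁻¹ *ᵥ Pi.single 0 1

theorem posteriorCov_zero (E : Environment K) (q : Fin K → ℕ) :
    E.posteriorCov q 0 = E.posteriorVariance q := by
  rw [posteriorCov, mulVec_single_one]
  rfl

theorem posteriorCov_dotProduct_posteriorPrecision_mulVec {E : Environment K} (hE : E.cov.PosDef)
    (q : Fin K → ℕ) (y : Fin K → ℝ) :
    E.posteriorCov q ⬝ᵥ E.posteriorPrecision q *ᵥ y = y 0 := by
  have hA := posDef_posteriorPrecision hE q
  rw [dotProduct_mulVec_comm_of_posDef hA, posteriorCov, mulVec_mulVec,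
    mul_nonsing_inv _ ((isUnit_iff_isUnit_det _).1 hA.isUnit), one_mulVec, single_one_dotProduct]

theorem Regular.posteriorVariance_nonneg {E : Environment K} (hE : E.Regular) (q : Fin K → ℕ) :
    0 ≤ E.posteriorVariance q := by
  rw [hE.posteriorVariance_eq_residualVariance]
  exact residualVariance_nonneg hE.posDef_transformed _ q

variable [Fintype J]

/-- How often each signal occurs in the list `κ` of signals. -/
def signalCount (κ : J → Fin K) (k : Fin K) : ℕ := (Finset.univ.filter fun j => κ j = k).card

omit [NeZero K] in
theorem dotProduct_posteriorPrecision_mulVec (E : Environment K) (κ : J → Fin K)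
    (x y : Fin K → ℝ) :
    x ⬝ᵥ E.posteriorPrecision (signalCount κ) *ᵥ y =
      x ⬝ᵥ E.cov⁻¹ *ᵥ y + ∑ j, (x ⬝ᵥ E.coeff (κ j)) * (E.coeff (κ j) ⬝ᵥ y) := by
  rw [posteriorPrecision, add_mulVec, dotProduct_add]
  congr 1
  rw [← mulVec_mulVec, ← mulVec_mulVec, dotProduct_mulVec, vecMul_transpose, dotProduct,
    ← Finset.sum_fiberwise_of_maps_to (s := Finset.univ) (t := Finset.univ) (g := κ)
      (fun _ _ => Finset.mem_univ _)]
  refine Finset.sum_congr rfl fun k _ => ?_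
  have fiber_sum : ∑ j with κ j = k, (x ⬝ᵥ E.coeff (κ j)) * (E.coeff (κ j) ⬝ᵥ y) =
      signalCount κ k * ((x ⬝ᵥ E.coeff k) * (E.coeff k ⬝ᵥ y)) := by
    rw [Finset.sum_congr rfl (g := fun _ => (x ⬝ᵥ E.coeff k) * (E.coeff k ⬝ᵥ y))
      (fun j hj => by rw [(Finset.mem_filter.1 hj).2]), Finset.sum_const, nsmul_eq_mul]
    rfl
  rw [fiber_sum, mulVec_diagonal, mulVec, mulVec, dotProduct_comm (E.coeff k) x]
  ring

/-- The weights of the state vector in the difference between the state of interest and the weighted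
sum of the observations. -/
noncomputable def innovationWeight (E : Environment K) (κ : J → Fin K) : Fin K → ℝ :=
  E.posteriorCov (signalCount κ) ᵥ* E.cov⁻¹

/-- The weight of each observation in the posterior mean of the state of interest. -/
noncomputable def signalWeight (E : Environment K) (κ : J → Fin K) (j : J) : ℝ :=
  E.posteriorCov (signalCount κ) ⬝ᵥ E.coeff (κ j)

/-- The posterior mean of the state of interest, as a function of the observations `x` of the
signals `κ`, for the prior mean vector `m`. -/
noncomputable def posteriorMean (E : Environment K) (m : EuclideanSpace ℝ (Fin K))
    (κ : J → Fin K) (x : J → ℝ) : ℝ :=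
  ∑ l, E.innovationWeight κ l * m l + ∑ j, E.signalWeight κ j * x j

theorem measurable_posteriorMean (E : Environment K) (m : EuclideanSpace ℝ (Fin K))
    (κ : J → Fin K) : Measurable (E.posteriorMean m κ) := by
  unfold posteriorMean
  fun_prop

section Innovation

variable {E : Environment K}

theorem Regular.innovationWeight_dotProduct_cov_mulVec (hE : E.Regular) (κ : J → Fin K)
    (y : Fin K → ℝ) :
    E.innovationWeight κ ⬝ᵥ E.cov *ᵥ y = E.posteriorCov (signalCount κ) ⬝ᵥ y := by
  rw [innovationWeight, ← dotProduct_mulVec, mulVec_mulVec,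
    nonsing_inv_mul _ ((isUnit_iff_isUnit_det _).1 hE.posDef.isUnit), one_mulVec]

theorem Regular.innovation_uncorrelated [DecidableEq J] (hE : E.Regular) (κ : J → Fin K) (j : J) :
    E.innovationWeight κ ⬝ᵥ E.cov *ᵥ E.coeff (κ j) +
      -E.signalWeight κ ⬝ᵥ Pi.single j 1 = 0 := by
  rw [hE.innovationWeight_dotProduct_cov_mulVec, dotProduct_single_one, Pi.neg_apply, signalWeight,
    add_neg_cancel]

theorem Regular.innovation_variance (hE : E.Regular) (κ : J → Fin K) :
    E.innovationWeight κ ⬝ᵥ E.cov *ᵥ E.innovationWeight κ +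
      -E.signalWeight κ ⬝ᵥ -E.signalWeight κ = E.posteriorVariance (signalCount κ) := by
  rw [← posteriorCov_zero, ← posteriorCov_dotProduct_posteriorPrecision_mulVec hE.posDef
    (signalCount κ) (E.posteriorCov (signalCount κ)), dotProduct_posteriorPrecision_mulVec,
    hE.innovationWeight_dotProduct_cov_mulVec, neg_dotProduct_neg, innovationWeight,
    dotProduct_comm _ (_ ᵥ* _), ← dotProduct_mulVec]
  congr 1
  exact Finset.sum_congr rfl fun j _ => by rw [dotProduct_comm (E.coeff (κ j)), signalWeight]

theorem Regular.apply_zero_eq_innovation_add (hE : E.Regular) (κ : J → Fin K)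
    (x : EuclideanSpace ℝ (Fin K) × EuclideanSpace ℝ J) :
    x.1 0 = pairFunctional (E.innovationWeight κ) (-E.signalWeight κ) x +
      ∑ j, E.signalWeight κ j * E.observe κ x.1 x.2.ofLp j := by
  have expand := dotProduct_posteriorPrecision_mulVec E κ (E.posteriorCov (signalCount κ)) x.1.ofLp
  rw [posteriorCov_dotProduct_posteriorPrecision_mulVec hE.posDef, dotProduct_mulVec] at expand
  rw [expand, pairFunctional_apply, add_assoc, ← Finset.sum_add_distrib]
  congr 1
  refine Finset.sum_congr rfl fun j _ => ?_
  simp only [observe, signalWeight, Pi.neg_apply, dotProduct]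
  ring

end Innovation

omit [NeZero K] in
theorem pairFunctional_single_eq_observe [DecidableEq J] (E : Environment K) (κ : J → Fin K)
    (j : J) (x : EuclideanSpace ℝ (Fin K) × EuclideanSpace ℝ J) :
    pairFunctional (E.coeff (κ j)) (Pi.single j 1) x = E.observe κ x.1 x.2.ofLp j := by
  rw [pairFunctional_apply, observe]
  simp [Pi.single_apply]

theorem measurePreserving_toLp_stdGaussian (J : Type*) [Fintype J] :
    MeasurePreserving (toLp 2) (Measure.pi fun _ : J => gaussianReal 0 1)
      (stdGaussian (EuclideanSpace ℝ J)) :=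
  ⟨by fun_prop, map_pi_eq_stdGaussian⟩

theorem Regular.hasGaussianPosterior_observe {E : Environment K} (hE : E.Regular)
    (m : EuclideanSpace ℝ (Fin K)) (κ : J → Fin K) :
    HasGaussianPosterior
      ((multivariateGaussian m E.cov).prod (Measure.pi fun _ : J => gaussianReal 0 1))
      (fun p => p.1 0) (fun p => E.observe κ p.1 p.2) (E.posteriorMean m κ)
      fun _ => E.posteriorVariance (signalCount κ) := by
  classical
  have regression := map_pairFunctional_prodMk (m := m) hE.posDef.posSemidef
    (E.innovationWeight κ) (-E.signalWeight κ) (fun j => E.coeff (κ j)) (fun j => Pi.single j 1)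
    (hE.innovation_uncorrelated κ)
  simp only [hE.innovation_variance κ, pairFunctional_single_eq_observe] at regression
  have hobs : Measurable fun x : EuclideanSpace ℝ (Fin K) × EuclideanSpace ℝ J =>
      E.observe κ x.1 x.2.ofLp := by
    unfold observe
    fun_prop
  exact (hasGaussianPosterior_of_map_prodMk (hE.posteriorVariance_nonneg _)
    (pairFunctional _ _).measurable hobs (h := fun x => ∑ j, E.signalWeight κ j * x j)
    (by fun_prop) regression (hE.apply_zero_eq_innovation_add κ)).comp_measurePreserving
      ((MeasurePreserving.id _).prod (measurePreserving_toLp_stdGaussian J))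

end Environment

end InfoGame

namespace InfoGame

namespace Acquisition

variable {K B : ℕ}

/-- The signals that are acquired along the history `h`. -/
def choices (S : Acquisition K B) {t : ℕ} (r : unitInterval) (h : History B t)
    (p : Fin t × Fin B) : Fin K :=
  S.choose p.1 r (fun j => h (Fin.castLE p.1.isLt.le j)) p.2

theorem measurable_choices (S : Acquisition K B) (t : ℕ) :
    Measurable fun p : unitInterval × History B t => S.choices p.1 p.2 := by
  refine measurable_pi_lambda _ fun p => (measurable_pi_apply p.2).comp ?_
  exact (S.measurable_choose p.1).comp
    (f := fun y : unitInterval × History B t => (y.1, fun j => y.2 (Fin.castLE p.1.isLt.le j)))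
    (by fun_prop)

theorem signalCount_choices (S : Acquisition K B) {t : ℕ} (r : unitInterval) (h : History B t) :
    Environment.signalCount (S.choices r h) = S.division r h := by
  funext k
  rw [Environment.signalCount, Finset.card_filter, Fintype.sum_prod_type]
  simp only [division, count, Finset.card_filter]
  rfl

theorem history_castLE (S : Acquisition K B) (E : Environment K) (θ : EuclideanSpace ℝ (Fin K))
    (r : unitInterval) (e : ℕ × Fin B → ℝ) {s t : ℕ} (hst : s ≤ t) :
    (fun j => S.history E θ r e t (Fin.castLE hst j)) = S.history E θ r e s := by
  induction t with
  | zero =>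
    obtain rfl : s = 0 := by omega
    rfl
  | succ t ih =>
    rcases Nat.lt_or_ge t s with h | h
    · obtain rfl : s = t + 1 := by omega
      rfl
    · rw [← ih h]
      ext j : 1
      have : Fin.castLE hst j = Fin.castSucc (Fin.castLE h j) := rfl
      rw [this, history, Fin.snoc_castSucc]

theorem history_apply (S : Acquisition K B) (E : Environment K) (θ : EuclideanSpace ℝ (Fin K))
    (r : unitInterval) (e : ℕ × Fin B → ℝ) {t : ℕ} (s : Fin t) (b : Fin B) :
    S.history E θ r e t s b =
      (∑ l, E.coeff (S.choose s r (S.history E θ r e s) b) l * θ l) + e (s, b) := by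
  have h := congrFun (S.history_castLE E θ r e (Nat.succ_le_of_lt s.isLt)) (Fin.last _)
  have h' : Fin.castLE (Nat.succ_le_of_lt s.isLt) (Fin.last _) = s := rfl
  rw [h'] at h
  rw [h, history, Fin.snoc_last]

/-- The signal realizations on the history of `t` periods if the signals of the plan `κ` are
observed, whatever is realized. -/
def plannedHistory (E : Environment K) {t : ℕ} (κ : Fin t × Fin B → Fin K)
    (θ : EuclideanSpace ℝ (Fin K)) (e : ℕ × Fin B → ℝ) : History B t :=
  fun s b => E.observe κ θ (fun p => e (p.1, p.2)) (s, b)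

theorem history_eq_plannedHistory (S : Acquisition K B) (E : Environment K)
    (θ : EuclideanSpace ℝ (Fin K)) (r : unitInterval) (e : ℕ × Fin B → ℝ) (t : ℕ) :
    S.history E θ r e t = plannedHistory E (S.choices r (S.history E θ r e t)) θ e := by
  ext s b
  rw [history_apply, plannedHistory, Environment.observe, choices]
  simp only [history_castLE]

theorem eq_history_of_eq_plannedHistory (S : Acquisition K B) (E : Environment K)
    (θ : EuclideanSpace ℝ (Fin K)) (r : unitInterval) (e : ℕ × Fin B → ℝ) {t : ℕ}
    {h : History B t} (hh : h = plannedHistory E (S.choices r h) θ e) :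
    h = S.history E θ r e t := by
  have agree : ∀ n : ℕ, ∀ hn : n < t, h ⟨n, hn⟩ = S.history E θ r e t ⟨n, hn⟩ := by
    intro n
    induction n using Nat.strong_induction_on with
    | _ n ih =>
      intro hn
      have agree_before : (fun j : Fin n => h (Fin.castLE hn.le j)) = S.history E θ r e n := by
        rw [← S.history_castLE E θ r e hn.le]
        ext j : 1
        exact ih j j.isLt (j.isLt.trans hn)
      ext b
      rw [history_apply]
      conv_lhs => rw [hh]
      simp only [plannedHistory, Environment.observe, choices, agree_before]
  ext s : 1
  exact agree s s.isLt

theorem history_eq_plannedHistory_of_choices_eq (S : Acquisition K B) (E : Environment K)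
    (θ : EuclideanSpace ℝ (Fin K)) (r : unitInterval) (e : ℕ × Fin B → ℝ) {t : ℕ}
    {κ : Fin t × Fin B → Fin K} (h : S.choices r (S.history E θ r e t) = κ ∨
      S.choices r (plannedHistory E κ θ e) = κ) :
    S.history E θ r e t = plannedHistory E κ θ e := by
  rcases h with h | h
  · rw [← h]
    exact S.history_eq_plannedHistory E θ r e t
  · exact (S.eq_history_of_eq_plannedHistory E θ r e (by rw [h])).symm

theorem measurable_history (S : Acquisition K B) (E : Environment K) (t : ℕ) :
    Measurable fun x : EuclideanSpace ℝ (Fin K) × unitInterval × (ℕ × Fin B → ℝ) =>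
      S.history E x.1 x.2.1 x.2.2 t := by
  induction t using Nat.strong_induction_on with
  | _ t ih =>
    refine measurable_pi_lambda _ fun s => measurable_pi_lambda _ fun b => ?_
    simp only [history_apply]
    have hchoose : Measurable fun x : EuclideanSpace ℝ (Fin K) × unitInterval × (ℕ × Fin B → ℝ) =>
        S.choose s x.2.1 (S.history E x.1 x.2.1 x.2.2 s) b :=
      (measurable_pi_apply b).comp ((S.measurable_choose s).comp
        (Measurable.prodMk (by fun_prop) (ih s s.isLt)))
    have hcoeff : ∀ l, Measurable fun x : EuclideanSpace ℝ (Fin K) × unitInterval ×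
        (ℕ × Fin B → ℝ) => E.coeff (S.choose s x.2.1 (S.history E x.1 x.2.1 x.2.2 s) b) l :=
      fun l => (measurable_of_finite fun k => E.coeff k l).comp hchoose
    fun_prop

/-- The outcome of the randomization device and the history of the first `t` periods. -/
def data (S : Acquisition K B) (E : Environment K) (t : ℕ)
    (x : EuclideanSpace ℝ (Fin K) × unitInterval × (ℕ × Fin B → ℝ)) :
    unitInterval × History B t :=
  (x.2.1, S.history E x.1 x.2.1 x.2.2 t)

theorem measurable_data (S : Acquisition K B) (E : Environment K) (t : ℕ) :
    Measurable (S.data E t) :=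
  Measurable.prodMk (by fun_prop) (S.measurable_history E t)

end Acquisition

/-- The law of the randomization device and the noise terms of a player. -/
noncomputable abbrev deviceLaw (B : ℕ) : Measure (unitInterval × (ℕ × Fin B → ℝ)) :=
  (volume : Measure unitInterval).prod (Measure.infinitePi fun _ : ℕ × Fin B => gaussianReal 0 1)

theorem measurePreserving_noise (B t : ℕ) :
    MeasurePreserving (fun (e : ℕ × Fin B → ℝ) (p : Fin t × Fin B) => e (p.1, p.2))
      (Measure.infinitePi fun _ : ℕ × Fin B => gaussianReal 0 1)
      (Measure.pi fun _ : Fin t × Fin B => gaussianReal 0 1) := by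
  refine ⟨by fun_prop, ?_⟩
  have hinj : Function.Injective fun p : Fin t × Fin B => ((p.1 : ℕ), p.2) := by
    rintro ⟨a, b⟩ ⟨c, d⟩ h
    simp only [Prod.mk.injEq] at h
    exact Prod.ext (Fin.ext h.1) h.2
  rw [← Measure.infinitePi_eq_pi]
  exact Measure.map_infinitePi_infinitePi_of_inj (P := fun _ : ℕ × Fin B => gaussianReal 0 1) hinj

variable {K B : ℕ}

theorem measurePreserving_device_swap (ν : Measure (EuclideanSpace ℝ (Fin K)))
    [IsProbabilityMeasure ν] (t : ℕ) :
    MeasurePreserving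
      (fun x : EuclideanSpace ℝ (Fin K) × unitInterval × (ℕ × Fin B → ℝ) =>
        (x.2.1, x.1, fun p : Fin t × Fin B => x.2.2 (p.1, p.2)))
      (ν.prod (deviceLaw B)) ((volume : Measure unitInterval).prod
        (ν.prod (Measure.pi fun _ : Fin t × Fin B => gaussianReal 0 1))) :=
  ((MeasurePreserving.id _).prod ((MeasurePreserving.id _).prod (measurePreserving_noise B t))).comp
    ((measurePreserving_prodAssoc _ _ _).comp
      ((Measure.measurePreserving_swap.prod (MeasurePreserving.id _)).comp
        (measurePreserving_prodAssoc ν volume _).symm))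

namespace Environment.Regular

variable [NeZero K] {E : Environment K}

theorem hasGaussianPosterior_plannedHistory (hE : E.Regular) (m : EuclideanSpace ℝ (Fin K))
    {t : ℕ} (κ : Fin t × Fin B → Fin K) :
    HasGaussianPosterior ((multivariateGaussian m E.cov).prod (deviceLaw B)) (fun x => x.1 0)
      (fun x => (x.2.1, Acquisition.plannedHistory E κ x.1 x.2.2))
      (fun y : unitInterval × History B t => E.posteriorMean m κ fun p => y.2 p.1 p.2)
      fun _ => E.posteriorVariance (signalCount κ) := by
  have hmean := E.measurable_posteriorMean m κ
  exact (((hE.hasGaussianPosterior_observe m κ).prod_left volume).comp_measurePreserving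
    (measurePreserving_device_swap _ t)).map_data
      (e := fun y : unitInterval × (Fin t × Fin B → ℝ) => (y.1, fun s b => y.2 (s, b)))
      (μ := fun y => E.posteriorMean m κ fun p => y.2 p.1 p.2)
      (v := fun _ => E.posteriorVariance (signalCount κ))
      (by fun_prop) (by fun_prop) measurable_const

theorem hasGaussianPosterior_data (hE : E.Regular) (m : EuclideanSpace ℝ (Fin K))
    (S : Acquisition K B) (t : ℕ) :
    HasGaussianPosterior ((multivariateGaussian m E.cov).prod (deviceLaw B)) (fun x => x.1 0)
      (S.data E t) (fun y => E.posteriorMean m (S.choices y.1 y.2) fun p => y.2 p.1 p.2)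
      fun y => E.posteriorVariance (S.division y.1 y.2) := by
  have h := hasGaussianPosterior_of_forall_fixed
    (fun κ => hE.hasGaussianPosterior_plannedHistory m κ) (by fun_prop) (S.measurable_data E t)
    (S.measurable_choices t) fun κ x hx => Prod.ext rfl
      (S.history_eq_plannedHistory_of_choices_eq E x.1 x.2.1 x.2.2 hx)
  simpa only [S.signalCount_choices] using h

end Environment.Regular

end InfoGame

section Garbling

variable {X Y Z W : Type*} [MeasurableSpace X] [MeasurableSpace Y] [MeasurableSpace Z]
  [MeasurableSpace W]

theorem map_prod_congr {P : Measure X} {Q : Measure Z} [SFinite Q] {Q' : Measure W}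
    [SFinite Q'] {g : X × Z → Y} {g' : X × W → Y} (hg : Measurable g) (hg' : Measurable g')
    (h : ∀ x, Q.map (fun z => g (x, z)) = Q'.map fun w => g' (x, w)) :
    (P.prod Q).map g = (P.prod Q').map g' := by
  ext s hs
  rw [Measure.map_apply hg hs, Measure.map_apply hg' hs, Measure.prod_apply (hg hs),
    Measure.prod_apply (hg' hs)]
  refine lintegral_congr fun x => ?_
  have hx := congrArg (fun ν => ν s) (h x)
  rwa [Measure.map_apply (by fun_prop) hs, Measure.map_apply (by fun_prop) hs] at hx

theorem gaussianReal_prod_map_add (c : ℝ) {a b : ℝ} (ha : 0 ≤ a) (hb : 0 ≤ b) :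
    ((gaussianReal 0 1).prod (gaussianReal 0 1)).map (fun w => c + √a * w.1 + √b * w.2) =
      (gaussianReal 0 1).map fun z => c + √(a + b) * z := by
  rw [gaussianReal_map_const_add_sqrt_mul c (add_nonneg ha hb), Real.toNNReal_add ha hb,
    ← add_zero c, ← gaussianReal_conv_gaussianReal, ← gaussianReal_map_const_add_sqrt_mul c ha,
    ← gaussianReal_map_const_add_sqrt_mul 0 hb, Measure.conv,
    Measure.map_prod_map _ _ (by fun_prop) (by fun_prop),
    Measure.map_map (by fun_prop) (by fun_prop)]
  congr 1
  funext w
  simp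

theorem eq_of_conv_gaussianReal_eq {P Q : Measure ℝ} [IsFiniteMeasure P] [IsFiniteMeasure Q]
    {v : NNReal} (h : P ∗ gaussianReal 0 v = Q ∗ gaussianReal 0 v) : P = Q := by
  refine Measure.ext_of_charFun ?_
  ext t
  have ht := congrArg (fun ν => charFun ν t) h
  simp only [charFun_conv, charFun_gaussianReal] at ht
  exact mul_right_cancel₀ (Complex.exp_ne_zero _) ht

/-- The law that results from `Q` when independent centered Gaussian noise of variance `f` is added
to the first component. -/
noncomputable def addNoise (f : ℝ) (Q : Measure (ℝ × Y)) : Measure (ℝ × Y) :=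
  (Q.prod (gaussianReal 0 1)).map fun p => (p.1.1 + √f * p.2, p.1.2)

theorem addNoise_map (f : ℝ) {P : Measure X} [SFinite P] {g : X → ℝ × Y} (hg : Measurable g) :
    addNoise f (P.map g) =
      (P.prod (gaussianReal 0 1)).map fun p => ((g p.1).1 + √f * p.2, (g p.1).2) := by
  rw [addNoise, ← Measure.map_id (μ := gaussianReal 0 1),
    Measure.map_prod_map _ _ hg measurable_id, Measure.map_map (by fun_prop) (by fun_prop),
    Measure.map_id]
  rfl

theorem fst_restrict_addNoise {f : ℝ} (hf : 0 ≤ f) (Q : Measure (ℝ × Y)) [SFinite Q] {A : Set Y}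
    (hA : MeasurableSet A) :
    ((addNoise f Q).restrict (Prod.snd ⁻¹' A)).map Prod.fst =
      (Q.restrict (Prod.snd ⁻¹' A)).map Prod.fst ∗ gaussianReal 0 f.toNNReal := by
  have cylinder : (fun p : (ℝ × Y) × ℝ => (p.1.1 + √f * p.2, p.1.2)) ⁻¹' (Prod.snd ⁻¹' A) =
      (Prod.snd ⁻¹' A) ×ˢ Set.univ := by
    ext
    simp
  rw [addNoise, Measure.restrict_map (by fun_prop) (measurable_snd hA), cylinder,
    ← Measure.prod_restrict, Measure.restrict_univ, Measure.map_map (by fun_prop) (by fun_prop),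
    ← gaussianReal_map_const_add_sqrt_mul 0 hf, Measure.conv,
    Measure.map_prod_map _ _ (by fun_prop) (by fun_prop),
    Measure.map_map (by fun_prop) (by fun_prop)]
  congr 1
  funext p
  simp

theorem addNoise_injective {f : ℝ} (hf : 0 ≤ f) {Q₁ Q₂ : Measure (ℝ × Y)} [IsFiniteMeasure Q₁]
    [IsFiniteMeasure Q₂] (h : addNoise f Q₁ = addNoise f Q₂) : Q₁ = Q₂ := by
  refine Measure.ext_prod fun {s A} hs hA => ?_
  have apply_rectangle : ∀ Q : Measure (ℝ × Y),
      (Q.restrict (Prod.snd ⁻¹' A)).map Prod.fst s = Q (s ×ˢ A) := by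
    intro Q
    rw [Measure.map_apply measurable_fst hs, Measure.restrict_apply (measurable_fst hs)]
    rfl
  rw [← apply_rectangle, ← apply_rectangle]
  congr 1
  refine eq_of_conv_gaussianReal_eq (v := f.toNNReal) ?_
  rw [← fst_restrict_addNoise hf Q₁ hA, ← fst_restrict_addNoise hf Q₂ hA, h]

theorem fst_addNoise_prod (f : ℝ) (Q : Measure (ℝ × Y)) [SFinite Q] (ρ : Measure Z) [SFinite ρ] :
    (addNoise f Q).fst.prod ρ = addNoise f (Q.fst.prod ρ) := by
  have swap_noise : MeasurePreserving
      (fun p : ((ℝ × Y) × ℝ) × Z => ((p.1.1, p.2), p.1.2))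
      ((Q.prod (gaussianReal 0 1)).prod ρ) ((Q.prod ρ).prod (gaussianReal 0 1)) :=
    (measurePreserving_prodAssoc _ _ _).symm.comp
      (((MeasurePreserving.id _).prod Measure.measurePreserving_swap).comp
        (measurePreserving_prodAssoc _ _ _))
  have fst_prod_eq : Q.fst.prod ρ = (Q.prod ρ).map (Prod.map Prod.fst id) := by
    rw [← Measure.map_prod_map _ _ measurable_fst measurable_id, Measure.map_id]
    rfl
  rw [fst_prod_eq, addNoise_map f (by fun_prop), ← swap_noise.map_eq,
    Measure.map_map (by fun_prop) (by fun_prop), Measure.fst, addNoise,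
    Measure.map_map (by fun_prop) (by fun_prop)]
  conv_lhs => rw [← Measure.map_id (μ := ρ)]
  rw [Measure.map_prod_map _ _ (by fun_prop) measurable_id]
  rfl

theorem exists_measurable_map_fst_prod_volume_eq [StandardBorelSpace Y] [Nonempty Y]
    (Γ : Measure (X × Y)) [IsFiniteMeasure Γ] :
    ∃ φ : X → unitInterval → Y, Measurable (Function.uncurry φ) ∧
      (Γ.fst.prod volume).map (fun p => (p.1, φ p.1 p.2)) = Γ := by
  obtain ⟨φ, hφ, hφκ⟩ := Kernel.exists_measurable_map_eq_unitInterval Γ.condKernel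
  have hgraph : Measurable fun p : X × unitInterval => (p.1, φ p.1 p.2) := measurable_fst.prodMk hφ
  refine ⟨φ, hφ, ?_⟩
  conv_rhs => rw [← Measure.disintegrate Γ Γ.condKernel]
  ext s hs
  rw [Measure.map_apply hgraph hs, Measure.prod_apply (hgraph hs), Measure.compProd_apply hs]
  refine lintegral_congr fun x => ?_
  have hφx : Measurable (φ x) := hφ.comp measurable_prodMk_left
  rw [← hφκ x, Measure.map_apply hφx (measurable_prodMk_left hs)]
  rfl

namespace HasGaussianPosterior

variable {P : Measure X} {θ : X → ℝ} {D : X → Y} {μ v : Y → ℝ} {f : ℝ}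

theorem map_prodMk_comp_eq_addNoise [SFinite P] (h : HasGaussianPosterior P θ D μ fun _ => f)
    {ψ : Y → Z} (hψ : Measurable ψ) :
    P.map (fun x => (θ x, ψ (D x))) = addNoise f (P.map fun x => (μ (D x), ψ (D x))) := by
  obtain ⟨hθ, hD, hμ, -, hmap⟩ := h
  have := congrArg (Measure.map (Prod.map id ψ)) hmap
  rw [Measure.map_map (by fun_prop) (by fun_prop),
    Measure.map_map (by fun_prop) (by fun_prop)] at this
  rw [addNoise_map f (by fun_prop)]
  exact this

theorem map_prodMk_eq_addNoise [SFinite P] (h : HasGaussianPosterior P θ D μ v) (hf : 0 ≤ f)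
    (hfv : ∀ x, f ≤ v (D x)) :
    P.map (fun x => (θ x, D x)) = addNoise f ((P.prod (gaussianReal 0 1)).map
      fun p => (μ (D p.1) + √(v (D p.1) - f) * p.2, D p.1)) := by
  obtain ⟨-, hD, hμ, hv, hmap⟩ := h
  rw [hmap, addNoise_map f (by fun_prop),
    ← (measurePreserving_prodAssoc P (gaussianReal 0 1) (gaussianReal 0 1)).symm.map_eq,
    Measure.map_map (by fun_prop) (MeasurableEquiv.measurable _)]
  refine map_prod_congr (by fun_prop) (by fun_prop) fun x => ?_
  have split_noise := congrArg (Measure.map fun y => (y, D x))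
    (gaussianReal_prod_map_add (μ (D x)) (sub_nonneg.2 (hfv x)) hf)
  rw [sub_add_cancel, Measure.map_map (by fun_prop) (by fun_prop),
    Measure.map_map (by fun_prop) (by fun_prop)] at split_noise
  exact split_noise.symm

/-- Blackwell's comparison: the posterior mean `μ₁ D₁` is a less noisy observation of the state than
`μ₂ D₂`, so that adding noise to it and resampling the rest of the data reproduces `D₂`. -/
theorem exists_garbling [StandardBorelSpace Z] [Nonempty Z] [IsProbabilityMeasure P]
    (h₁ : HasGaussianPosterior P θ D μ fun _ => f) {D₂ : X → Z} {μ₂ v₂ : Z → ℝ}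
    (h₂ : HasGaussianPosterior P θ D₂ μ₂ v₂) (hf : 0 ≤ f) (hfv : ∀ x, f ≤ v₂ (D₂ x))
    {r : Y → unitInterval} (hr : Measurable r)
    (hind : P.map (fun x => (θ x, r (D x))) = (P.map θ).prod volume) :
    ∃ ψ : Y → Z, Measurable ψ ∧
      P.map (fun x => (θ x, ψ (D x))) = P.map fun x => (θ x, D₂ x) := by
  obtain ⟨hθ, hD₂, hμ₂, hv₂, -⟩ := id h₂
  have hD := h₁.measurable_data
  have hμ := h₁.measurable_mean
  set Γ : Measure (ℝ × Z) := (P.prod (gaussianReal 0 1)).map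
    fun p => (μ₂ (D₂ p.1) + √(v₂ (D₂ p.1) - f) * p.2, D₂ p.1)
  have : IsProbabilityMeasure Γ := Measure.isProbabilityMeasure_map (by fun_prop)
  have : IsProbabilityMeasure (P.map fun x => (μ (D x), r (D x))) :=
    Measure.isProbabilityMeasure_map (by fun_prop)
  have addNoise_Γ : addNoise f Γ = P.map fun x => (θ x, D₂ x) :=
    (h₂.map_prodMk_eq_addNoise hf hfv).symm
  have law_mean_device : P.map (fun x => (μ (D x), r (D x))) = Γ.fst.prod volume := by
    refine addNoise_injective hf ?_
    rw [← h₁.map_prodMk_comp_eq_addNoise hr, hind, ← fst_addNoise_prod, addNoise_Γ, Measure.fst,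
      Measure.map_map measurable_fst (by fun_prop)]
    rfl
  obtain ⟨φ, hφ, hφΓ⟩ := exists_measurable_map_fst_prod_volume_eq Γ
  have hgraph : Measurable fun p : ℝ × unitInterval => (p.1, φ p.1 p.2) := measurable_fst.prodMk hφ
  have hψ : Measurable fun y => φ (μ y) (r y) := hφ.comp (hμ.prodMk hr)
  refine ⟨fun y => φ (μ y) (r y), hψ, ?_⟩
  rw [h₁.map_prodMk_comp_eq_addNoise hψ, ← addNoise_Γ]
  congr 1
  rw [← hφΓ, ← law_mean_device, Measure.map_map hgraph (by fun_prop)]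
  rfl

end HasGaussianPosterior

end Garbling

namespace InfoGame

variable {K B : ℕ} [NeZero K]

theorem map_state_device_eq_prod (ν : Measure (EuclideanSpace ℝ (Fin K))) [IsProbabilityMeasure ν] :
    (ν.prod (deviceLaw B)).map (fun x => (x.1 0, x.2.1)) =
      ((ν.prod (deviceLaw B)).map fun x => x.1 0).prod volume := by
  have hstate : (ν.prod (deviceLaw B)).map (fun x => x.1 0) = ν.map fun θ => θ 0 := by
    have hfst := (measurePreserving_fst (μ := ν) (ν := deviceLaw B)).map_eq
    conv_rhs => rw [← hfst, Measure.map_map (by fun_prop) measurable_fst]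
    rfl
  have hdevice := (measurePreserving_fst (μ := (volume : Measure unitInterval)) (ν :=
    Measure.infinitePi fun _ : ℕ × Fin B => gaussianReal 0 1)).map_eq
  rw [hstate, ← hdevice, Measure.map_prod_map _ _ (by fun_prop) measurable_fst]
  rfl

theorem Environment.Regular.exists_garbling {E : Environment K} (hE : E.Regular) {t : ℕ}
    {S : Acquisition K B}
    (hS : ∀ r (h : History B t), IsOptimalCount E.posteriorVariance (t * B) (S.division r h))
    (τ : Acquisition K B) (m : EuclideanSpace ℝ (Fin K)) :
    ∃ ψ : unitInterval × History B t → unitInterval × History B t, Measurable ψ ∧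
      ((multivariateGaussian m E.cov).prod (deviceLaw B)).map
          (fun x => (x.1 0, ψ (S.data E t x))) =
        ((multivariateGaussian m E.cov).prod (deviceLaw B)).map
          fun x => (x.1 0, τ.data E t x) := by
  have variance_eq : ∀ r (h : History B t),
      E.posteriorVariance (S.division r h) = E.posteriorVariance (S.division 0 (0 : History B t)) :=
    fun r h =>
      le_antisymm ((hS r h).2 _ (S.sum_division _ _)) ((hS 0 0).2 _ (S.sum_division _ _))
  have posterior := hE.hasGaussianPosterior_data m S t
  simp only [variance_eq] at posterior
  exact posterior.exists_garbling (hE.hasGaussianPosterior_data m τ t)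
    (hE.posteriorVariance_nonneg _) (fun x => (hS 0 0).2 _ (τ.sum_division _ _)) measurable_fst
    (map_state_device_eq_prod _)

end InfoGame

theorem measurePreserving_update {ι : Type*} [Fintype ι] [DecidableEq ι] {X : ι → Type*}
    [∀ i, MeasurableSpace (X i)] (μ : ∀ i, Measure (X i)) [∀ i, IsProbabilityMeasure (μ i)]
    (i : ι) :
    MeasurePreserving (fun p : (∀ j, X j) × X i => Function.update p.1 i p.2)
      ((Measure.pi μ).prod (μ i)) (Measure.pi μ) := by
  refine ⟨measurable_update', (Measure.pi_eq fun s hs => ?_).symm⟩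
  have preimage_pi : (fun p : (∀ j, X j) × X i => Function.update p.1 i p.2) ⁻¹' Set.univ.pi s =
      (Set.univ.pi (Function.update s i Set.univ)) ×ˢ s i := by
    ext ⟨x, y⟩
    simp only [Set.mem_preimage, Set.mem_univ_pi, Set.mem_prod]
    constructor
    · refine fun h => ⟨fun j => ?_, by simpa using h i⟩
      rcases eq_or_ne j i with rfl | hj
      · simp
      · simpa [hj] using h j
    · rintro ⟨h, h'⟩ j
      rcases eq_or_ne j i with rfl | hj
      · simpa using h'
      · simpa [hj] using h j
  rw [Measure.map_apply measurable_update' (MeasurableSet.univ_pi hs), preimage_pi,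
    Measure.prod_prod, Measure.pi_pi, ← Finset.mul_prod_erase _ _ (Finset.mem_univ i),
    ← Finset.mul_prod_erase _ (fun j => μ j (s j)) (Finset.mem_univ i), mul_comm]
  simp only [Function.update_self, measure_univ, one_mul]
  congr 1
  refine Finset.prod_congr rfl fun j hj => ?_
  rw [Function.update_of_ne (Finset.ne_of_mem_erase hj)]

section CondIndep

variable {Ω T U V : Type*} [MeasurableSpace Ω] [StandardBorelSpace Ω] [MeasurableSpace T]
  [StandardBorelSpace T] [Nonempty T] [MeasurableSpace U] [MeasurableSpace V]
  [StandardBorelSpace V] [Nonempty V] {P : Measure Ω} [IsFiniteMeasure P] {W : Ω → V} {θ : Ω → T}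

theorem lintegral_eq_lintegral_condDistrib {k : Ω → U} (hW : Measurable W) (hθ : Measurable θ)
    (hk : Measurable k)
    (h : CondIndepFun (MeasurableSpace.comap k inferInstance) hk.comap_le W θ P)
    {G : V × T → ENNReal} (hG : Measurable G) :
    ∫⁻ x, G (W x, θ x) ∂P = ∫⁻ x, ∫⁻ w, G (w, θ x) ∂(condDistrib W k P (k x)) ∂P := by
  have law := (condIndepFun_iff_condDistrib_prod_ae_eq_prodMkRight hW hθ hk).1 h.symm
  rw [condDistrib_ae_eq_iff_measure_eq_compProd _ hW.aemeasurable] at law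
  have hG' : Measurable fun p : (U × T) × V => G (p.2, p.1.2) := by fun_prop
  have integrals := congrArg (fun Q => ∫⁻ p, G (p.2, p.1.2) ∂Q) law
  rw [lintegral_map hG' (by fun_prop), Measure.lintegral_compProd hG',
    lintegral_map hG'.lintegral_kernel_prod_right' (by fun_prop)] at integrals
  exact integrals

variable {Y Z : Type*} [MeasurableSpace Y] [MeasurableSpace Z] {ν : Measure Z} [SFinite ν]
  {f : T → U} {R : V × Y → ENNReal}

theorem lintegral_lintegral_eq_of_condIndepFun (hW : Measurable W) (hθ : Measurable θ)
    (hf : Measurable f)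
    (h : CondIndepFun (MeasurableSpace.comap (fun x => f (θ x)) inferInstance)
      (hf.comp hθ).comap_le W θ P)
    {D : T × Z → Y} (hD : Measurable D) (hR : Measurable R) :
    ∫⁻ x, ∫⁻ z, R (W x, D (θ x, z)) ∂ν ∂P =
      ∫⁻ y, ∫⁻ w, R (w, y.2) ∂(condDistrib W (fun x => f (θ x)) P y.1)
        ∂(((P.map θ).prod ν).map fun p => (f p.1, D p)) := by
  set κ := condDistrib W (fun x => f (θ x)) P
  have hκ : Measurable fun y : U × Y => ∫⁻ w, R (w, y.2) ∂(κ y.1) :=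
    Measurable.lintegral_kernel_prod_right' (κ := κ.prodMkRight Y)
      (f := fun p : (U × Y) × V => R (p.2, p.1.2)) (by fun_prop)
  have hG : Measurable fun p : V × T => ∫⁻ z, R (p.1, D (p.2, z)) ∂ν :=
    Measurable.lintegral_prod_right' (f := fun p : (V × T) × Z => R (p.1.1, D (p.1.2, p.2)))
      (by fun_prop)
  have hκD : Measurable fun p : T × Z => ∫⁻ w, R (w, D p) ∂(κ (f p.1)) :=
    hκ.comp (f := fun p : T × Z => (f p.1, D p)) (by fun_prop)
  rw [lintegral_eq_lintegral_condDistrib hW hθ (hf.comp hθ) h hG, lintegral_map hκ (by fun_prop),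
    lintegral_prod _ hκD.aemeasurable, lintegral_map hκD.lintegral_prod_right' hθ]
  refine lintegral_congr fun x => lintegral_lintegral_swap ?_
  exact Measurable.aemeasurable (by fun_prop : Measurable fun p : V × Z => R (p.1, D (θ x, p.2)))

theorem lintegral_lintegral_congr_of_condIndepFun (hW : Measurable W) (hθ : Measurable θ)
    (hf : Measurable f)
    (h : CondIndepFun (MeasurableSpace.comap (fun x => f (θ x)) inferInstance)
      (hf.comp hθ).comap_le W θ P)
    {D D' : T × Z → Y} (hD : Measurable D) (hD' : Measurable D')
    (hDD' : ((P.map θ).prod ν).map (fun p => (f p.1, D p)) =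
      ((P.map θ).prod ν).map fun p => (f p.1, D' p)) (hR : Measurable R) :
    ∫⁻ x, ∫⁻ z, R (W x, D (θ x, z)) ∂ν ∂P = ∫⁻ x, ∫⁻ z, R (W x, D' (θ x, z)) ∂ν ∂P := by
  rw [lintegral_lintegral_eq_of_condIndepFun hW hθ hf h hD hR, hDD',
    ← lintegral_lintegral_eq_of_condIndepFun hW hθ hf h hD' hR]

end CondIndep

namespace InfoGame

section Action

variable {K B : ℕ} {A : Type*} [MeasurableSpace A]

/-- The action of a player in period `t`, as a function of his state vector, his randomization
device and his noise terms. -/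
def Strategy.action (τ : Strategy K B A) (E : Environment K) (t : ℕ)
    (x : EuclideanSpace ℝ (Fin K) × unitInterval × (ℕ × Fin B → ℝ)) : A :=
  τ.decision.act t (τ.acquisition.data E t x).1 (τ.acquisition.data E t x).2

theorem Strategy.measurable_action (τ : Strategy K B A) (E : Environment K) (t : ℕ) :
    Measurable (τ.action E t) :=
  (τ.decision.measurable_act t).comp (τ.acquisition.measurable_data E t)

theorem Environment.Regular.exists_decision_map_action_eq [NeZero K] {E : Environment K}
    (hE : E.Regular) {S : Acquisition K B}
    (hS : ∀ t r (h : History B t), IsOptimalCount E.posteriorVariance (t * B) (S.division r h))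
    (τ : Strategy K B A) (m : EuclideanSpace ℝ (Fin K)) :
    ∃ δ : Decision B A, ∀ t,
      ((multivariateGaussian m E.cov).prod (deviceLaw B)).map
          (fun x => (x.1 0, (⟨S, δ⟩ : Strategy K B A).action E t x)) =
        ((multivariateGaussian m E.cov).prod (deviceLaw B)).map
          fun x => (x.1 0, τ.action E t x) := by
  choose ψ hψ hψmap using fun t => hE.exists_garbling (hS t) τ.acquisition m
  refine ⟨⟨fun t r h => τ.decision.act t (ψ t (r, h)).1 (ψ t (r, h)).2,
    fun t => (τ.decision.measurable_act t).comp (hψ t)⟩, fun t => ?_⟩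
  have hS := S.measurable_data E t
  have hτ := τ.acquisition.measurable_data E t
  have hact :
      Measurable (Prod.map (id : ℝ → ℝ) fun p : unitInterval × History B t =>
        τ.decision.act t p.1 p.2) := measurable_id.prodMap (τ.decision.measurable_act t)
  have := congrArg (Measure.map (Prod.map id fun p => τ.decision.act t p.1 p.2)) (hψmap t)
  rwa [Measure.map_map hact (by fun_prop), Measure.map_map hact (by fun_prop)] at this

end Action

section Profile

variable {ι : Type*} {K B : ℕ} {A : ι → Type*} [∀ i, MeasurableSpace (A i)]

theorem measurable_finalAction_of_period (E : ι → Environment K) (σ : ∀ i, Strategy K B (A i))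
    (t : ℕ) : Measurable fun p : States ι K × (ι → unitInterval × (ℕ × Fin B → ℝ)) =>
      finalAction E σ (t, p) :=
  measurable_pi_lambda _ fun j => ((σ j).measurable_action (E j) t).comp
    (f := fun p : States ι K × (ι → unitInterval × (ℕ × Fin B → ℝ)) => (p.1.2 j, p.2 j))
    (by fun_prop)

theorem measurable_finalAction (E : ι → Environment K) (σ : ∀ i, Strategy K B (A i)) :
    Measurable (finalAction E σ) :=
  measurable_from_prod_countable_right fun t => measurable_finalAction_of_period E σ t

variable [DecidableEq ι]

/-- The action profile of period `t` when player `i` takes the action `a` and the others, whose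
state vectors are `w`, follow `σ`. The entry `d i` is ignored. -/
def deviationProfile (E : ι → Environment K) (σ : ∀ i, Strategy K B (A i)) (i : ι) (t : ℕ)
    (d : ι → unitInterval × (ℕ × Fin B → ℝ)) (w : {j // j ≠ i} → EuclideanSpace ℝ (Fin K))
    (a : A i) (j : ι) : A j :=
  if h : j = i then h ▸ a else (σ j).action (E j) t (w ⟨j, h⟩, d j)

theorem measurable_deviationProfile (E : ι → Environment K) (σ : ∀ i, Strategy K B (A i)) (i : ι)
    (t : ℕ) (d : ι → unitInterval × (ℕ × Fin B → ℝ)) :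
    Measurable fun p : ({j // j ≠ i} → EuclideanSpace ℝ (Fin K)) × A i =>
      deviationProfile E σ i t d p.1 p.2 := by
  refine measurable_pi_lambda _ fun j => ?_
  by_cases hj : j = i
  · subst hj
    simpa only [deviationProfile, dif_pos] using measurable_snd
  · simp only [deviationProfile, dif_neg hj]
    exact ((σ j).measurable_action (E j) t).comp
      (f := fun p : ({j // j ≠ i} → EuclideanSpace ℝ (Fin K)) × A i => (p.1 ⟨j, hj⟩, d j))
      (by fun_prop)

theorem finalAction_update {E : ι → Environment K} {σ σ' : ∀ i, Strategy K B (A i)} {i : ι}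
    (h : ∀ j ≠ i, σ' j = σ j) (t : ℕ) (x : States ι K)
    (d : ι → unitInterval × (ℕ × Fin B → ℝ)) (y : unitInterval × (ℕ × Fin B → ℝ)) :
    finalAction E σ' (t, x, Function.update d i y) =
      deviationProfile E σ i t d (fun j => x.2 j) ((σ' i).action (E i) t (x.2 i, y)) := by
  funext j
  by_cases hj : j = i
  · subst hj
    simp [finalAction, deviationProfile, Strategy.action, Acquisition.data]
  · simp [finalAction, deviationProfile, Strategy.action, Acquisition.data, hj, h j hj]

end Profile

section Dominance

variable {ι : Type*} [Fintype ι] {K B : ℕ} {A : ι → Type*} [∀ i, MeasurableSpace (A i)]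

theorem lintegral_nature_eq_of_forall_ne [DecidableEq ι] (E : ι → Environment K)
    {σ σ' : ∀ j, Strategy K B (A j)} {i : ι} (hσ : ∀ j ≠ i, σ' j = σ j) (final : PMF ℕ)
    (P : Measure (States ι K)) [SFinite P] {H : (∀ j, A j) × ℝ → ENNReal} (hH : Measurable H) :
    ∫⁻ x, H (finalAction E σ' x, x.2.1.1) ∂(nature B final P) =
      ∫⁻ t, ∫⁻ d, ∫⁻ x, ∫⁻ y, H (deviationProfile E σ i t d (fun j => x.2 j)
        ((σ' i).action (E i) t (x.2 i, y)), x.1) ∂(deviceLaw B) ∂P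
        ∂(Measure.pi fun _ : ι => deviceLaw B) ∂final.toMeasure := by
  have payoff_measurable : Measurable fun x : Outcome ι K B => H (finalAction E σ' x, x.2.1.1) :=
    hH.comp ((measurable_finalAction E σ').prodMk (by fun_prop))
  have resample := measurePreserving_update (fun _ : ι => deviceLaw B) i
  rw [nature, lintegral_prod _ payoff_measurable.aemeasurable]
  refine lintegral_congr fun t => ?_
  have payoff_measurable_t : Measurable fun p : States ι K × (ι → unitInterval × (ℕ × Fin B → ℝ)) =>
      H (finalAction E σ' (t, p), p.1.1) := payoff_measurable.comp measurable_prodMk_left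
  have device_measurable := payoff_measurable_t.lintegral_prod_left' (μ := P)
  have pair_measurable : Measurable fun p : (ι → unitInterval × (ℕ × Fin B → ℝ)) ×
      (unitInterval × (ℕ × Fin B → ℝ)) =>
      ∫⁻ x, H (finalAction E σ' (t, x, Function.update p.1 i p.2), x.1) ∂P :=
    device_measurable.comp resample.measurable
  rw [lintegral_prod_symm _ payoff_measurable_t.aemeasurable,
    ← resample.lintegral_comp device_measurable, lintegral_prod _ pair_measurable.aemeasurable]
  refine lintegral_congr fun d => ?_
  simp only [← finalAction_update hσ]
  refine lintegral_lintegral_swap ?_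
  exact (payoff_measurable_t.comp (f := fun p : (unitInterval × (ℕ × Fin B → ℝ)) × States ι K =>
    (p.2, Function.update d i p.1)) (measurable_snd.prodMk
      ((measurable_update d).comp measurable_fst))).aemeasurable

theorem IsCommonPrior.exists_decision_map_finalAction_eq [NeZero K] [DecidableEq ι]
    {E : ι → Environment K} {P : Measure (States ι K)} [IsProbabilityMeasure P]
    (hP : IsCommonPrior E P) {i : ι} (hE : (E i).Regular) {S : Acquisition K B}
    (hS : ∀ t r (h : History B t), IsOptimalCount (E i).posteriorVariance (t * B) (S.division r h))
    (final : PMF ℕ) (σ : ∀ j, Strategy K B (A j)) :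
    ∃ δ : Decision B (A i),
      (nature B final P).map
          (fun x => (finalAction E (Function.update σ i ⟨S, δ⟩) x, x.2.1.1)) =
        (nature B final P).map fun x => (finalAction E σ x, x.2.1.1) := by
  obtain ⟨m, hm⟩ := hP.gaussian i
  obtain ⟨δ, hδ⟩ := hE.exists_decision_map_action_eq hS (σ i) m
  have measurable_outcome : ∀ σ : ∀ j, Strategy K B (A j),
      Measurable fun x : Outcome ι K B => (finalAction E σ x, x.2.1.1) := fun σ =>
    (measurable_finalAction E σ).prodMk (by fun_prop)
  refine ⟨δ, Measure.ext_of_lintegral _ fun H hH => ?_⟩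
  rw [lintegral_map hH (measurable_outcome _), lintegral_map hH (measurable_outcome _),
    lintegral_nature_eq_of_forall_ne E (fun j hj => Function.update_of_ne hj _ σ) final P hH,
    lintegral_nature_eq_of_forall_ne E (σ := σ) (i := i) (fun _ _ => rfl) final P hH]
  simp only [Function.update_self]
  refine lintegral_congr fun t => lintegral_congr fun d => ?_
  have same_law := hδ t
  rw [← hm] at same_law
  have hR : Measurable fun p : (ℝ × ({j // j ≠ i} → EuclideanSpace ℝ (Fin K))) × A i =>
      H (deviationProfile E σ i t d p.1.2 p.2, p.1.1) :=
    hH.comp (((measurable_deviationProfile E σ i t d).comp (f := fun p :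
      (ℝ × ({j // j ≠ i} → EuclideanSpace ℝ (Fin K))) × A i => (p.1.2, p.2))
      (by fun_prop)).prodMk (by fun_prop))
  exact lintegral_lintegral_congr_of_condIndepFun (θ := fun x : States ι K => x.2 i)
    (f := fun θ : EuclideanSpace ℝ (Fin K) => θ 0)
    (W := fun x => (x.1, fun j : {j // j ≠ i} => x.2 j)) (by fun_prop) (by fun_prop) (by fun_prop)
    (hP.condIndep i) (Strategy.measurable_action _ (E i) t) (Strategy.measurable_action _ (E i) t)
    same_law hR

theorem expectedPayoff_congr {E : ι → Environment K} {P : Measure (States ι K)}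
    {G : Payoffs A} {σ σ' : ∀ j, Strategy K B (A j)} {i : ι}
    (h : (nature B G.final P).map (fun x => (finalAction E σ x, x.2.1.1)) =
      (nature B G.final P).map fun x => (finalAction E σ' x, x.2.1.1)) :
    expectedPayoff E P G σ i = expectedPayoff E P G σ' i := by
  have measurable_outcome : ∀ σ : ∀ j, Strategy K B (A j),
      Measurable fun x : Outcome ι K B => (finalAction E σ x, x.2.1.1) := fun σ =>
    (measurable_finalAction E σ).prodMk (by fun_prop)
  have lintegral_congr : ∀ H : (∀ j, A j) × ℝ → ENNReal, Measurable H →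
      ∫⁻ x, H (finalAction E σ x, x.2.1.1) ∂(nature B G.final P) =
        ∫⁻ x, H (finalAction E σ' x, x.2.1.1) ∂(nature B G.final P) := fun H hH => by
    rw [← lintegral_map hH (measurable_outcome σ), h, lintegral_map hH (measurable_outcome σ')]
  have hu := G.measurable_u i
  have positive_part := lintegral_congr (fun p => ENNReal.ofReal (G.u i p.1 p.2)) (by fun_prop)
  have negative_part := lintegral_congr (fun p => ENNReal.ofReal (-G.u i p.1 p.2)) (by fun_prop)
  simp only [expectedPayoff, realizedPayoff, positive_part, negative_part]

variable [DecidableEq ι]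

theorem IsCommonPrior.isDominant [NeZero K] {E : ι → Environment K} {P : Measure (States ι K)}
    [IsProbabilityMeasure P] (hP : IsCommonPrior E P) (G : Payoffs A) {i : ι} (hE : (E i).Regular)
    {S : Acquisition K B}
    (hS : ∀ t r (h : History B t),
      IsOptimalCount (E i).posteriorVariance (t * B) (S.division r h)) :
    IsDominant E P G i S := by
  intro σ
  obtain ⟨δ, hδ⟩ := hP.exists_decision_map_finalAction_eq hE hS G.final σ
  exact ⟨δ, (expectedPayoff_congr hδ).ge⟩

theorem IsDecisionEquilibrium.isNash {E : ι → Environment K} {P : Measure (States ι K)}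
    {G : Payoffs A} {σ : ∀ j, Strategy K B (A j)} (hσ : IsDecisionEquilibrium E P G σ)
    (h : ∀ i, IsDominant E P G i (σ i).acquisition) : IsNash E P G σ := by
  refine fun i => ⟨(hσ i).1, fun τ => ?_⟩
  obtain ⟨δ, hδ⟩ := h i (Function.update σ i τ)
  rw [Function.update_idem] at hδ
  exact hδ.trans ((hσ i).2 δ)

end Dominance

end InfoGame

section GaussianShift

theorem withDensity_gaussianReal_standard (a : ℝ) :
    (gaussianReal 0 1).withDensity (fun z => ENNReal.ofReal (Real.exp (a * z - a ^ 2 / 2))) =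
      gaussianReal a 1 := by
  rw [gaussianReal_of_var_ne_zero 0 one_ne_zero, gaussianReal_of_var_ne_zero a one_ne_zero,
    ← withDensity_mul _ (measurable_gaussianPDF 0 1) (by fun_prop)]
  congr 1
  ext z
  rw [Pi.mul_apply, gaussianPDF, gaussianPDF, ← ENNReal.ofReal_mul (gaussianPDFReal_nonneg _ _ _),
    gaussianPDFReal, gaussianPDFReal, mul_assoc, ← Real.exp_add]
  congr 3
  simp
  ring

theorem integrable_gaussianShift (a : ℝ) :
    Integrable (fun z => Real.exp (a * z - a ^ 2 / 2)) (gaussianReal 0 1) := by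
  simp only [sub_eq_add_neg, Real.exp_add]
  exact (integrable_exp_mul_gaussianReal a).mul_const _

variable {J : Type*} [Fintype J]

/-- The density of the Gaussian vector with independent components of variance one and with the
mean `x`, relative to the standard one. -/
noncomputable def gaussianShift (x h : J → ℝ) : ℝ := ∏ p, Real.exp (x p * h p - x p ^ 2 / 2)

theorem gaussianShift_nonneg (x h : J → ℝ) : 0 ≤ gaussianShift x h :=
  Finset.prod_nonneg fun _ _ => (Real.exp_pos _).le

theorem measurable_gaussianShift :
    Measurable fun p : (J → ℝ) × (J → ℝ) => gaussianShift p.1 p.2 := by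
  unfold gaussianShift
  fun_prop

theorem measurable_gaussianShift_right (x : J → ℝ) : Measurable (gaussianShift x) :=
  measurable_gaussianShift.comp (by fun_prop : Measurable fun h => (x, h))

theorem pi_gaussianReal_eq_withDensity (x : J → ℝ) :
    Measure.pi (fun p => gaussianReal (x p) 1) =
      (Measure.pi fun _ : J => gaussianReal 0 1).withDensity
        fun h => ENNReal.ofReal (gaussianShift x h) := by
  refine Measure.pi_eq fun s hs => ?_
  rw [withDensity_apply _ (MeasurableSet.univ_pi hs), Measure.restrict_pi_pi]
  have hint : ∀ p, Integrable (fun z => Real.exp (x p * z - x p ^ 2 / 2))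
      ((gaussianReal 0 1).restrict (s p)) := fun p => (integrable_gaussianShift (x p)).restrict
  unfold gaussianShift
  rw [← ofReal_integral_eq_lintegral_ofReal (Integrable.fintype_prod hint)
      (ae_of_all _ fun h => gaussianShift_nonneg x h),
    integral_fintype_prod_eq_prod (f := fun p z => Real.exp (x p * z - x p ^ 2 / 2)),
    ENNReal.ofReal_prod_of_nonneg fun p _ => integral_nonneg fun z => (Real.exp_pos _).le]
  refine Finset.prod_congr rfl fun p _ => ?_
  rw [ofReal_integral_eq_lintegral_ofReal (hint p) (ae_of_all _ fun z => (Real.exp_pos _).le),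
    ← withDensity_apply _ (hs p), withDensity_gaussianReal_standard]

theorem map_add_pi_gaussianReal (x : J → ℝ) :
    (Measure.pi fun _ : J => gaussianReal 0 1).map (fun e p => x p + e p) =
      (Measure.pi fun _ : J => gaussianReal 0 1).withDensity
        fun h => ENNReal.ofReal (gaussianShift x h) := by
  rw [Measure.pi_map_pi (f := fun p z => x p + z) (fun p => by fun_prop),
    ← pi_gaussianReal_eq_withDensity]
  simp only [gaussianReal_map_const_add, zero_add]

theorem integral_add_pi_gaussianReal (x : J → ℝ) {s : (J → ℝ) → ℝ} (hs : Measurable s) :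
    ∫ e, s (fun p => x p + e p) ∂(Measure.pi fun _ : J => gaussianReal 0 1) =
      ∫ h, s h * gaussianShift x h ∂(Measure.pi fun _ : J => gaussianReal 0 1) := by
  have hm : Measurable fun (e : J → ℝ) p => x p + e p := by fun_prop
  rw [← integral_map hm.aemeasurable hs.aestronglyMeasurable, map_add_pi_gaussianReal,
    integral_withDensity_eq_integral_toReal_smul
      (measurable_gaussianShift_right x).ennreal_ofReal
      (ae_of_all _ fun _ => ENNReal.ofReal_lt_top)]
  refine integral_congr_ae (ae_of_all _ fun h => ?_)
  simp only
  rw [ENNReal.toReal_ofReal (gaussianShift_nonneg x h), smul_eq_mul, mul_comm]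

theorem memLp_gaussianShift (x : J → ℝ) :
    MemLp (gaussianShift x) 2 (Measure.pi fun _ : J => gaussianReal 0 1) := by
  rw [memLp_two_iff_integrable_sq (measurable_gaussianShift_right x).aestronglyMeasurable]
  have : (fun h => gaussianShift x h ^ 2) = fun h : J → ℝ =>
      ∏ p, (fun z => Real.exp (2 * x p * z) * Real.exp (-(x p ^ 2))) (h p) := by
    ext h
    rw [gaussianShift, ← Finset.prod_pow]
    refine Finset.prod_congr rfl fun p _ => ?_
    simp only
    rw [← Real.exp_add, ← Real.exp_nat_mul]
    congr 1
    push_cast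
    ring
  rw [this]
  exact Integrable.fintype_prod (f := fun p z => Real.exp (2 * x p * z) * Real.exp (-(x p ^ 2)))
    fun p => (integrable_exp_mul_gaussianReal _).mul_const _

/-- The density `gaussianShift x` as an element of `L²`. -/
noncomputable def gaussianShiftLp (x : J → ℝ) :
    Lp ℝ 2 (Measure.pi fun _ : J => gaussianReal 0 1) :=
  (memLp_gaussianShift x).toLp _

theorem coeFn_gaussianShiftLp (x : J → ℝ) :
    gaussianShiftLp x =ᵐ[Measure.pi fun _ : J => gaussianReal 0 1] gaussianShift x :=
  (memLp_gaussianShift x).coeFn_toLp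

theorem integral_gaussianShiftLp_mul (x : J → ℝ) {s : (J → ℝ) → ℝ} (hs : Measurable s) :
    ∫ h, s h * gaussianShiftLp x h ∂(Measure.pi fun _ : J => gaussianReal 0 1) =
      ∫ e, s (fun p => x p + e p) ∂(Measure.pi fun _ : J => gaussianReal 0 1) := by
  rw [integral_add_pi_gaussianReal x hs]
  refine integral_congr_ae ?_
  filter_upwards [coeFn_gaussianShiftLp x] with h hh
  rw [hh]

theorem measurable_apply_gaussianShiftLp
    (ψ : WeakDual ℝ (Lp ℝ 2 (Measure.pi fun _ : J => gaussianReal 0 1))) :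
    Measurable fun x => ψ (gaussianShiftLp x) := by
  set f := (InnerProductSpace.toDual ℝ _).symm (WeakDual.toStrongDual ψ) with hf
  have h : ∀ g, ψ g = inner ℝ f g := fun g => by
    rw [hf, InnerProductSpace.toDual_symm_apply]
    rfl
  have h' : (fun x => ψ (gaussianShiftLp x)) = fun x : J → ℝ =>
      ∫ y, f y * gaussianShift x y ∂(Measure.pi fun _ : J => gaussianReal 0 1) := by
    ext x
    rw [h, L2.inner_def]
    refine integral_congr_ae ?_
    filter_upwards [coeFn_gaussianShiftLp x] with y hy
    rw [hy]
    simp [mul_comm]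
  rw [h']
  have hfm : Measurable fun y => f y := (Lp.stronglyMeasurable f).measurable
  have hsm : StronglyMeasurable fun p : (J → ℝ) × (J → ℝ) => f p.2 * gaussianShift p.1 p.2 :=
    ((hfm.comp measurable_snd).mul measurable_gaussianShift).stronglyMeasurable
  exact hsm.integral_prod_right'.measurable

theorem isSignalDensity_gaussianShiftLp {Ω : Type*} [MeasurableSpace Ω] {f : Ω → J → ℝ}
    (hf : Measurable f) : IsSignalDensity fun ω => gaussianShiftLp (f ω) where
  nonneg ω := by
    rw [← Lp.coeFn_nonneg]
    filter_upwards [coeFn_gaussianShiftLp (f ω)] with h hh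
    rw [hh]
    exact gaussianShift_nonneg _ h
  integral_eq_one ω := by
    simpa using integral_gaussianShiftLp_mul (f ω) (s := fun _ => 1) measurable_const
  measurable_apply ψ := (measurable_apply_gaussianShiftLp ψ).comp hf

end GaussianShift

section Behavior

variable {A : Type*} [MeasurableSpace A]

namespace IsBehavior

variable [Fintype A] {T : Type*} [MeasurableSpace T] {s : T → A → ℝ}

/-- The Markov kernel that draws an action according to the behavior strategy. -/
noncomputable def kernel (hs : IsBehavior s) : Kernel T A where
  toFun x := ∑ a, ENNReal.ofReal (s x a) • Measure.dirac a
  measurable' := by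
    refine Measure.measurable_of_measurable_coe _ fun U _ => ?_
    simp only [Measure.coe_finsetSum, Finset.sum_apply, Measure.smul_apply, smul_eq_mul]
    have := hs.measurable_apply
    fun_prop

theorem kernel_apply (hs : IsBehavior s) (x : T) :
    hs.kernel x = ∑ a, ENNReal.ofReal (s x a) • Measure.dirac a := rfl

instance isMarkovKernel_kernel (hs : IsBehavior s) : IsMarkovKernel hs.kernel where
  isProbabilityMeasure x := ⟨by
    simp only [kernel_apply, Measure.coe_finsetSum, Finset.sum_apply, Measure.smul_apply,
      smul_eq_mul, measure_univ, mul_one]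
    rw [← ENNReal.ofReal_sum_of_nonneg fun a _ => hs.nonneg x a, hs.sum_eq_one,
      ENNReal.ofReal_one]⟩

variable [MeasurableSingletonClass A]

theorem kernel_real_singleton (hs : IsBehavior s) (x : T) (a : A) :
    (hs.kernel x).real {a} = s x a := by
  rw [kernel_apply, measureReal_def, Measure.coe_finsetSum, Finset.sum_apply,
    Finset.sum_eq_single a]
  · simp [hs.nonneg]
  · intro b _ hb
    simp [hb]
  · simp

theorem exists_measurable_volume_real_eq [Nonempty A] (hs : IsBehavior s) :
    ∃ f : T → unitInterval → A, Measurable (Function.uncurry f) ∧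
      ∀ x a, (volume : Measure unitInterval).real {r | f x r = a} = s x a := by
  obtain ⟨f, hf, hfκ⟩ := Kernel.exists_measurable_map_eq_unitInterval hs.kernel
  refine ⟨f, hf, fun x a => ?_⟩
  have hfx : Measurable (f x) := hf.comp measurable_prodMk_left
  rw [← hs.kernel_real_singleton x a, ← hfκ x,
    map_measureReal_apply hfx (measurableSet_singleton a)]
  rfl

end IsBehavior

namespace InfoGame

variable {B : ℕ}

/-- The probabilities of the actions in period `t`, given the realizations. -/
noncomputable def Decision.behavior (δ : Decision B A) (t : ℕ) (h : Fin t × Fin B → ℝ) (a : A) :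
    ℝ :=
  (volume : Measure unitInterval).real {r | δ.act t r (fun s b => h (s, b)) = a}

variable [MeasurableSingletonClass A]

theorem Decision.measurableSet_act (δ : Decision B A) (t : ℕ) (a : A) :
    MeasurableSet {p : (Fin t × Fin B → ℝ) × unitInterval |
      δ.act t p.2 (fun s b => p.1 (s, b)) = a} :=
  ((δ.measurable_act t).comp (f := fun p : (Fin t × Fin B → ℝ) × unitInterval =>
    (p.2, fun s b => p.1 (s, b))) (by fun_prop)) (measurableSet_singleton a)

theorem Decision.measurable_behavior_apply (δ : Decision B A) (t : ℕ) (a : A) :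
    Measurable fun h => δ.behavior t h a :=
  (measurable_measure_prodMk_left (δ.measurableSet_act t a)).ennreal_toReal

theorem Decision.isBehavior_behavior [Fintype A] (δ : Decision B A) (t : ℕ) :
    IsBehavior (δ.behavior t) where
  measurable_apply a := δ.measurable_behavior_apply t a
  nonneg _ _ := measureReal_nonneg
  sum_eq_one h := by
    have := sum_measureReal_preimage_singleton (μ := (volume : Measure unitInterval)) Finset.univ
      (f := fun r => δ.act t r (fun s b => h (s, b)))
      (fun a _ => measurable_prodMk_left (δ.measurableSet_act t a))
    rwa [Finset.coe_univ, Set.preimage_univ, probReal_univ] at this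

theorem exists_decision_behavior_eq [Fintype A] [Nonempty A]
    {s : ∀ t, (Fin t × Fin B → ℝ) → A → ℝ} (hs : ∀ t, IsBehavior (s t)) :
    ∃ δ : Decision B A, ∀ t, δ.behavior t = s t := by
  choose f hf hfs using fun t => (hs t).exists_measurable_volume_real_eq
  refine ⟨⟨fun t r h => f t (fun p => h p.1 p.2) r, fun t => ?_⟩,
    fun t => funext₂ fun h a => hfs t h a⟩
  exact (hf t).comp (f := fun p : unitInterval × History B t =>
    ((fun q : Fin t × Fin B => p.2 q.1 q.2), p.1)) (by fun_prop)

end InfoGame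

end Behavior

namespace InfoGame

variable {K B : ℕ}

/-- The acquisition strategy that ignores all data and follows the path `c`. -/
def Acquisition.ofPath (c : ℕ → Fin B → Fin K) : Acquisition K B :=
  ⟨fun t _ _ => c t, fun _ => measurable_const⟩

theorem Acquisition.exists_isMyopic_ofPath [NeZero K] (E : Environment K) (B : ℕ) :
    ∃ c : ℕ → Fin B → Fin K, (Acquisition.ofPath c).IsMyopic E := by
  choose g hg using fun q : Fin K → ℕ =>
    Finite.exists_min fun c : Fin B → Fin K => E.posteriorVariance (q + count c)
  let q (t : ℕ) : Fin K → ℕ := Nat.rec 0 (fun _ q => q + count (g q)) t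
  have hq : ∀ t, q (t + 1) = q t + count (g (q t)) := fun t => rfl
  refine ⟨fun t => g (q t), fun t r h c => ?_⟩
  have hdiv : (Acquisition.ofPath fun t => g (q t)).division r h = q t := by
    funext k
    change ∑ s : Fin t, count (g (q s)) k = q t k
    clear h
    induction t with
    | zero => rfl
    | succ t ih =>
      rw [Fin.sum_univ_castSucc, hq, Pi.add_apply]
      simp only [Fin.val_castSucc, Fin.val_last, ih]
  rw [hdiv]
  exact hg (q t) c

/-- The means of the signals that are acquired along the path `c`. -/
def signalMean (E : Environment K) (c : ℕ → Fin B → Fin K) (t : ℕ)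
    (θ : EuclideanSpace ℝ (Fin K)) (p : Fin t × Fin B) : ℝ :=
  ∑ l, E.coeff (c p.1 p.2) l * θ l

theorem measurable_signalMean (E : Environment K) (c : ℕ → Fin B → Fin K) (t : ℕ) :
    Measurable (signalMean E c t) := by
  unfold signalMean
  fun_prop

theorem Acquisition.history_ofPath (E : Environment K) (c : ℕ → Fin B → Fin K)
    (θ : EuclideanSpace ℝ (Fin K)) (r : unitInterval) (e : ℕ × Fin B → ℝ) (t : ℕ) :
    (Acquisition.ofPath c).history E θ r e t =
      fun s b => signalMean E c t θ (s, b) + e ((s : ℕ), b) := by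
  ext s b
  rw [history_apply]
  rfl

theorem integrable_indicator_singleton_comp {X A : Type*} [MeasurableSpace X] [MeasurableSpace A]
    [MeasurableSingletonClass A] {μ : Measure X} [IsFiniteMeasure μ] {f : X → A}
    (hf : Measurable f) (a : A) :
    Integrable (fun x => Set.indicator {a} (fun _ => (1 : ℝ)) (f x)) μ :=
  (integrable_const (1 : ℝ)).indicator (hf (measurableSet_singleton a))

variable {A : Type*} [MeasurableSpace A] [MeasurableSingletonClass A]

theorem integral_indicator_action_ofPath (E : Environment K) (c : ℕ → Fin B → Fin K)
    (δ : Decision B A) (t : ℕ) (θ : EuclideanSpace ℝ (Fin K)) (a : A) :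
    ∫ y, Set.indicator {a} (fun _ => (1 : ℝ))
      ((⟨Acquisition.ofPath c, δ⟩ : Strategy K B A).action E t (θ, y)) ∂(deviceLaw B) =
    ∫ e, δ.behavior t (fun p => signalMean E c t θ p + e p) a
      ∂(Measure.pi fun _ : Fin t × Fin B => gaussianReal 0 1) := by
  have hmeas : Measurable fun y =>
      (⟨Acquisition.ofPath c, δ⟩ : Strategy K B A).action E t (θ, y) :=
    (Strategy.measurable_action _ E t).comp measurable_prodMk_left
  have hbehavior : Measurable fun e : Fin t × Fin B → ℝ =>
      δ.behavior t (fun p => signalMean E c t θ p + e p) a :=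
    (δ.measurable_behavior_apply t a).comp
      (f := fun (e : Fin t × Fin B → ℝ) p => signalMean E c t θ p + e p) (by fun_prop)
  have hnoise := measurePreserving_noise B t
  rw [← hnoise.map_eq, integral_map hnoise.measurable.aemeasurable
    hbehavior.aestronglyMeasurable,
    integral_prod_symm _ (integrable_indicator_singleton_comp hmeas a)]
  refine integral_congr_ae (ae_of_all _ fun e => ?_)
  simp only [Strategy.action, Acquisition.data, Acquisition.history_ofPath]
  exact integral_indicator_one (measurable_prodMk_left
    (x := fun p : Fin t × Fin B => signalMean E c t θ p + e ((p.1 : ℕ), p.2))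
    (δ.measurableSet_act t a))

theorem integral_indicator_action_eq_apply (E : Environment K) (c : ℕ → Fin B → Fin K)
    (δ : Decision B A) (t : ℕ) (θ : EuclideanSpace ℝ (Fin K)) (a : A)
    {φ : A → WeakDual ℝ (Lp ℝ 2 (Measure.pi fun _ : Fin t × Fin B => gaussianReal 0 1))}
    (hφ : Represents _ (δ.behavior t) φ) :
    ∫ y, Set.indicator {a} (fun _ => (1 : ℝ))
      ((⟨Acquisition.ofPath c, δ⟩ : Strategy K B A).action E t (θ, y)) ∂(deviceLaw B) =
    φ a (gaussianShiftLp (signalMean E c t θ)) := by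
  rw [integral_indicator_action_ofPath, hφ,
    integral_gaussianShiftLp_mul _ (δ.measurable_behavior_apply t a)]

end InfoGame

namespace InfoGame

variable {ι : Type*} {K B : ℕ} {A : ι → Type*} [∀ i, MeasurableSpace (A i)]

theorem integrable_payoff_comp [Finite ι] [∀ i, Finite (A i)] {P : Measure (States ι K)}
    {G : Payoffs A} {i : ι} (hu : ∀ a, Integrable (fun x : States ι K => G.u i a x.1) P)
    {X : Type*} [MeasurableSpace X] {μ : Measure X} {a : X → ∀ j, A j} {x : X → States ι K}
    (ha : Measurable a) (hx : MeasurePreserving x μ P) :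
    Integrable (fun y => G.u i (a y) (x y).1) μ := by
  have := Fintype.ofFinite (∀ j, A j)
  have hsum : Integrable (fun x : States ι K => ∑ a, |G.u i a x.1|) P :=
    integrable_finsetSum _ fun a _ => (hu a).abs
  refine (hx.integrable_comp_of_integrable hsum).mono' ?_ (ae_of_all _ fun y => ?_)
  · exact ((G.measurable_u i).comp
      (ha.prodMk (measurable_fst.comp hx.measurable))).aestronglyMeasurable
  · exact Finset.single_le_sum (f := fun a => |G.u i a (x y).1|) (fun a _ => abs_nonneg _)
      (Finset.mem_univ _)

theorem Acquisition.update_ofPath [DecidableEq ι] (c : ι → ℕ → Fin B → Fin K)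
    (δ : ∀ j, Decision B (A j)) (i : ι) (δ' : Decision B (A i)) :
    Function.update (fun j => (⟨Acquisition.ofPath (c j), δ j⟩ : Strategy K B (A j))) i
      ⟨Acquisition.ofPath (c i), δ'⟩ =
    fun j => ⟨Acquisition.ofPath (c j), Function.update δ i δ' j⟩ :=
  (funext fun j => Function.apply_update
    (fun j d => (⟨Acquisition.ofPath (c j), d⟩ : Strategy K B (A j))) δ i δ' j).symm

/-- The density of the realizations of the first `t` periods along the paths `c`, relative to the
distribution of the noise. -/
noncomputable def signalDensity (E : ι → Environment K) (c : ι → ℕ → Fin B → Fin K) (t : ℕ)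
    (j : ι) (x : States ι K) : Lp ℝ 2 (Measure.pi fun _ : Fin t × Fin B => gaussianReal 0 1) :=
  gaussianShiftLp (signalMean (E j) (c j) t (x.2 j))

theorem isSignalDensity_signalDensity (E : ι → Environment K) (c : ι → ℕ → Fin B → Fin K)
    (t : ℕ) (j : ι) : IsSignalDensity (signalDensity E c t j) :=
  isSignalDensity_gaussianShiftLp
    ((measurable_signalMean (E j) (c j) t).comp (f := fun x : States ι K => x.2 j) (by fun_prop))

variable [Fintype ι]

theorem expectedPayoff_eq_integral {E : ι → Environment K} {P : Measure (States ι K)}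
    {G : Payoffs A} {σ : ∀ j, Strategy K B (A j)} {i : ι}
    (h : Integrable (realizedPayoff E G σ i) (nature B G.final P)) :
    expectedPayoff E P G σ i = (∫ x, realizedPayoff E G σ i x ∂(nature B G.final P) : ℝ) := by
  rw [integral_eq_lintegral_pos_part_sub_lintegral_neg_part h, expectedPayoff, EReal.coe_sub]
  have hpos : ∫⁻ x, ENNReal.ofReal (realizedPayoff E G σ i x) ∂(nature B G.final P) ≠ ⊤ :=
    h.lintegral_lt_top.ne
  have hneg : ∫⁻ x, ENNReal.ofReal (-realizedPayoff E G σ i x) ∂(nature B G.final P) ≠ ⊤ :=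
    h.neg.lintegral_lt_top.ne
  rw [← EReal.toReal_coe_ennreal, ← EReal.toReal_coe_ennreal,
    EReal.coe_toReal (by simpa using hpos) (by simp),
    EReal.coe_toReal (by simpa using hneg) (by simp)]

theorem integrable_realizedPayoff [∀ i, Finite (A i)] (E : ι → Environment K)
    {P : Measure (States ι K)} [IsProbabilityMeasure P] {G : Payoffs A} {i : ι}
    (hu : ∀ a, Integrable (fun x : States ι K => G.u i a x.1) P)
    (σ : ∀ j, Strategy K B (A j)) :
    Integrable (realizedPayoff E G σ i) (nature B G.final P) :=
  integrable_payoff_comp hu (x := fun y : Outcome ι K B => y.2.1) (measurable_finalAction E σ)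
    (measurePreserving_fst.comp measurePreserving_snd)

theorem integrable_realizedPayoff_of_period [∀ i, Finite (A i)] (E : ι → Environment K)
    {P : Measure (States ι K)} {G : Payoffs A} {i : ι}
    (hu : ∀ a, Integrable (fun x : States ι K => G.u i a x.1) P)
    (σ : ∀ j, Strategy K B (A j)) (t : ℕ) :
    Integrable (fun p => realizedPayoff E G σ i (t, p))
      (P.prod (Measure.pi fun _ : ι => deviceLaw B)) :=
  integrable_payoff_comp hu (measurable_finalAction_of_period E σ t) measurePreserving_fst

section Finite

variable [∀ i, Fintype (A i)]

theorem realizedPayoff_eq_sum [DecidableEq ι] (E : ι → Environment K) (G : Payoffs A)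
    (σ : ∀ j, Strategy K B (A j)) (i : ι) (t : ℕ) (x : States ι K)
    (d : ι → unitInterval × (ℕ × Fin B → ℝ)) :
    realizedPayoff E G σ i (t, x, d) = ∑ a, G.u i a x.1 *
      ∏ j, Set.indicator {a j} (fun _ => (1 : ℝ)) ((σ j).action (E j) t (x.2 j, d j)) := by
  rw [Finset.sum_eq_single fun j => (σ j).action (E j) t (x.2 j, d j)]
  · simp only [Set.mem_singleton_iff, Set.indicator_of_mem, Finset.prod_const_one, mul_one]
    rfl
  · intro a _ ha
    obtain ⟨j, hj⟩ := Function.ne_iff.1 ha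
    rw [Finset.prod_eq_zero (Finset.mem_univ j), mul_zero]
    exact Set.indicator_of_notMem (fun h => hj (Set.mem_singleton_iff.1 h).symm) _
  · exact fun h => absurd (Finset.mem_univ _) h

variable [∀ i, MeasurableSingletonClass (A i)]

theorem integral_realizedPayoff_of_period [DecidableEq ι] (E : ι → Environment K) (G : Payoffs A)
    (σ : ∀ j, Strategy K B (A j)) (i : ι) (t : ℕ) (x : States ι K) :
    ∫ d, realizedPayoff E G σ i (t, x, d) ∂(Measure.pi fun _ : ι => deviceLaw B) =
      ∑ a, G.u i a x.1 * ∏ j, ∫ y, Set.indicator {a j} (fun _ => (1 : ℝ))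
        ((σ j).action (E j) t (x.2 j, y)) ∂(deviceLaw B) := by
  have hint (a : ∀ j, A j) (j : ι) : Integrable (fun y => Set.indicator {a j}
      (fun _ => (1 : ℝ)) ((σ j).action (E j) t (x.2 j, y))) (deviceLaw B) :=
    integrable_indicator_singleton_comp
      (((σ j).measurable_action (E j) t).comp measurable_prodMk_left) (a j)
  simp only [realizedPayoff_eq_sum]
  rw [integral_finsetSum _ fun a _ => (Integrable.fintype_prod (hint a)).const_mul _]
  refine Finset.sum_congr rfl fun a _ => ?_
  rw [integral_const_mul, integral_fintype_prod_eq_prod (f := fun j y =>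
    Set.indicator {a j} (fun _ => (1 : ℝ)) ((σ j).action (E j) t (x.2 j, y)))]

theorem integral_realizedPayoff_eq_signalPayoff [DecidableEq ι] (E : ι → Environment K)
    {P : Measure (States ι K)} [IsProbabilityMeasure P] {G : Payoffs A} {i : ι}
    (hu : ∀ a, Integrable (fun x : States ι K => G.u i a x.1) P)
    (c : ι → ℕ → Fin B → Fin K) (δ : ∀ j, Decision B (A j)) (t : ℕ)
    {φ : ∀ j, A j → WeakDual ℝ (Lp ℝ 2 (Measure.pi fun _ : Fin t × Fin B => gaussianReal 0 1))}
    {χ : A i → WeakDual ℝ (Lp ℝ 2 (Measure.pi fun _ : Fin t × Fin B => gaussianReal 0 1))}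
    (hφ : ∀ j ≠ i, Represents _ ((δ j).behavior t) (φ j))
    (hχ : Represents _ ((δ i).behavior t) χ) :
    ∫ p, realizedPayoff E G (fun j => ⟨Acquisition.ofPath (c j), δ j⟩) i (t, p)
      ∂(P.prod (Measure.pi fun _ : ι => deviceLaw B)) =
    signalPayoff P (signalDensity E c t) (fun a x => G.u i a x.1) i φ χ := by
  rw [integral_prod _ (integrable_realizedPayoff_of_period E hu _ t), signalPayoff]
  refine integral_congr_ae (ae_of_all _ fun x => ?_)
  simp only [integral_realizedPayoff_of_period]
  refine Finset.sum_congr rfl fun a _ => ?_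
  rw [← Finset.mul_prod_erase _ _ (Finset.mem_univ i),
    integral_indicator_action_eq_apply (E i) (c i) (δ i) t _ (a i) hχ]
  congr 2
  refine Finset.prod_congr rfl fun j hj => ?_
  exact integral_indicator_action_eq_apply (E j) (c j) (δ j) t _ (a j)
    (hφ j (Finset.ne_of_mem_erase hj))

end Finite

theorem exists_isDecisionEquilibrium_ofPath [DecidableEq ι] [∀ i, Finite (A i)]
    [∀ i, Nonempty (A i)] [∀ i, MeasurableSingletonClass (A i)]
    (E : ι → Environment K) {P : Measure (States ι K)} [IsProbabilityMeasure P] {G : Payoffs A}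
    (hu : ∀ i a, Integrable (fun x : States ι K => G.u i a x.1) P)
    (c : ι → ℕ → Fin B → Fin K) :
    ∃ δ : ∀ j, Decision B (A j),
      IsDecisionEquilibrium E P G fun j => ⟨Acquisition.ofPath (c j), δ j⟩ := by
  have (i : ι) := Fintype.ofFinite (A i)
  -- The final period is not influenced by the players, so each period can be solved separately.
  choose φ hφ heq using fun t => exists_signalPayoff_equilibrium
    (isSignalDensity_signalDensity E c t) (g := fun i a x => G.u i a x.1) hu
  choose s hs hsφ using fun j t => mixedFunctionals.exists_isBehavior (hφ t j)
  choose δ hδ using fun j => exists_decision_behavior_eq (B := B) (hs j)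
  have hδφ : ∀ j t, Represents _ ((δ j).behavior t) (φ t j) := fun j t => hδ j t ▸ hsφ j t
  have hint (σ : ∀ j, Strategy K B (A j)) (i : ι) :
      Integrable (realizedPayoff E G σ i) (nature B G.final P) :=
    integrable_realizedPayoff E (hu i) σ
  refine ⟨δ, fun i => ⟨hint _ i, fun δ' => ?_⟩⟩
  rw [Acquisition.update_ofPath, expectedPayoff_eq_integral (hint _ i),
    expectedPayoff_eq_integral (hint _ i), EReal.coe_le_coe_iff]
  unfold nature at hint ⊢
  rw [integral_prod _ (hint _ i), integral_prod _ (hint _ i)]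
  refine integral_mono (hint _ i).integral_prod_left (hint _ i).integral_prod_left fun t => ?_
  obtain ⟨χ, hχ, hδ'χ⟩ := mixedFunctionals.exists_represents_of_isBehavior
    (lam := Measure.pi fun _ : Fin t × Fin B => gaussianReal 0 1) (δ'.isBehavior_behavior t)
  calc _ = signalPayoff P (signalDensity E c t) (fun a x => G.u i a x.1) i (φ t) χ :=
        integral_realizedPayoff_eq_signalPayoff E (hu i) c (Function.update δ i δ') t
          (fun j hj => by rw [Function.update_of_ne hj]; exact hδφ j t)
          (by rwa [Function.update_self])
    _ ≤ signalPayoff P (signalDensity E c t) (fun a x => G.u i a x.1) i (φ t) (φ t i) :=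
        heq t i χ hχ
    _ = _ := (integral_realizedPayoff_eq_signalPayoff E (hu i) c δ t
        (fun j _ => hδφ j t) (hδφ i t)).symm

end InfoGame

theorem corollary1 {ι : Type*} [Fintype ι] [DecidableEq ι] {K : ℕ} [NeZero K]
    (E : ι → Environment K) (hE : ∀ i, (E i).Regular) :
    ∃ B₀ : ℕ, ∀ B : ℕ, 0 < B → (B₀ ≤ B ∨ ∀ i, (E i).Separable) →
      ∀ (P : Measure (States ι K)) [IsProbabilityMeasure P], IsCommonPrior E P →
      ∀ (A : ι → Type*) [∀ i, MeasurableSpace (A i)] (G : Payoffs A),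
        (∀ (i : ι) (S : Acquisition K B), S.IsMyopic (E i) → IsDominant E P G i S) ∧
        (∀ σ : ∀ i, Strategy K B (A i), (∀ i, (σ i).acquisition.IsMyopic (E i)) →
          IsDecisionEquilibrium E P G σ → IsNash E P G σ) ∧
        ((∀ i, Finite (A i) ∧ Nonempty (A i) ∧ MeasurableSingletonClass (A i)) →
          (∀ (i : ι) (a : ∀ j, A j), Integrable (fun x : States ι K => G.u i a x.1) P) →
          ∃ σ : ∀ i, Strategy K B (A i),
            (∀ i, (σ i).acquisition.IsMyopic (E i)) ∧ IsNash E P G σ) := by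
  choose B₁ hB₁ using fun i => (hE i).exists_isOptimalCount_ge
  refine ⟨Finset.univ.sup B₁, fun B hB hsep P _ hP A _ G => ?_⟩
  have hdom (i : ι) (S : Acquisition K B) (hS : S.IsMyopic (E i)) : IsDominant E P G i S :=
    hP.isDominant G (hE i) <| hS.isOptimalCount_division <| hB₁ i B hB <|
      hsep.imp (Finset.le_sup (Finset.mem_univ i)).trans fun h => h i
  refine ⟨hdom, fun σ hσ hdec => hdec.isNash fun i => hdom i _ (hσ i), fun hA hu => ?_⟩
  choose _ _ _ using hA
  choose c hc using fun i => Acquisition.exists_isMyopic_ofPath (E i) B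
  obtain ⟨δ, hδ⟩ := exists_isDecisionEquilibrium_ofPath E hu c
  exact ⟨fun j => ⟨Acquisition.ofPath (c j), δ j⟩, hc, hδ.isNash fun i => hdom i _ (hc i)⟩
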